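/- All graphs are finite, simple and undirected (not necessarily connected). For vertices $u,w$ of a graph $G$ let $I(u,w)$ be the set of vertices that lie on some shortest path between $u$ and $w$ (empty if there is no path). A set $S\subseteq V(G)$ is a geodetic set if $\bigcup_{u,w\in S}I(u,w)=V(G)$, where $u=w$ is allowed; the geodetic number $g(G)$ is the minimum cardinality of a geodetic set, and Minimum Geodetic Set asks for a geodetic set of cardinality $g(G)$. A grid embedding of $G$ represents the vertices by distinct points of $\mathbb Z^2$ such that two vertices are adjacent if and only if their points are at Euclidean distance $1$; edges are drawn as straight segments. $G$ is a solid grid graph if it has a solid grid embedding, that is, a grid embedding all of whose interior (bounded) faces have area $1$. A cut vertex is a vertex $v$ such that some two vertices other than $v$ are connected in $G$ but not in $G-v$. With respect to a grid embedding, a corner path is a path $P$ of $G$ with two distinct end-vertices, all of whose vertices have the same $x$-coordinate or all of whose vertices have the same $y$-coordinate, such that no vertex of $P$ is a cut vertex of $G$, both end-vertices have degree $2$, and all other vertices of $P$ have degree $3$. A corner vertex is a vertex that has degree $1$ or is an end-vertex of a corner path. **Theorem.** (a) There is an $O(n)$-time $3$-approximation algorithm for Minimum Geodetic Set on solid grid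 graphs with $n$ vertices. That is, there is one program for a random access machine with $O(\log n)$-bit words (unit-cost copying, addition, subtraction, comparison and indirect access) which, given the adjacency lists (in any order) of a solid grid graph $G$ on $n$ arbitrarily labelled vertices and no grid embedding, halts after $O(n)$ steps with a geodetic set of $G$ of cardinality at most $3\,g(G)$. (b) Let $G$ be a solid grid graph with a solid grid embedding, and let $C$ be its set of corner vertices. If $G$ has no isolated vertex, then $C$ is a geodetic set of $G$. Every geodetic set of $G$ contains a vertex of each corner path. Moreover $|C|\le 3\,g(G)$. -/

import Mathlib

open MeasureTheory

/-! ### Geodetic sets -/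

/-- `geodesicInterval G u w` is the set of all vertices that lie on some shortest path of `G`
between `u` and `w`; it is empty if `u` and `w` lie in different components. -/
def geodesicInterval {V : Type*} (G : SimpleGraph V) (u w : V) : Set V :=
  {x | ∃ p : G.Walk u w, p.IsPath ∧ p.length = G.dist u w ∧ x ∈ p.support}

/-- `S` is a geodetic set of `G`: the intervals between (possibly equal) vertices of `S`
cover all the vertices. -/
def IsGeodeticSet {V : Type*} (G : SimpleGraph V) (S : Set V) : Prop :=
  ∀ x : V, ∃ u ∈ S, ∃ w ∈ S, x ∈ geodesicInterval G u w

/-- The geodetic number of a finite graph: the least cardinality of a geodetic set. (The set of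
all vertices is geodetic, so the infimum is over a non-empty set.) -/
noncomputable def geodeticNumber {V : Type*} [Fintype V] (G : SimpleGraph V) : ℕ :=
  sInf {k | ∃ S : Set V, IsGeodeticSet G S ∧ S.ncard = k}

/-- `v` is a cut vertex of `G`: its deletion disconnects two vertices (different from `v`) that
are connected in `G`. -/
def IsCutVertex {V : Type*} (G : SimpleGraph V) (v : V) : Prop :=
  ∃ (a b : V) (ha : a ≠ v) (hb : b ≠ v), G.Reachable a b ∧
    ¬ (G.induce {x | x ≠ v}).Reachable ⟨a, ha⟩ ⟨b, hb⟩

/-! ### Solid grid graphs -/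

/-- A grid embedding of `G`: the vertices are distinct points with integer coordinates, and two
vertices are adjacent iff their points are at (squared) Euclidean distance one. -/
structure IsGridEmbedding {V : Type*} (G : SimpleGraph V) (φ : V → ℤ × ℤ) : Prop where
  injective : Function.Injective φ
  adj_iff : ∀ u v : V,
    G.Adj u v ↔ ((φ u).1 - (φ v).1) ^ 2 + ((φ u).2 - (φ v).2) ^ 2 = 1

/-- The point of the plane with given integer coordinates. -/
def gridPoint (p : ℤ × ℤ) : ℝ × ℝ := ((p.1 : ℝ), (p.2 : ℝ))

/-- The drawing of `G` in the plane: all its points, and a straight segment for each edge. -/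
def gridDrawing {V : Type*} (G : SimpleGraph V) (φ : V → ℤ × ℤ) : Set (ℝ × ℝ) :=
  {z | ∃ v : V, z = gridPoint (φ v)} ∪
    {z | ∃ u v : V, G.Adj u v ∧ z ∈ segment ℝ (gridPoint (φ u)) (gridPoint (φ v))}

/-- The faces of the embedding: the connected components of the complement of the drawing. -/
def IsGridFace {V : Type*} (G : SimpleGraph V) (φ : V → ℤ × ℤ) (F : Set (ℝ × ℝ)) : Prop :=
  ∃ z ∈ (gridDrawing G φ)ᶜ, F = connectedComponentIn (gridDrawing G φ)ᶜ z

/-- A solid grid embedding: a grid embedding all of whose interior (that is, bounded) faces have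
unit area. -/
def IsSolidGridEmbedding {V : Type*} (G : SimpleGraph V) (φ : V → ℤ × ℤ) : Prop :=
  IsGridEmbedding G φ ∧
    ∀ F : Set (ℝ × ℝ), IsGridFace G φ F → Bornology.IsBounded F → volume F = 1

/-- A solid grid graph: a graph that has a solid grid embedding. -/
def IsSolidGridGraph {V : Type*} (G : SimpleGraph V) : Prop :=
  ∃ φ : V → ℤ × ℤ, IsSolidGridEmbedding G φ

/-! ### Corner paths and corner vertices -/

/-- A corner path (with respect to the grid embedding `φ`): a path with two different end-vertices
of degree two whose other vertices have degree three, which contains no cut vertex of `G` and runs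
along a vertical or a horizontal line. -/
structure IsCornerPath {V : Type*} [Fintype V] (G : SimpleGraph V) [DecidableRel G.Adj]
    (φ : V → ℤ × ℤ) {u v : V} (P : G.Walk u v) : Prop where
  isPath : P.IsPath
  ne : u ≠ v
  not_cut : ∀ w ∈ P.support, ¬ IsCutVertex G w
  degree_left : G.degree u = 2
  degree_right : G.degree v = 2
  degree_inner : ∀ w ∈ P.support, w ≠ u → w ≠ v → G.degree w = 3
  straight : (∀ w ∈ P.support, (φ w).1 = (φ u).1) ∨ (∀ w ∈ P.support, (φ w).2 = (φ u).2)

/-- The set of corner vertices: the vertices of degree one and the end-vertices of corner paths. -/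
def cornerVertices {V : Type*} [Fintype V] (G : SimpleGraph V) [DecidableRel G.Adj]
    (φ : V → ℤ × ℤ) : Set V :=
  {x | G.degree x = 1 ∨
    ∃ (u v : V) (P : G.Walk u v), IsCornerPath G φ P ∧ (x = u ∨ x = v)}

/-! ### A random access machine

A structured random access machine with registers and zero-indexed arrays of natural numbers.
Programs are finite, so each of them uses finitely many registers and arrays. Elementary
instructions and tests take one step each. The machine works with bounded words: an instruction
whose result exceeds the word bound cannot be executed. -/

/-- A memory configuration: the contents of the registers and of the cells of the arrays. -/
structure RamState where
  reg : ℕ → ℕ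
  arr : ℕ → ℕ → ℕ

/-- The elementary instructions. -/
inductive RamInstr where
  /-- `reg x := k`, for a constant `k` -/
  | const (x k : ℕ)
  /-- `reg x := reg y` -/
  | copy (x y : ℕ)
  /-- `reg x := reg y + reg z` -/
  | add (x y z : ℕ)
  /-- `reg x := reg y - reg z`, truncated at zero -/
  | sub (x y z : ℕ)
  /-- `reg x := (arr a)[reg y]` -/
  | load (x a y : ℕ)
  /-- `(arr a)[reg y] := reg z` -/
  | store (a y z : ℕ)

/-- The value that an instruction writes. -/
def RamInstr.value : RamInstr → RamState → ℕ
  | .const _ k, _ => k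
  | .copy _ y, s => s.reg y
  | .add _ y z, s => s.reg y + s.reg z
  | .sub _ y z, s => s.reg y - s.reg z
  | .load _ a y, s => s.arr a (s.reg y)
  | .store _ _ z, s => s.reg z

/-- Writing the value `k` to register `x`. -/
def RamState.setReg (s : RamState) (x k : ℕ) : RamState :=
  { s with reg := Function.update s.reg x k }

/-- Writing the value `k` to cell `i` of array `a`. -/
def RamState.setArr (s : RamState) (a i k : ℕ) : RamState :=
  { s with arr := Function.update s.arr a (Function.update (s.arr a) i k) }

/-- The effect of an instruction on the memory. -/
def RamInstr.run (c : RamInstr) (s : RamState) : RamState :=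
  match c with
  | .const x _ => s.setReg x (c.value s)
  | .copy x _ => s.setReg x (c.value s)
  | .add x _ _ => s.setReg x (c.value s)
  | .sub x _ _ => s.setReg x (c.value s)
  | .load x _ _ => s.setReg x (c.value s)
  | .store a y _ => s.setArr a (s.reg y) (c.value s)

/-- The elementary tests: comparisons of two registers. -/
inductive RamTest where
  | lt (x y : ℕ)
  | eq (x y : ℕ)

/-- The truth of a test. -/
def RamTest.Holds : RamTest → RamState → Prop
  | .lt x y, s => s.reg x < s.reg y
  | .eq x y, s => s.reg x = s.reg y

/-- Programs. -/
inductive RamProgram where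
  | skip
  | instr (c : RamInstr)
  | seq (p q : RamProgram)
  | ite (b : RamTest) (p q : RamProgram)
  | while (b : RamTest) (p : RamProgram)

/-- `RamExec B p s t s'`: started in the memory `s`, with words of value at most `B`, the program
`p` halts after exactly `t` steps, and then the memory is `s'`. -/
inductive RamExec (B : ℕ) : RamProgram → RamState → ℕ → RamState → Prop where
  | skip (s : RamState) : RamExec B .skip s 1 s
  | instr (c : RamInstr) (s : RamState) (h : c.value s ≤ B) : RamExec B (.instr c) s 1 (c.run s)
  | seq {p q : RamProgram} {s₁ s₂ s₃ : RamState} {t₁ t₂ : ℕ} (hp : RamExec B p s₁ t₁ s₂)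
      (hq : RamExec B q s₂ t₂ s₃) : RamExec B (.seq p q) s₁ (t₁ + t₂) s₃
  | ite_true {b : RamTest} {p q : RamProgram} {s s' : RamState} {t : ℕ} (hb : b.Holds s)
      (hp : RamExec B p s t s') : RamExec B (.ite b p q) s (1 + t) s'
  | ite_false {b : RamTest} {p q : RamProgram} {s s' : RamState} {t : ℕ} (hb : ¬ b.Holds s)
      (hq : RamExec B q s t s') : RamExec B (.ite b p q) s (1 + t) s'
  | while_true {b : RamTest} {p : RamProgram} {s₁ s₂ s₃ : RamState} {t₁ t₂ : ℕ}
      (hb : b.Holds s₁) (hp : RamExec B p s₁ t₁ s₂)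
      (hw : RamExec B (.while b p) s₂ t₂ s₃) : RamExec B (.while b p) s₁ (1 + t₁ + t₂) s₃
  | while_false {b : RamTest} {p : RamProgram} {s : RamState} (hb : ¬ b.Holds s) :
      RamExec B (.while b p) s 1 s

/-! ### Graphs as inputs -/

/-- `adj` lists, for each vertex, its neighbours in `G` without repetition, in any order. -/
def IsAdjacencyList {n : ℕ} (G : SimpleGraph (Fin n)) (adj : Fin n → List (Fin n)) : Prop :=
  ∀ v : Fin n, (adj v).Nodup ∧ ∀ w : Fin n, w ∈ adj v ↔ G.Adj v w

/-- The initial memory for adjacency lists `adj` on the vertices `0, …, n - 1`. Register `0` holds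
`n`; array `1` holds the concatenation of the lists of the vertices `0, 1, …, n - 1`; and cell
`v ≤ n` of array `0` holds the position in array `1` where the list of `v` starts, which is
the total length of the lists before it. Everything else is zero. -/
def graphInput {n : ℕ} (adj : Fin n → List (Fin n)) : RamState where
  reg x := if x = 0 then n else 0
  arr a i :=
    if a = 0 then (if i ≤ n then (((List.ofFn adj).take i).map List.length).sum else 0)
    else if a = 1 then (((List.ofFn adj).flatten).map Fin.val).getD i 0
    else 0

/-- The set of vertices that a final memory describes: the vertices `v` with a non-zero entry in
array `2`. -/
def vertexOutput (n : ℕ) (s : RamState) : Set (Fin n) :=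
  {v | s.arr 2 v ≠ 0}

/-! Solidity is used through one fact. A unit cell that lacks one of its four corners can be left
for infinity through segments that are not edges, since otherwise it would lie in a bounded face of
area more than one. Hence the edges met by a ray from such a cell form a cut
(`IsSolidGridEmbedding.splitsRight`). For an edge, take the maximal run of full squares stacked
sideways on it. Rays from the two cells beyond the ends of this run differ exactly in its rungs, so
the rungs form a cut (`exists_strip`).

Both sides of such a strip are straight rows, hence shortest paths, and they are parallel. So the
cut splits the component of the edge into two halfspaces: the vertices closer to one end and those
closer to the other (`IsStrip.dist_lt_iff`). It follows that opposite edges of a square define the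
same halfspaces, and that two neighbours of `u` which are both closer to `c` span a square with `u`.
From this one gets `IsSolidGridEmbedding.dist_eq_add`: `x` lies between `c` and `c'` unless some
neighbour of `x` is closer to both.

Corner paths are the same as ladders: maximal rows with a full parallel row on one side and nothing
on the other. Every halfspace contains a corner vertex, because a halfspace containing no smaller
one is bounded by a ladder row or a vertex of degree one. If `x` were between no two corner
vertices, three neighbours of `x` would lie in pairwise perpendicular directions, which the plane
does not allow. So the corner vertices, with the isolated ones, form a geodetic set.

Conversely a ladder row is a whole halfspace. If a geodetic set missed it, a geodesic through its
end could be shortened along the parallel row. Each vertex of the geodetic set is charged by at most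
three corner vertices (`card_chargedTo_le`), which gives the factor three.

The algorithm needs no embedding. From a vertex of degree two it traces a possible ladder square by
square: the fourth corner of a square is the second common neighbour of two opposite corners, and
the next vertex of the row is the remaining neighbour. The traced rays in one direction are
disjoint, so the total time is linear. -/

/-! ### From faces to unit cells -/

/-- The closed unit cell with lower left corner `c`. -/
def gridCell (c : ℤ × ℤ) : Set (ℝ × ℝ) :=
  Set.Icc (c.1 : ℝ) (c.1 + 1) ×ˢ Set.Icc (c.2 : ℝ) (c.2 + 1)

lemma isClosed_gridCell (c : ℤ × ℤ) : IsClosed (gridCell c) := isClosed_Icc.prod isClosed_Icc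

/-- Makes arbitrary unions of cells closed, which is what separates a connected face below. -/
lemma locallyFinite_gridCell : LocallyFinite gridCell := by
  intro z
  refine ⟨Set.Ioo (z.1 - 1) (z.1 + 1) ×ˢ Set.Ioo (z.2 - 1) (z.2 + 1), ?_, ?_⟩
  · exact prod_mem_nhds (Ioo_mem_nhds (by linarith) (by linarith))
      (Ioo_mem_nhds (by linarith) (by linarith))
  · refine ((Set.finite_Icc (⌊z.1⌋ - 2) (⌊z.1⌋ + 2)).prod
      (Set.finite_Icc (⌊z.2⌋ - 2) (⌊z.2⌋ + 2))).subset ?_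
    rintro ⟨i, j⟩ ⟨⟨a, b⟩, ⟨⟨h1, h2⟩, h3, h4⟩, ⟨h5, h6⟩, h7, h8⟩
    dsimp only at *
    have f1 := Int.floor_le z.1
    have f2 := Int.lt_floor_add_one z.1
    have f3 := Int.floor_le z.2
    have f4 := Int.lt_floor_add_one z.2
    refine ⟨⟨?_, ?_⟩, ?_, ?_⟩ <;> dsimp only <;> rw [← @Int.cast_le ℝ] <;> push_cast
    · have : (⌊z.1⌋ : ℝ) < i + 2 := by linarith
      have : ⌊z.1⌋ < i + 2 := by exact_mod_cast this
      have : ⌊z.1⌋ - 2 ≤ i := by omega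
      have : ((⌊z.1⌋ - 2 : ℤ) : ℝ) ≤ i := Int.cast_le.2 this
      simpa using this
    · have : (i : ℝ) < ⌊z.1⌋ + 2 := by linarith
      exact this.le
    · have : (⌊z.2⌋ : ℝ) < j + 2 := by linarith
      have : ⌊z.2⌋ < j + 2 := by exact_mod_cast this
      have : ⌊z.2⌋ - 2 ≤ j := by omega
      have : ((⌊z.2⌋ - 2 : ℤ) : ℝ) ≤ j := Int.cast_le.2 this
      simpa using this
    · have : (j : ℝ) < ⌊z.2⌋ + 2 := by linarith
      exact this.le

lemma exists_mem_gridCell (z : ℝ × ℝ) : z ∈ gridCell (⌊z.1⌋, ⌊z.2⌋) :=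
  ⟨⟨Int.floor_le _, (Int.lt_floor_add_one _).le⟩, Int.floor_le _, (Int.lt_floor_add_one _).le⟩

lemma sq_add_sq_eq_one {a b : ℤ} (h : a ^ 2 + b ^ 2 = 1) :
    (a = 0 ∧ (b = 1 ∨ b = -1)) ∨ (b = 0 ∧ (a = 1 ∨ a = -1)) := by
  have h1 : a ≤ 1 := by nlinarith
  have h2 : -1 ≤ a := by nlinarith
  have h3 : b ≤ 1 := by nlinarith
  have h4 : -1 ≤ b := by nlinarith
  interval_cases a <;> interval_cases b <;> simp_all

/-! ### The drawing inside unit cells, and the area argument -/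

section Drawing

variable {V : Type*} {G : SimpleGraph V} {φ : V → ℤ × ℤ}

lemma mem_gridDrawing_of_vertical (hφ : IsGridEmbedding G φ) {x y : ℤ} {z : ℝ × ℝ}
    (h1 : (x, y) ∈ Set.range φ) (h2 : (x, y + 1) ∈ Set.range φ) (hz : z.1 = x)
    (hz1 : (y : ℝ) ≤ z.2) (hz2 : z.2 ≤ y + 1) : z ∈ gridDrawing G φ := by
  obtain ⟨u, hu⟩ := h1
  obtain ⟨v, hv⟩ := h2
  refine Or.inr ⟨u, v, (hφ.adj_iff u v).2 (by rw [hu, hv]; ring), ?_⟩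
  rw [hu, hv]
  refine ⟨1 - (z.2 - y), z.2 - y, by linarith, by linarith, by ring, ?_⟩
  apply Prod.ext <;> simp [gridPoint, hz] <;> ring

lemma mem_gridDrawing_of_horizontal (hφ : IsGridEmbedding G φ) {x y : ℤ} {z : ℝ × ℝ}
    (h1 : (x, y) ∈ Set.range φ) (h2 : (x + 1, y) ∈ Set.range φ) (hz : z.2 = y)
    (hz1 : (x : ℝ) ≤ z.1) (hz2 : z.1 ≤ x + 1) : z ∈ gridDrawing G φ := by
  obtain ⟨u, hu⟩ := h1
  obtain ⟨v, hv⟩ := h2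
  refine Or.inr ⟨u, v, (hφ.adj_iff u v).2 (by rw [hu, hv]; ring), ?_⟩
  rw [hu, hv]
  refine ⟨1 - (z.1 - x), z.1 - x, by linarith, by linarith, by ring, ?_⟩
  apply Prod.ext <;> simp [gridPoint, hz] <;> ring

lemma gridDrawing_cases (hφ : IsGridEmbedding G φ) {z : ℝ × ℝ} (hz : z ∈ gridDrawing G φ) :
    ∃ x y : ℤ, (z.1 = x ∧ z.2 = y ∧ (x, y) ∈ Set.range φ) ∨
      (z.1 = x ∧ (y : ℝ) ≤ z.2 ∧ z.2 ≤ y + 1 ∧ (x, y) ∈ Set.range φ ∧ (x, y + 1) ∈ Set.range φ) ∨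
      (z.2 = y ∧ (x : ℝ) ≤ z.1 ∧ z.1 ≤ x + 1 ∧ (x, y) ∈ Set.range φ ∧
        (x + 1, y) ∈ Set.range φ) := by
  rcases hz with ⟨v, rfl⟩ | ⟨u, v, huv, a, b, ha, hb, hab, rfl⟩
  · exact ⟨(φ v).1, (φ v).2, Or.inl ⟨rfl, rfl, v, rfl⟩⟩
  · rw [hφ.adj_iff] at huv
    obtain rfl : a = 1 - b := by linarith
    have hu : ((φ u).1, (φ u).2) ∈ Set.range φ := ⟨u, rfl⟩
    have hv : ((φ v).1, (φ v).2) ∈ Set.range φ := ⟨v, rfl⟩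
    rcases sq_add_sq_eq_one huv with ⟨h1, h2 | h2⟩ | ⟨h1, h2 | h2⟩
    · have e1 : (φ u).1 = (φ v).1 := by omega
      have e2 : (φ u).2 = (φ v).2 + 1 := by omega
      refine ⟨(φ v).1, (φ v).2, Or.inr (Or.inl ⟨?_, ?_, ?_, hv, ?_⟩)⟩
      · simp [gridPoint, e1]; ring
      · simp [gridPoint, e2]; linarith
      · simp [gridPoint, e2]; linarith
      · rw [← e1, ← e2]; exact hu
    · have e1 : (φ v).1 = (φ u).1 := by omega
      have e2 : (φ v).2 = (φ u).2 + 1 := by omega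
      refine ⟨(φ u).1, (φ u).2, Or.inr (Or.inl ⟨?_, ?_, ?_, hu, ?_⟩)⟩
      · simp [gridPoint, e1]; ring
      · simp [gridPoint, e2]; linarith
      · simp [gridPoint, e2]; linarith
      · rw [← e1, ← e2]; exact hv
    · have e1 : (φ u).2 = (φ v).2 := by omega
      have e2 : (φ u).1 = (φ v).1 + 1 := by omega
      refine ⟨(φ v).1, (φ v).2, Or.inr (Or.inr ⟨?_, ?_, ?_, hv, ?_⟩)⟩
      · simp [gridPoint, e1]; ring
      · simp [gridPoint, e2]; linarith
      · simp [gridPoint, e2]; linarith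
      · rw [← e1, ← e2]; exact hu
    · have e1 : (φ v).2 = (φ u).2 := by omega
      have e2 : (φ v).1 = (φ u).1 + 1 := by omega
      refine ⟨(φ u).1, (φ u).2, Or.inr (Or.inr ⟨?_, ?_, ?_, hu, ?_⟩)⟩
      · simp [gridPoint, e1]; ring
      · simp [gridPoint, e2]; linarith
      · simp [gridPoint, e2]; linarith
      · rw [← e1, ← e2]; exact hv

/-- A property of unit cells that is preserved by crossing a segment that is not an edge. -/
structure CrossInvariant (O : Set (ℤ × ℤ)) (P : ℤ × ℤ → Prop) : Prop where
  right : ∀ i j : ℤ, ¬ ((i + 1, j) ∈ O ∧ (i + 1, j + 1) ∈ O) → (P (i, j) ↔ P (i + 1, j))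
  up : ∀ i j : ℤ, ¬ ((i, j + 1) ∈ O ∧ (i + 1, j + 1) ∈ O) → (P (i, j) ↔ P (i, j + 1))

/-- A point in two cells lies on their common boundary, and being off the drawing it shows that the
segment crossed is no edge. Cells that meet only at a corner are compared through `(i', j)`, which
also contains the point. -/
lemma CrossInvariant.iff_of_mem_cells (hφ : IsGridEmbedding G φ) {P : ℤ × ℤ → Prop}
    (hP : CrossInvariant (Set.range φ) P) {z : ℝ × ℝ} (hz : z ∉ gridDrawing G φ) {c c' : ℤ × ℤ}
    (hc : z ∈ gridCell c) (hc' : z ∈ gridCell c') : P c ↔ P c' := by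
  have row : ∀ i j : ℤ, z ∈ gridCell (i, j) → z ∈ gridCell (i + 1, j) →
      (P (i, j) ↔ P (i + 1, j)) := by
    rintro i j ⟨⟨h1, h2⟩, h3, h4⟩ ⟨⟨h5, h6⟩, h7, h8⟩
    refine hP.right i j fun ⟨ha, hb⟩ => hz (mem_gridDrawing_of_vertical hφ ha hb ?_ h3 h4)
    push_cast at *; linarith
  have col : ∀ i j : ℤ, z ∈ gridCell (i, j) → z ∈ gridCell (i, j + 1) →
      (P (i, j) ↔ P (i, j + 1)) := by
    rintro i j ⟨⟨h1, h2⟩, h3, h4⟩ ⟨⟨h5, h6⟩, h7, h8⟩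
    refine hP.up i j fun ⟨ha, hb⟩ => hz (mem_gridDrawing_of_horizontal hφ ha hb ?_ h1 h2)
    push_cast at *; linarith
  have near : ∀ (t : ℝ) (i i' : ℤ), t ∈ Set.Icc (i : ℝ) (i + 1) → t ∈ Set.Icc (i' : ℝ) (i' + 1) →
      i' = i ∨ i' = i + 1 ∨ i = i' + 1 := by
    rintro t i i' ⟨h1, h2⟩ ⟨h3, h4⟩
    have a : (i : ℝ) ≤ i' + 1 := by linarith
    have b : (i' : ℝ) ≤ i + 1 := by linarith
    have a' : i ≤ i' + 1 := by exact_mod_cast a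
    have b' : i' ≤ i + 1 := by exact_mod_cast b
    omega
  obtain ⟨i, j⟩ := c
  obtain ⟨i', j'⟩ := c'
  have hm : z ∈ gridCell (i', j) := ⟨hc'.1, hc.2⟩
  have s1 : P (i, j) ↔ P (i', j) := by
    rcases near _ _ _ hc.1 hc'.1 with h | h | h <;> dsimp only at h <;> subst h
    · rfl
    · exact row _ _ hc hm
    · exact (row _ _ hm hc).symm
  have s2 : P (i', j) ↔ P (i', j') := by
    rcases near _ _ _ hc.2 hc'.2 with h | h | h <;> dsimp only at h <;> subst h
    · rfl
    · exact col _ _ hm hc'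
    · exact (col _ _ hc' hm).symm
  exact s1.trans s2

/-- If `P c` failed, the whole face of `z` would lie in cells violating `P`: a connected set covered
by the closed unions `A` and `B` and meeting both has a point in both, which `iff_of_mem_cells`
forbids off the drawing. There are finitely many such cells, so the face is bounded and has area
one, but it contains a rectangle of area two. -/
lemma CrossInvariant.of_rectangle (hs : IsSolidGridEmbedding G φ) {P : ℤ × ℤ → Prop}
    (hP : CrossInvariant (Set.range φ) P) (hfar : {c | ¬ P c}.Finite) {c : ℤ × ℤ}
    {a b a' b' : ℝ} (hU : Disjoint (Set.Ioo a b ×ˢ Set.Ioo a' b') (gridDrawing G φ))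
    (hab : (b - a) * (b' - a') = 2) (h0 : 0 ≤ b - a) {z : ℝ × ℝ}
    (hz : z ∈ Set.Ioo a b ×ˢ Set.Ioo a' b') (hzc : z ∈ gridCell c) : P c := by
  by_contra hc
  have hzD : z ∈ (gridDrawing G φ)ᶜ := fun h => Set.disjoint_left.1 hU hz h
  set F := connectedComponentIn (gridDrawing G φ)ᶜ z with hF
  have hFD : F ⊆ (gridDrawing G φ)ᶜ := connectedComponentIn_subset _ _
  set A := ⋃ c : {c // ¬ P c}, gridCell c with hA
  set B := ⋃ c : {c // P c}, gridCell c with hB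
  have hcA : IsClosed A := (locallyFinite_gridCell.comp_injective
    Subtype.val_injective).isClosed_iUnion fun c => isClosed_gridCell _
  have hcB : IsClosed B := (locallyFinite_gridCell.comp_injective
    Subtype.val_injective).isClosed_iUnion fun c => isClosed_gridCell _
  have hsub : F ⊆ A := by
    have hpre : IsPreconnected F := isPreconnected_connectedComponentIn
    rw [isPreconnected_closed_iff] at hpre
    intro w hw
    by_contra hwA
    have hcov : ∀ w, w ∈ A ∪ B := by
      intro w
      by_cases h : P (⌊w.1⌋, ⌊w.2⌋)
      · exact Or.inr (Set.mem_iUnion.2 ⟨⟨_, h⟩, exists_mem_gridCell w⟩)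
      · exact Or.inl (Set.mem_iUnion.2 ⟨⟨_, h⟩, exists_mem_gridCell w⟩)
    obtain ⟨y, hyF, hyA, hyB⟩ := hpre A B hcA hcB (fun y _ => hcov y)
      ⟨z, mem_connectedComponentIn hzD, Set.mem_iUnion.2 ⟨⟨c, hc⟩, hzc⟩⟩
      ⟨w, hw, (hcov w).resolve_left hwA⟩
    obtain ⟨⟨c1, h1⟩, hy1⟩ := Set.mem_iUnion.1 hyA
    obtain ⟨⟨c2, h2⟩, hy2⟩ := Set.mem_iUnion.1 hyB
    exact h1 ((hP.iff_of_mem_cells hs.1 (hFD hyF) hy1 hy2).2 h2)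
  have hbdd : Bornology.IsBounded F := by
    refine Bornology.IsBounded.subset ?_ hsub
    have : Finite {c // ¬ P c} := hfar
    exact (Bornology.isBounded_iUnion (s := fun c : {c // ¬ P c} => gridCell c)).2 fun c =>
      (Metric.isBounded_Icc _ _).prod (Metric.isBounded_Icc _ _)
  have hvol := hs.2 F ⟨z, hzD, rfl⟩ hbdd
  have hUF : Set.Ioo a b ×ˢ Set.Ioo a' b' ⊆ F :=
    ((convex_Ioo a b).prod (convex_Ioo a' b')).isPreconnected.subset_connectedComponentIn hz
      (fun y hy h => Set.disjoint_left.1 hU hy h)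
  have := measure_mono (μ := volume) hUF
  rw [hvol, Measure.volume_eq_prod, Measure.prod_prod, Real.volume_Ioo, Real.volume_Ioo,
    ← ENNReal.ofReal_mul h0, hab] at this
  norm_num at this

/-- In a solid grid embedding, a property of cells that is invariant under crossing non-edges and
holds for almost all cells holds for all cells that are not faces. -/
theorem CrossInvariant.of_not_full (hs : IsSolidGridEmbedding G φ) {P : ℤ × ℤ → Prop}
    (hP : CrossInvariant (Set.range φ) P) (hfar : {c | ¬ P c}.Finite) {i j : ℤ}
    (h : ¬ ((i, j) ∈ Set.range φ ∧ (i + 1, j) ∈ Set.range φ ∧ (i, j + 1) ∈ Set.range φ ∧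
      (i + 1, j + 1) ∈ Set.range φ)) : P (i, j) := by
  have half : ∀ i j : ℤ, ((i : ℝ) + 1 / 2, (j : ℝ) + 1 / 2) ∈ gridCell (i, j) := fun i j => by
    refine ⟨⟨?_, ?_⟩, ?_, ?_⟩ <;> dsimp only <;> linarith
  -- Two cells separated by a missing segment form an open rectangle of area two that avoids the
  -- drawing.
  have row : ∀ i j : ℤ, ¬ ((i + 1, j) ∈ Set.range φ ∧ (i + 1, j + 1) ∈ Set.range φ) →
      P (i, j) := by
    intro i j hij
    refine hP.of_rectangle hs hfar (a := i) (b := i + 2) (a' := j) (b' := j + 1) ?_ (by ring)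
      (by linarith) (z := ((i : ℝ) + 1 / 2, (j : ℝ) + 1 / 2)) ?_ (half i j)
    · rw [Set.disjoint_left]
      rintro z ⟨⟨h1, h2⟩, h3, h4⟩ hz
      obtain ⟨x, y, ⟨e1, e2, -⟩ | ⟨e1, e2, e3, e4, e5⟩ | ⟨e1, -⟩⟩ := gridDrawing_cases hs.1 hz
      · rw [e2] at h3 h4; norm_cast at h3 h4; omega
      · rw [e1] at h1 h2
        have l1 : (j : ℝ) < y + 1 := by linarith
        have l2 : (y : ℝ) < j + 1 := by linarith
        norm_cast at h1 h2 l1 l2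
        obtain rfl : x = i + 1 := by omega
        obtain rfl : y = j := by omega
        exact hij ⟨e4, e5⟩
      · rw [e1] at h3 h4; norm_cast at h3 h4; omega
    · refine ⟨⟨?_, ?_⟩, ?_, ?_⟩ <;> dsimp only <;> linarith
  have col : ∀ i j : ℤ, ¬ ((i, j + 1) ∈ Set.range φ ∧ (i + 1, j + 1) ∈ Set.range φ) →
      P (i, j) := by
    intro i j hij
    refine hP.of_rectangle hs hfar (a := i) (b := i + 1) (a' := j) (b' := j + 2) ?_ (by ring)
      (by linarith) (z := ((i : ℝ) + 1 / 2, (j : ℝ) + 1 / 2)) ?_ (half i j)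
    · rw [Set.disjoint_left]
      rintro z ⟨⟨h1, h2⟩, h3, h4⟩ hz
      obtain ⟨x, y, ⟨e1, e2, -⟩ | ⟨e1, -⟩ | ⟨e1, e2, e3, e4, e5⟩⟩ := gridDrawing_cases hs.1 hz
      · rw [e1] at h1 h2; norm_cast at h1 h2; omega
      · rw [e1] at h1 h2; norm_cast at h1 h2; omega
      · rw [e1] at h3 h4
        have l1 : (i : ℝ) < x + 1 := by linarith
        have l2 : (x : ℝ) < i + 1 := by linarith
        norm_cast at h3 h4 l1 l2
        obtain rfl : y = j + 1 := by omega
        obtain rfl : x = i := by omega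
        exact hij ⟨e4, e5⟩
    · refine ⟨⟨?_, ?_⟩, ?_, ?_⟩ <;> dsimp only <;> linarith
  by_cases h1 : (i + 1, j) ∈ Set.range φ ∧ (i + 1, j + 1) ∈ Set.range φ
  · by_cases h2 : (i, j + 1) ∈ Set.range φ
    -- The missing corner is the lower left one. Then the left side is no edge, and the property is
    -- carried over from the cell `(i - 1, j)`.
    · have h3 : (i, j) ∉ Set.range φ := fun h3 => h ⟨h3, h1.1, h2, h1.2⟩
      have h4 : ¬ ((i - 1 + 1, j) ∈ Set.range φ ∧ (i - 1 + 1, j + 1) ∈ Set.range φ) := by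
        rw [sub_add_cancel]
        exact fun h => h3 h.1
      have h5 := (hP.right (i - 1) j h4).1 (row (i - 1) j h4)
      rwa [sub_add_cancel] at h5
    · exact col i j fun h => h2 h.1
  · exact row i j h1

end Drawing

/-! ### Cuts -/

/-- A two-colouring of the plane that changes along the edges of `O` to the right of the cell
`(i, j)` in its row, and along no other edges. -/
def SplitsRight (O : Set (ℤ × ℤ)) (i j : ℤ) : Prop :=
  ∃ χ : ℤ × ℤ → Bool, (∀ x y, (x, y) ∈ O → (x + 1, y) ∈ O → χ (x + 1, y) = χ (x, y)) ∧
    ∀ x y, (x, y) ∈ O → (x, y + 1) ∈ O →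
      χ (x, y + 1) = (χ (x, y) ^^ decide (y = j ∧ i < x))

/-- The cut consists of the edges met by the horizontal ray to the right of the cell. Moving the
cell across a missing vertical segment does not change this set. Moving it up is compensated by
flipping the colour of the points between the two parallel rays; no edge leaves these points
sideways, because the segment crossed is missing. -/
lemma crossInvariant_splitsRight (O : Set (ℤ × ℤ)) :
    CrossInvariant O fun c => SplitsRight O c.1 c.2 where
  right i j h := by
    refine exists_congr fun χ => and_congr_right fun _ => ?_
    refine forall₂_congr fun x y => forall₂_congr fun h1 h2 => ?_
    have : (y = j ∧ i < x) ↔ (y = j ∧ i + 1 < x) := by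
      constructor
      · rintro ⟨rfl, h3⟩
        refine ⟨rfl, lt_of_le_of_ne (by omega) ?_⟩
        rintro rfl
        exact h ⟨h1, h2⟩
      · rintro ⟨rfl, h3⟩
        exact ⟨rfl, by omega⟩
    simp only [this]
  up i j h := by
    have key : ∀ χ : ℤ × ℤ → Bool, ∀ k k', (k = j ∧ k' = j + 1 ∨ k = j + 1 ∧ k' = j) →
        (∀ x y, (x, y) ∈ O → (x + 1, y) ∈ O → χ (x + 1, y) = χ (x, y)) →
        (∀ x y, (x, y) ∈ O → (x, y + 1) ∈ O →
          χ (x, y + 1) = (χ (x, y) ^^ decide (y = k ∧ i < x))) → SplitsRight O i k' := by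
      intro χ k k' hk h1 h2
      refine ⟨fun p => χ p ^^ decide (p.2 = j + 1 ∧ i < p.1), ?_, ?_⟩
      · intro x y hx hy
        have : (y = j + 1 ∧ i < x + 1) ↔ (y = j + 1 ∧ i < x) := by
          constructor
          · rintro ⟨rfl, h3⟩
            refine ⟨rfl, lt_of_le_of_ne (by omega) ?_⟩
            rintro rfl
            exact h ⟨hx, hy⟩
          · rintro ⟨rfl, h3⟩
            exact ⟨rfl, by omega⟩
        simp only [this, h1 x y hx hy]
      · intro x y hx hy
        simp only [h2 x y hx hy]
        by_cases a : i < x <;> by_cases b : y = j <;> by_cases c : y = j + 1 <;>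
          rcases hk with ⟨rfl, rfl⟩ | ⟨rfl, rfl⟩ <;> cases χ (x, y) <;> simp [a, b, c]
    constructor
    · rintro ⟨χ, h1, h2⟩
      exact key χ j (j + 1) (Or.inl ⟨rfl, rfl⟩) h1 h2
    · rintro ⟨χ, h1, h2⟩
      exact key χ (j + 1) j (Or.inr ⟨rfl, rfl⟩) h1 h2

/-- To the left of all points the ray meets every edge of its row, so the cut separates the points
above the row from the rest. From the other far cells the ray meets no edge, and a constant
colouring works. -/
lemma splitsRight_of_far {O : Set (ℤ × ℤ)} {N : ℤ}
    (hN : ∀ p ∈ O, -N ≤ p.1 ∧ p.1 ≤ N ∧ -N ≤ p.2 ∧ p.2 ≤ N) {i j : ℤ}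
    (h : i < -N ∨ N < i ∨ j < -N ∨ N < j) : SplitsRight O i j := by
  by_cases h1 : i < -N
  · refine ⟨fun p => decide (j < p.2), fun x y _ _ => rfl, fun x y hx hy => ?_⟩
    have h2 := (hN _ hx).1
    dsimp only at h2
    by_cases a : j < y <;> by_cases b : y = j <;> simp [a, b] <;> omega
  · refine ⟨fun _ => false, fun x y _ _ => rfl, fun x y hx hy => ?_⟩
    have h2 := hN _ hx
    dsimp only at h2
    simp only [Bool.false_bne, Bool.false_eq, decide_eq_false_iff_not]
    simp
    omega

/-- Exchanging the coordinates turns horizontal rays into vertical ones. -/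
lemma CrossInvariant.swap {O : Set (ℤ × ℤ)} {P : ℤ × ℤ → Prop}
    (h : CrossInvariant (Prod.swap ⁻¹' O) P) : CrossInvariant O fun c => P c.swap where
  right i j hij := h.up j i fun ⟨h1, h2⟩ => hij ⟨h1, h2⟩
  up i j hij := h.right j i fun ⟨h1, h2⟩ => hij ⟨h1, h2⟩

/-- The rest of the proof uses the condition on faces only through this statement. -/
theorem IsSolidGridEmbedding.splitsRight {V : Type*} [Finite V] {G : SimpleGraph V}
    {φ : V → ℤ × ℤ} (hs : IsSolidGridEmbedding G φ) {i j : ℤ}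
    (h : ¬ ((i, j) ∈ Set.range φ ∧ (i + 1, j) ∈ Set.range φ ∧ (i, j + 1) ∈ Set.range φ ∧
      (i + 1, j + 1) ∈ Set.range φ)) :
    SplitsRight (Set.range φ) i j ∧ SplitsRight (Prod.swap ⁻¹' Set.range φ) j i := by
  obtain ⟨N, hN⟩ : ∃ N : ℤ, ∀ p ∈ Set.range φ, -N ≤ p.1 ∧ p.1 ≤ N ∧ -N ≤ p.2 ∧ p.2 ≤ N := by
    obtain ⟨M, hM⟩ := ((Set.finite_range φ).image fun p => |p.1| + |p.2|).bddAbove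
    refine ⟨M, fun p hp => ?_⟩
    have h1 : |p.1| + |p.2| ≤ M := hM ⟨p, hp, rfl⟩
    have h2 := abs_nonneg p.1
    have h3 := abs_nonneg p.2
    have h4 := abs_le.1 (show |p.1| ≤ M by omega)
    have h5 := abs_le.1 (show |p.2| ≤ M by omega)
    exact ⟨h4.1, h4.2, h5.1, h5.2⟩
  have hbox := (Set.finite_Icc (-N) N).prod (Set.finite_Icc (-N) N)
  constructor
  · refine (crossInvariant_splitsRight (Set.range φ)).of_not_full hs (hbox.subset ?_) h
    intro c hc
    by_contra hc'
    refine hc (splitsRight_of_far hN ?_)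
    simp only [Set.mem_prod, Set.mem_Icc] at hc'
    omega
  · refine (crossInvariant_splitsRight (Prod.swap ⁻¹' Set.range φ)).swap.of_not_full hs
      (hbox.subset ?_) h
    intro c hc
    by_contra hc'
    refine hc (splitsRight_of_far (N := N) (fun p hp => ?_) ?_)
    · have := hN _ hp
      simp only [Prod.fst_swap, Prod.snd_swap] at this
      omega
    · simp only [Set.mem_prod, Set.mem_Icc] at hc'
      simp only [Prod.fst_swap, Prod.snd_swap]
      omega

/-! ### Strips of unit squares -/

/-- Two perpendicular unit vectors of the lattice. -/
def IsFrame (d n : ℤ × ℤ) : Prop :=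
  ((d = (1, 0) ∨ d = (-1, 0)) ∧ (n = (0, 1) ∨ n = (0, -1))) ∨
    ((d = (0, 1) ∨ d = (0, -1)) ∧ (n = (1, 0) ∨ n = (-1, 0)))

lemma IsFrame.symm {d n : ℤ × ℤ} (h : IsFrame d n) : IsFrame n d := by
  unfold IsFrame at *; tauto

lemma IsFrame.cases {d n : ℤ × ℤ} {C : ℤ × ℤ → ℤ × ℤ → Prop} (h : IsFrame d n)
    (h1 : C (1, 0) (0, 1)) (h2 : C (0, 1) (1, 0)) (neg_left : ∀ d n, C d n → C (-d) n)
    (neg_right : ∀ d n, C d n → C d (-n)) : C d n := by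
  rcases h with ⟨rfl | rfl, rfl | rfl⟩ | ⟨rfl | rfl, rfl | rfl⟩
  · exact h1
  · exact neg_right _ _ h1
  · exact neg_left _ _ h1
  · exact neg_left _ _ (neg_right _ _ h1)
  · exact h2
  · exact neg_right _ _ h2
  · exact neg_left _ _ h2
  · exact neg_left _ _ (neg_right _ _ h2)

lemma IsFrame.neg_left {d n : ℤ × ℤ} (h : IsFrame d n) : IsFrame (-d) n := by
  rcases h with ⟨rfl | rfl, rfl | rfl⟩ | ⟨rfl | rfl, rfl | rfl⟩ <;> simp [IsFrame]

lemma IsFrame.neg_right {d n : ℤ × ℤ} (h : IsFrame d n) : IsFrame d (-n) :=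
  h.symm.neg_left.symm

/-- Adjacency in the square lattice. -/
def LatticeAdj (p q : ℤ × ℤ) : Prop := (p.1 - q.1) ^ 2 + (p.2 - q.2) ^ 2 = 1

lemma LatticeAdj.cases {p q : ℤ × ℤ} (h : LatticeAdj p q) :
    q = p + (1, 0) ∨ q = p + (-1, 0) ∨ q = p + (0, 1) ∨ q = p + (0, -1) := by
  obtain ⟨a, b⟩ := p
  obtain ⟨c, d⟩ := q
  have := sq_add_sq_eq_one h
  simp only [Prod.mk_add_mk, Prod.mk.injEq] at *
  omega

lemma LatticeAdj.eq_add {p q d n : ℤ × ℤ} (h : LatticeAdj p q) (hf : IsFrame d n) :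
    q = p + d ∨ q = p - d ∨ q = p + n ∨ q = p - n := by
  have := h.cases
  rcases hf with ⟨rfl | rfl, rfl | rfl⟩ | ⟨rfl | rfl, rfl | rfl⟩ <;>
    simp only [sub_eq_add_neg, Prod.neg_mk, neg_zero, neg_neg] <;> tauto

lemma IsFrame.latticeAdj {d n : ℤ × ℤ} (hf : IsFrame d n) (p : ℤ × ℤ) :
    LatticeAdj p (p + d) := by
  rcases hf with ⟨rfl | rfl, rfl | rfl⟩ | ⟨rfl | rfl, rfl | rfl⟩ <;> simp [LatticeAdj]

lemma LatticeAdj.symm {p q : ℤ × ℤ} (h : LatticeAdj p q) : LatticeAdj q p := by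
  unfold LatticeAdj at *; linarith

/-- A maximal strip of full unit squares of the point set `O`, with base point `p` and extending in
direction `d`, together with a two-colouring of `O` which changes along its rungs only. The rungs
are the edges between `p + s • d` and `p + s • d + n` for `a ≤ s ≤ b`. -/
structure IsStrip (O : Set (ℤ × ℤ)) (p d n : ℤ × ℤ) (a b : ℤ) (χ : ℤ × ℤ → Bool) : Prop where
  left_le : a ≤ 0
  le_right : 0 ≤ b
  near : ∀ s, a ≤ s → s ≤ b → p + s • d ∈ O
  far : ∀ s, a ≤ s → s ≤ b → p + s • d + n ∈ O
  left_end : ¬ (p + (a - 1) • d ∈ O ∧ p + (a - 1) • d + n ∈ O)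
  right_end : ¬ (p + (b + 1) • d ∈ O ∧ p + (b + 1) • d + n ∈ O)
  cross : ∀ q ∈ O, ∀ q' ∈ O, LatticeAdj q q' → χ q ≠ χ q' → ∃ s, a ≤ s ∧ s ≤ b ∧
    ((q = p + s • d ∧ q' = p + s • d + n) ∨ (q' = p + s • d ∧ q = p + s • d + n))
  ne : ∀ s, a ≤ s → s ≤ b → χ (p + s • d) ≠ χ (p + s • d + n)

lemma IsStrip.swap {O : Set (ℤ × ℤ)} {p d n : ℤ × ℤ} {a b : ℤ} {χ : ℤ × ℤ → Bool}
    (h : IsStrip (Prod.swap ⁻¹' O) p d n a b χ) :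
    IsStrip O p.swap d.swap n.swap a b (χ ∘ Prod.swap) where
  left_le := h.left_le
  le_right := h.le_right
  near := h.near
  far := h.far
  left_end := h.left_end
  right_end := h.right_end
  cross q hq q' hq' hqq hχ := by
    obtain ⟨s, h1, h2, h3⟩ := h.cross q.swap (by simpa) q'.swap (by simpa)
      (by simp only [LatticeAdj, Prod.fst_swap, Prod.snd_swap] at *; linarith) hχ
    refine ⟨s, h1, h2, ?_⟩
    rcases h3 with ⟨h3, h4⟩ | ⟨h3, h4⟩
    · left; rw [← Prod.swap_swap q, ← Prod.swap_swap q', h3, h4]; exact ⟨rfl, rfl⟩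
    · right; rw [← Prod.swap_swap q, ← Prod.swap_swap q', h3, h4]; exact ⟨rfl, rfl⟩
  ne := h.ne

lemma IsStrip.reverse {O : Set (ℤ × ℤ)} {p d n : ℤ × ℤ} {a b : ℤ} {χ : ℤ × ℤ → Bool}
    (h : IsStrip O p d n a b χ) : IsStrip O p (-d) n (-b) (-a) χ where
  left_le := neg_nonpos.2 h.le_right
  le_right := neg_nonneg.2 h.left_le
  near s h1 h2 := by simpa using h.near (-s) (by omega) (by omega)
  far s h1 h2 := by simpa using h.far (-s) (by omega) (by omega)
  left_end := by
    have := h.right_end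
    rwa [show (b + 1) • d = (-b - 1) • (-d) by rw [smul_neg, ← neg_smul]; ring_nf] at this
  right_end := by
    have := h.left_end
    rwa [show (a - 1) • d = (-a + 1) • (-d) by rw [smul_neg, ← neg_smul]; ring_nf] at this
  cross q hq q' hq' hqq hχ := by
    obtain ⟨s, h1, h2, h3⟩ := h.cross q hq q' hq' hqq hχ
    exact ⟨-s, by omega, by omega, by simpa using h3⟩
  ne s h1 h2 := by simpa using h.ne (-s) (by omega) (by omega)

lemma IsStrip.flip {O : Set (ℤ × ℤ)} {p d n : ℤ × ℤ} {a b : ℤ} {χ : ℤ × ℤ → Bool}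
    (h : IsStrip O p d n a b χ) : IsStrip O (p + n) d (-n) a b χ where
  left_le := h.left_le
  le_right := h.le_right
  near s h1 h2 := by rw [add_right_comm]; exact h.far s h1 h2
  far s h1 h2 := by rw [add_right_comm, add_neg_cancel_right]; exact h.near s h1 h2
  left_end := by
    rw [add_right_comm, add_neg_cancel_right, and_comm]; exact h.left_end
  right_end := by
    rw [add_right_comm, add_neg_cancel_right, and_comm]; exact h.right_end
  cross q hq q' hq' hqq hχ := by
    obtain ⟨s, h1, h2, h3⟩ := h.cross q hq q' hq' hqq hχ
    refine ⟨s, h1, h2, ?_⟩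
    rw [add_right_comm, add_neg_cancel_right]
    tauto
  ne s h1 h2 := by
    rw [add_right_comm, add_neg_cancel_right]; exact (h.ne s h1 h2).symm

lemma exists_last_of_finite {Q : ℤ → Prop} (h0 : Q 0) (hQ : {s | Q s}.Finite) :
    ∃ b, 0 ≤ b ∧ (∀ s, 0 ≤ s → s ≤ b → Q s) ∧ ¬ Q (b + 1) := by
  classical
  have hex : ∃ k : ℕ, ¬ Q k := by
    by_contra hc
    push Not at hc
    exact Set.infinite_of_injective_forall_mem (f := ((↑) : ℕ → ℤ)) Nat.cast_injective hc hQ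
  obtain ⟨k, hk, hk'⟩ : ∃ k : ℕ, ¬ Q k ∧ ∀ m < k, Q m :=
    ⟨Nat.find hex, Nat.find_spec hex, fun m hm => not_not.1 (Nat.find_min hex hm)⟩
  have hk0 : k ≠ 0 := by rintro rfl; exact hk h0
  refine ⟨k - 1, by omega, fun s h1 h2 => ?_, by simpa using hk⟩
  lift s to ℕ using h1
  exact hk' s (by omega)

lemma exists_interval_of_finite {Q : ℤ → Prop} (h0 : Q 0) (hQ : {s | Q s}.Finite) :
    ∃ a b, a ≤ 0 ∧ 0 ≤ b ∧ (∀ s, a ≤ s → s ≤ b → Q s) ∧ ¬ Q (a - 1) ∧ ¬ Q (b + 1) := by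
  obtain ⟨b, h1, h2, h3⟩ := exists_last_of_finite h0 hQ
  obtain ⟨a, h4, h5, h6⟩ := exists_last_of_finite (Q := fun s => Q (-s)) (by simpa)
    (hQ.preimage neg_injective.injOn)
  refine ⟨-a, b, by omega, h1, fun s h7 h8 => ?_, by convert h6 using 2; ring, h3⟩
  rcases le_total 0 s with h | h
  · exact h2 s h h8
  · simpa using h5 (-s) (by omega) (by omega)

/-- The combinatorial content of solidity: from each cell that is not full one escapes to
infinity, which yields cuts in both directions. -/
def HasCuts (O : Set (ℤ × ℤ)) : Prop :=
  ∀ i j : ℤ, ¬ ((i, j) ∈ O ∧ (i + 1, j) ∈ O ∧ (i, j + 1) ∈ O ∧ (i + 1, j + 1) ∈ O) →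
    SplitsRight O i j

/-- By maximality the cells just beyond both ends of the run of rungs are not full, so the rays to
the right of them define cuts. The two rays differ exactly in the rungs, hence so does the exclusive
or of the two colourings. -/
lemma HasCuts.exists_strip_aux {O : Set (ℤ × ℤ)} (hO : O.Finite) (hc : HasCuts O) {p : ℤ × ℤ}
    (h1 : p ∈ O) (h2 : p + (0, 1) ∈ O) : ∃ a b χ, IsStrip O p (1, 0) (0, 1) a b χ := by
  obtain ⟨a, b, ha, hb, hQ, ha', hb'⟩ := exists_interval_of_finite
    (Q := fun s => p + s • ((1, 0) : ℤ × ℤ) ∈ O ∧ p + s • ((1, 0) : ℤ × ℤ) + (0, 1) ∈ O)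
    (by simpa using ⟨h1, h2⟩) (Set.Finite.subset (hO.preimage
      (f := fun s : ℤ => p + s • ((1, 0) : ℤ × ℤ)) (by
        intro s _ t _ hst; simpa using hst)) fun s hs => hs.1)
  obtain ⟨x, y⟩ := p
  -- Cells are named by their lower left corners: the one before rung `a` starts at `x + a - 1`, the
  -- one after rung `b` at `x + b`.
  obtain ⟨χ₁, c1, c2⟩ := hc (x + a - 1) y (fun h => ha' ⟨by
    simpa [add_sub_assoc] using h.1, by simpa [add_sub_assoc] using h.2.2.1⟩)
  obtain ⟨χ₂, c3, c4⟩ := hc (x + b) y (fun h => hb' ⟨by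
    simpa [add_assoc] using h.2.1, by simpa [add_assoc] using h.2.2.2⟩)
  have vert : ∀ u v, (u, v) ∈ O → (u, v + 1) ∈ O →
      ((χ₁ (u, v) ^^ χ₂ (u, v)) ≠ (χ₁ (u, v + 1) ^^ χ₂ (u, v + 1)) ↔
        v = y ∧ x + a ≤ u ∧ u ≤ x + b) := by
    intro u v huv huv'
    rw [c2 u v huv huv', c4 u v huv huv']
    by_cases e1 : v = y <;> by_cases e2 : x + a - 1 < u <;> by_cases e3 : x + b < u <;>
      cases χ₁ (u, v) <;> cases χ₂ (u, v) <;> simp [e1, e2, e3] <;> omega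
  have up : ∀ u v, (u, v) ∈ O → (u, v + 1) ∈ O →
      (χ₁ (u, v) ^^ χ₂ (u, v)) ≠ (χ₁ (u, v + 1) ^^ χ₂ (u, v + 1)) → ∃ s, a ≤ s ∧ s ≤ b ∧
        (u, v) = (x, y) + s • ((1, 0) : ℤ × ℤ) := by
    intro u v huv huv' hne
    obtain ⟨rfl, h3, h4⟩ := (vert u v huv huv').1 hne
    exact ⟨u - x, by omega, by omega, by simp⟩
  have right : ∀ u v, (u, v) ∈ O → (u + 1, v) ∈ O →
      (χ₁ (u, v) ^^ χ₂ (u, v)) = (χ₁ (u + 1, v) ^^ χ₂ (u + 1, v)) := by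
    intro u v huv huv'
    rw [c1 u v huv huv', c3 u v huv huv']
  refine ⟨a, b, fun q => χ₁ q ^^ χ₂ q, ha, hb, fun s h3 h4 => (hQ s h3 h4).1,
    fun s h3 h4 => (hQ s h3 h4).2, ha', hb', ?_, ?_⟩
  · rintro ⟨u, v⟩ hq q' hq' hqq hχ
    rcases hqq.cases with rfl | rfl | rfl | rfl
    · refine absurd (right u v hq (by simpa using hq')) ?_
      simpa using hχ
    · refine absurd (right (u - 1) v (by simpa [sub_eq_add_neg] using hq') (by simpa using hq)) ?_
      simpa [sub_eq_add_neg] using hχ.symm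
    · obtain ⟨s, h3, h4, h5⟩ := up u v hq (by simpa using hq') (by simpa using hχ)
      exact ⟨s, h3, h4, Or.inl ⟨h5, by rw [← h5]⟩⟩
    · obtain ⟨s, h3, h4, h5⟩ := up u (v - 1) (by simpa [sub_eq_add_neg] using hq')
        (by simpa using hq) (by simpa [sub_eq_add_neg] using hχ.symm)
      exact ⟨s, h3, h4, Or.inr ⟨by rw [← h5]; simp [sub_eq_add_neg], by rw [← h5]; simp⟩⟩
  · intro s h3 h4
    have h5 := hQ s h3 h4
    simp only [Prod.smul_mk, smul_eq_mul, mul_one, mul_zero, Prod.mk_add_mk, add_zero] at h5 ⊢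
    exact (vert (x + s) y h5.1 h5.2).2 ⟨rfl, by omega, by omega⟩

theorem exists_strip {O : Set (ℤ × ℤ)} (hO : O.Finite) (hc : HasCuts O)
    (hc' : HasCuts (Prod.swap ⁻¹' O)) {p d n : ℤ × ℤ} (hf : IsFrame d n) (h1 : p ∈ O)
    (h2 : p + n ∈ O) : ∃ a b χ, IsStrip O p d n a b χ := by
  revert p
  refine hf.cases (C := fun d n => ∀ {p : ℤ × ℤ}, p ∈ O → p + n ∈ O →
    ∃ a b χ, IsStrip O p d n a b χ) ?_ ?_ ?_ ?_
  · exact fun h1 h2 => hc.exists_strip_aux hO h1 h2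
  · intro p h1 h2
    obtain ⟨a, b, χ, h⟩ := hc'.exists_strip_aux (p := p.swap)
      (hO.preimage Prod.swap_injective.injOn) (by simpa) (by
        show (p.swap + (0, 1)).swap ∈ O
        simpa using h2)
    exact ⟨a, b, _, h.swap⟩
  · intro d n h p h1 h2
    obtain ⟨a, b, χ, h⟩ := h h1 h2
    exact ⟨_, _, _, h.reverse⟩
  · intro d n h p h1 h2
    obtain ⟨a, b, χ, h⟩ := h (p := p + -n) h2 (by simpa)
    have := h.flip
    rw [neg_add_cancel_right] at this
    exact ⟨_, _, _, this⟩

lemma IsSolidGridEmbedding.exists_strip {V : Type*} [Finite V] {G : SimpleGraph V}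
    {φ : V → ℤ × ℤ} (hs : IsSolidGridEmbedding G φ) {p d n : ℤ × ℤ} (hf : IsFrame d n)
    (h1 : p ∈ Set.range φ) (h2 : p + n ∈ Set.range φ) :
    ∃ a b χ, IsStrip (Set.range φ) p d n a b χ :=
  _root_.exists_strip (Set.finite_range φ) (fun _ _ h => (hs.splitsRight h).1)
    (fun _ _ h => (hs.splitsRight fun h' => h ⟨h'.1, h'.2.2.1, h'.2.1, h'.2.2.2⟩).2) hf h1 h2

/-! ### Distances in solid grid graphs -/

/-- The `ℓ¹`-distance of two lattice points. -/
def latticeDist (p q : ℤ × ℤ) : ℤ := |p.1 - q.1| + |p.2 - q.2|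

lemma latticeDist_triangle (p q r : ℤ × ℤ) :
    latticeDist p r ≤ latticeDist p q + latticeDist q r := by
  have h1 := abs_sub_le p.1 q.1 r.1
  have h2 := abs_sub_le p.2 q.2 r.2
  unfold latticeDist
  omega

lemma LatticeAdj.latticeDist_eq {p q : ℤ × ℤ} (h : LatticeAdj p q) : latticeDist p q = 1 := by
  rcases h.cases with rfl | rfl | rfl | rfl <;> simp [latticeDist]

lemma IsFrame.latticeDist_line {d n : ℤ × ℤ} (hf : IsFrame d n) (p : ℤ × ℤ) (s t : ℤ) :
    latticeDist (p + s • d) (p + t • d) = |s - t| := by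
  rcases hf with ⟨rfl | rfl, rfl | rfl⟩ | ⟨rfl | rfl, rfl | rfl⟩ <;> simp [latticeDist] <;>
    rw [← abs_neg] <;> ring_nf

lemma IsFrame.ne {d n : ℤ × ℤ} (hf : IsFrame d n) : d ≠ n ∧ d ≠ -n ∧ d ≠ 0 ∧ n ≠ 0 := by
  rcases hf with ⟨rfl | rfl, rfl | rfl⟩ | ⟨rfl | rfl, rfl | rfl⟩ <;> simp

lemma IsFrame.smul_inj {d n : ℤ × ℤ} (hf : IsFrame d n) {s t : ℤ} (h : s • d = t • d) :
    s = t := by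
  rcases hf with ⟨rfl | rfl, rfl | rfl⟩ | ⟨rfl | rfl, rfl | rfl⟩ <;> simpa using h

lemma IsFrame.smul_add_ne {d n : ℤ × ℤ} (hf : IsFrame d n) (s t : ℤ) :
    s • d + n ≠ t • d := by
  rcases hf with ⟨rfl | rfl, rfl | rfl⟩ | ⟨rfl | rfl, rfl | rfl⟩ <;> simp

lemma LatticeAdj.exists_frame {p q : ℤ × ℤ} (h : LatticeAdj p q) :
    ∃ d n, IsFrame d n ∧ q = p + n := by
  rcases h.cases with rfl | rfl | rfl | rfl
  · exact ⟨(0, 1), _, by simp [IsFrame], rfl⟩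
  · exact ⟨(0, 1), _, by simp [IsFrame], rfl⟩
  · exact ⟨(1, 0), _, by simp [IsFrame], rfl⟩
  · exact ⟨(1, 0), _, by simp [IsFrame], rfl⟩

/-- This is where the dimension enters: the contradiction at the end of
`IsSolidGridEmbedding.exists_corner_interval`. -/
lemma IsFrame.not_pairwise {d₁ d₂ d₃ : ℤ × ℤ} (h₁ : IsFrame d₁ d₂) (h₂ : IsFrame d₁ d₃)
    (h₃ : IsFrame d₂ d₃) : False := by
  rcases h₁ with ⟨rfl | rfl, rfl | rfl⟩ | ⟨rfl | rfl, rfl | rfl⟩ <;>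
    simp [IsFrame] at h₂ h₃ <;> rcases h₂ with rfl | rfl <;> simp at h₃

/-! ### The two sides of a strip -/

section Strips

variable {O : Set (ℤ × ℤ)} {p d n : ℤ × ℤ} {a b : ℤ} {χ : ℤ × ℤ → Bool}

/-- Consecutive points of the near row are joined by an edge that is not a rung, so the colour does
not change. -/
lemma IsStrip.near_const (hS : IsStrip O p d n a b χ) (hf : IsFrame d n) {s t : ℤ}
    (h1 : a ≤ s) (h2 : s ≤ b) (h3 : a ≤ t) (h4 : t ≤ b) : χ (p + s • d) = χ (p + t • d) := by
  have step : ∀ s, a ≤ s → s + 1 ≤ b → χ (p + s • d) = χ (p + (s + 1) • d) := by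
    intro s h1 h2
    by_contra hne
    have e : p + (s + 1) • d = p + s • d + d := by rw [add_smul, one_smul, add_assoc]
    obtain ⟨t, -, -, ⟨h3, h4⟩ | ⟨h3, h4⟩⟩ := hS.cross _ (hS.near s h1 (by omega)) _
      (hS.near (s + 1) (by omega) h2) (by rw [e]; exact hf.latticeAdj _) hne
    · rw [e, h3] at h4
      exact hf.ne.1 (add_left_cancel h4)
    · rw [add_assoc, add_left_cancel_iff] at h4
      exact hf.smul_add_ne _ _ h4.symm
  have main : ∀ k : ℕ, a + k ≤ b → χ (p + (a + k) • d) = χ (p + a • d) := by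
    intro k
    induction k with
    | zero => simp
    | succ k ih =>
      intro h
      push_cast at h ⊢
      rw [← ih (by omega), step (a + k) (by omega) (by omega), add_assoc]
  obtain ⟨k, hk⟩ := Int.eq_ofNat_of_zero_le (sub_nonneg.2 h1)
  obtain ⟨l, hl⟩ := Int.eq_ofNat_of_zero_le (sub_nonneg.2 h3)
  obtain rfl : s = a + k := by omega
  obtain rfl : t = a + l := by omega
  rw [main k h2, main l h4]

/-- The orientation of the edges which leave the near side of a strip. -/
lemma IsStrip.cross_near (hS : IsStrip O p d n a b χ) (hf : IsFrame d n) {q q' : ℤ × ℤ}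
    (hq : q ∈ O) (hq' : q' ∈ O) (hqq : LatticeAdj q q') (h1 : χ q = χ p) (h2 : χ q' ≠ χ p) :
    ∃ s, a ≤ s ∧ s ≤ b ∧ q = p + s • d ∧ q' = p + s • d + n := by
  obtain ⟨s, h3, h4, h5 | h5⟩ := hS.cross q hq q' hq' hqq (by rw [h1]; exact h2.symm)
  · exact ⟨s, h3, h4, h5⟩
  · refine absurd (hS.near_const hf h3 h4 hS.left_le hS.le_right) ?_
    rw [← h5.1]
    simpa using h2

lemma IsStrip.one_le (hS : IsStrip O p d n a b χ) (h1 : p + d ∈ O) (h2 : p + d + n ∈ O) :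
    1 ≤ b := by
  by_contra hb
  have := hS.le_right
  obtain rfl : b = 0 := by omega
  exact hS.right_end (by simpa using ⟨h1, h2⟩)

end Strips

/-! ### Halfspaces and betweenness -/

section Metric

variable {V : Type*} {G : SimpleGraph V} {φ : V → ℤ × ℤ}

lemma IsGridEmbedding.latticeDist_le (hφ : IsGridEmbedding G φ) {u v : V} (w : G.Walk u v) :
    latticeDist (φ u) (φ v) ≤ w.length := by
  induction w with
  | nil => simp [latticeDist]
  | @cons u x v h w ih =>
    have h1 := latticeDist_triangle (φ u) (φ x) (φ v)
    have h2 : LatticeAdj (φ u) (φ x) := (hφ.adj_iff _ _).1 h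
    have h3 := h2.latticeDist_eq
    simp only [SimpleGraph.Walk.length_cons]
    push_cast
    linarith

lemma IsGridEmbedding.exists_walk_line (hφ : IsGridEmbedding G φ) {d n : ℤ × ℤ}
    (hf : IsFrame d n) (k : ℕ) {u v : V} (hv : φ v = φ u + (k : ℤ) • d)
    (h : ∀ i : ℕ, i ≤ k → φ u + (i : ℤ) • d ∈ Set.range φ) :
    ∃ w : G.Walk u v, w.length = k ∧
      ∀ x, x ∈ w.support ↔ ∃ i : ℕ, i ≤ k ∧ φ x = φ u + (i : ℤ) • d := by
  induction k generalizing u with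
  | zero =>
    obtain rfl : v = u := hφ.injective (by simpa using hv)
    refine ⟨.nil, rfl, fun x => ?_⟩
    simp only [SimpleGraph.Walk.support_nil, List.mem_singleton, Nat.le_zero]
    constructor
    · rintro rfl
      exact ⟨0, rfl, by simp⟩
    · rintro ⟨i, rfl, hi⟩
      exact hφ.injective (by simpa using hi)
  | succ k ih =>
    obtain ⟨x, hx⟩ := h 1 (by omega)
    rw [Nat.cast_one, one_smul] at hx
    have e : ∀ i : ℕ, φ u + ((i + 1 : ℕ) : ℤ) • d = φ x + (i : ℤ) • d := by
      intro i
      rw [hx]; push_cast; rw [add_smul, one_smul]; abel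
    have hux : G.Adj u x := (hφ.adj_iff _ _).2 (by rw [hx]; exact hf.latticeAdj _)
    obtain ⟨w, hw, hws⟩ := ih (u := x) (by rw [hv, e])
      (fun i hi => by rw [← e]; exact h (i + 1) (by omega))
    refine ⟨.cons hux w, by simp [hw], fun y => ?_⟩
    rw [SimpleGraph.Walk.support_cons, List.mem_cons, hws]
    constructor
    · rintro (rfl | ⟨i, hi, hi'⟩)
      · exact ⟨0, by omega, by simp⟩
      · exact ⟨i + 1, by omega, by rw [hi', e]⟩
    · rintro ⟨i, hi, hi'⟩
      cases i with
      | zero => left; exact hφ.injective (by simpa using hi')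
      | succ i => right; exact ⟨i, by omega, by rw [hi', e]⟩

lemma IsStrip.exists_walk_near {p d n : ℤ × ℤ} {a b : ℤ} {χ : ℤ × ℤ → Bool}
    (hS : IsStrip (Set.range φ) p d n a b χ) (hφ : IsGridEmbedding G φ)
    (hf : IsFrame d n) {s t : ℤ} (h1 : a ≤ s) (h2 : s ≤ b) (h3 : a ≤ t) (h4 : t ≤ b) {u v : V}
    (hu : φ u = p + s • d) (hv : φ v = p + t • d) : ∃ w : G.Walk u v, (w.length : ℤ) = |s - t| := by
  have main : ∀ s t, a ≤ s → s ≤ t → t ≤ b → ∀ u v, φ u = p + s • d → φ v = p + t • d →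
      ∃ w : G.Walk u v, (w.length : ℤ) = t - s := by
    intro s t h1 h2 h3 u v hu hv
    obtain ⟨k, hk⟩ := Int.eq_ofNat_of_zero_le (sub_nonneg.2 h2)
    obtain rfl : t = s + k := by omega
    obtain ⟨w, hw, -⟩ := hφ.exists_walk_line hf k (u := u) (v := v)
      (by rw [hu, hv, add_smul, add_assoc])
      (fun i hi => by rw [hu, add_assoc, ← add_smul]; exact hS.near _ (by omega) (by omega))
    exact ⟨w, by rw [hw]; ring⟩
  rcases le_total s t with h | h
  · obtain ⟨w, hw⟩ := main s t h1 h h4 u v hu hv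
    exact ⟨w, by rw [hw, abs_sub_comm, abs_of_nonneg (by omega)]⟩
  · obtain ⟨w, hw⟩ := main t s h3 h h2 v u hv hu
    exact ⟨w.reverse, by rw [SimpleGraph.Walk.length_reverse, hw, abs_of_nonneg (by omega)]⟩

lemma SimpleGraph.Walk.exists_first_crossing {u c : V} (w : G.Walk u c) (f : V → Bool) (t : Bool)
    (hu : f u = t) (hc : f c ≠ t) : ∃ (x y : V) (_ : G.Adj x y) (w₁ : G.Walk u x)
      (w₂ : G.Walk y c), f x = t ∧ f y ≠ t ∧ w₁.length + 1 + w₂.length = w.length := by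
  induction w with
  | nil => exact absurd hu hc
  | @cons u v c h w ih =>
    by_cases hv : f v = t
    · obtain ⟨x, y, hxy, w₁, w₂, h1, h2, h3⟩ := ih hv hc
      refine ⟨x, y, hxy, .cons h w₁, w₂, h1, h2, ?_⟩
      simp only [SimpleGraph.Walk.length_cons]
      omega
    · exact ⟨u, v, h, .nil, w, hu, hv, by simp; omega⟩

/-- A vertex on the other side of a strip is closer to the far end of each rung. -/
lemma IsStrip.dist_lt {p d n : ℤ × ℤ} {a b : ℤ} {χ : ℤ × ℤ → Bool}
    (hS : IsStrip (Set.range φ) p d n a b χ) (hφ : IsGridEmbedding G φ)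
    (hf : IsFrame d n) {s : ℤ} (h1 : a ≤ s) (h2 : s ≤ b) {u v c : V}
    (hu : φ u = p + s • d) (hv : φ v = p + s • d + n) (huc : G.Reachable u c)
    (hc : χ (φ c) ≠ χ p) : G.dist v c < G.dist u c := by
  obtain ⟨w, hw⟩ := huc.exists_walk_length_eq_dist
  have hup : χ (φ u) = χ p := by
    rw [hu, hS.near_const hf h1 h2 hS.left_le hS.le_right]; simp
  obtain ⟨x, y, hxy, w₁, w₂, hx, hy, hlen⟩ := w.exists_first_crossing (fun v => χ (φ v)) _ hup hc
  obtain ⟨t, h3, h4, h5, h6⟩ := hS.cross_near hf ⟨x, rfl⟩ ⟨y, rfl⟩ ((hφ.adj_iff _ _).1 hxy) hx hy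
  -- Before its first crossing, at rung `t`, the geodesic has made at least `|s - t|` steps. The far
  -- row makes the same shift in exactly `|s - t|` steps, so a start at `v` saves the crossing step.
  have h7 := hφ.latticeDist_le w₁
  rw [hu, h5, hf.latticeDist_line] at h7
  obtain ⟨w₃, hw₃⟩ := hS.flip.exists_walk_near hφ hf.neg_right h1 h2 h3 h4 (u := v) (v := y)
    (by rw [hv]; abel) (by rw [h6]; abel)
  have h8 := SimpleGraph.dist_le (w₃.append w₂)
  rw [SimpleGraph.Walk.length_append] at h8
  omega

/-- Within a component the halfspaces of a rung are thus the colour classes. The converse is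
`IsStrip.dist_lt` for the flipped strip. -/
lemma IsStrip.dist_lt_iff {p d n : ℤ × ℤ} {a b : ℤ} {χ : ℤ × ℤ → Bool}
    (hS : IsStrip (Set.range φ) p d n a b χ) (hφ : IsGridEmbedding G φ)
    (hf : IsFrame d n) {s : ℤ} (h1 : a ≤ s) (h2 : s ≤ b) {u v c : V}
    (hu : φ u = p + s • d) (hv : φ v = p + s • d + n) (huc : G.Reachable u c) :
    G.dist v c < G.dist u c ↔ χ (φ c) ≠ χ p := by
  refine ⟨fun h hc => ?_, hS.dist_lt hφ hf h1 h2 hu hv huc⟩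
  have huv : G.Adj u v := (hφ.adj_iff _ _).2 (by rw [hu, hv]; exact hf.symm.latticeAdj _)
  have h3 := hS.ne 0 hS.left_le hS.le_right
  rw [zero_smul, add_zero] at h3
  have := hS.flip.dist_lt hφ hf.neg_right h1 h2 (u := v) (v := u) (c := c) (by rw [hv]; abel)
    (by rw [hu]; abel) (huv.symm.reachable.trans huc) (by rw [hc]; exact h3)
  omega

/-- By `hl`, stepping from `u` to `q` increases the distance to every point of the near row. A
geodesic from `q` to `c` crosses some rung `t` and has then made at least `|t| + 2` steps. From `u`,
crossing at once and following the far row reaches the same point in `|t| + 1` steps, so `u` is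
closer to `c` than `q`. -/
lemma IsStrip.not_both_closer {d n : ℤ × ℤ} {a b : ℤ} {χ : ℤ × ℤ → Bool} {u v q c : V}
    (hS : IsStrip (Set.range φ) (φ u) d n a b χ) (hφ : IsGridEmbedding G φ) (hf : IsFrame d n)
    (hv : φ v = φ u + n) (huq : G.Adj u q) (hqv : q ≠ v)
    (hl : ∀ s, a ≤ s → s ≤ b → latticeDist (φ q) (φ u + s • d) = |s| + 1)
    (huc : G.Reachable u c) (hvc : G.dist v c < G.dist u c) (hqc : G.dist q c < G.dist u c) :
    False := by
  rw [hS.dist_lt_iff hφ hf hS.left_le hS.le_right (by simp) (by simpa) huc] at hvc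
  have hq : χ (φ q) = χ (φ u) := by
    by_contra hne
    obtain ⟨s, h1, h2, h3, h4⟩ := hS.cross_near hf ⟨u, rfl⟩ ⟨q, rfl⟩ ((hφ.adj_iff _ _).1 huq)
      rfl hne
    rw [← h3, ← hv] at h4
    exact hqv (hφ.injective h4)
  obtain ⟨w, hw⟩ := (huq.symm.reachable.trans huc).exists_walk_length_eq_dist
  obtain ⟨x, y, hxy, w₁, w₂, hx, hy, hlen⟩ := w.exists_first_crossing (fun v => χ (φ v)) _ hq hvc
  obtain ⟨t, h3, h4, h5, h6⟩ := hS.cross_near hf ⟨x, rfl⟩ ⟨y, rfl⟩ ((hφ.adj_iff _ _).1 hxy) hx hy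
  have h7 := hφ.latticeDist_le w₁
  rw [h5, hl t h3 h4] at h7
  obtain ⟨w₃, hw₃⟩ := hS.flip.exists_walk_near hφ hf.neg_right hS.left_le hS.le_right h3 h4
    (u := v) (v := y) (by rw [hv]; simp) (by rw [h6]; abel)
  have huv : G.Adj u v := (hφ.adj_iff _ _).2 (by rw [hv]; exact hf.symm.latticeAdj _)
  have h8 := SimpleGraph.dist_le (SimpleGraph.Walk.cons huv (w₃.append w₂))
  rw [SimpleGraph.Walk.length_cons, SimpleGraph.Walk.length_append] at h8
  rw [zero_sub, abs_neg] at hw₃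
  omega

lemma mem_geodesicInterval_of_dist_eq {u x w : V} (hux : G.Reachable u x) (hxw : G.Reachable x w)
    (h : G.dist u w = G.dist u x + G.dist x w) : x ∈ geodesicInterval G u w := by
  obtain ⟨w₁, h₁⟩ := hux.exists_walk_length_eq_dist
  obtain ⟨w₂, h₂⟩ := hxw.exists_walk_length_eq_dist
  have h3 : (w₁.append w₂).length = G.dist u w := by
    rw [SimpleGraph.Walk.length_append, h₁, h₂, h]
  exact ⟨w₁.append w₂, SimpleGraph.Walk.isPath_of_length_eq_dist _ h3, h3, by simp⟩

lemma dist_eq_of_mem_geodesicInterval {u x w : V} (h : x ∈ geodesicInterval G u w) :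
    G.Reachable x u ∧ G.Reachable x w ∧ G.dist u w = G.dist x u + G.dist x w := by
  classical
  obtain ⟨p, -, hp, hx⟩ := h
  have h1 := congrArg SimpleGraph.Walk.length (p.take_spec hx)
  rw [SimpleGraph.Walk.length_append, hp] at h1
  have h2 := SimpleGraph.dist_le (p.takeUntil x hx).reverse
  have h3 := SimpleGraph.dist_le (p.dropUntil x hx)
  rw [SimpleGraph.Walk.length_reverse] at h2
  have hr1 : G.Reachable x u := (p.takeUntil x hx).reverse.reachable
  have hr2 : G.Reachable x w := (p.dropUntil x hx).reachable
  refine ⟨hr1, hr2, ?_⟩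
  obtain ⟨w₁, h₁⟩ := hr1.symm.exists_walk_length_eq_dist
  obtain ⟨w₂, h₂⟩ := hr2.exists_walk_length_eq_dist
  have h4 := SimpleGraph.dist_le (w₁.append w₂)
  rw [SimpleGraph.Walk.length_append, h₁, h₂, G.dist_comm (u := u) (v := x)] at h4
  omega

variable [Finite V]

/-- There are no ties, since `c` is on one of the two sides of the strip of `uv`. -/
lemma IsSolidGridEmbedding.dist_lt_or_lt (hs : IsSolidGridEmbedding G φ) {u v c : V}
    (huv : G.Adj u v) (huc : G.Reachable u c) :
    G.dist v c < G.dist u c ∨ G.dist u c < G.dist v c := by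
  obtain ⟨d, n, hf, hv⟩ := LatticeAdj.exists_frame ((hs.1.adj_iff _ _).1 huv)
  obtain ⟨a, b, χ, hS⟩ := hs.exists_strip hf ⟨u, rfl⟩ ⟨v, hv⟩
  by_cases hc : χ (φ c) = χ (φ u)
  · right
    have h3 := hS.ne 0 hS.left_le hS.le_right
    rw [zero_smul, add_zero] at h3
    exact hS.flip.dist_lt hs.1 hf.neg_right hS.left_le hS.le_right (by simpa) (by simp)
      (huv.symm.reachable.trans huc) (by rw [hc]; exact h3)
  · left
    exact hS.dist_lt hs.1 hf hS.left_le hS.le_right (by simp) (by simpa) huc hc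

/-- Opposite edges of a square define the same halfspaces. -/
lemma IsSolidGridEmbedding.dist_lt_of_square (hs : IsSolidGridEmbedding G φ) {d n : ℤ × ℤ}
    (hf : IsFrame d n) {u v u' v' c : V} (hv : φ v = φ u + n) (hu' : φ u' = φ u + d)
    (hv' : φ v' = φ u + d + n) (huc : G.Reachable u c) (h : G.dist v c < G.dist u c) :
    G.dist v' c < G.dist u' c := by
  obtain ⟨a, b, χ, hS⟩ := hs.exists_strip hf ⟨u, rfl⟩ ⟨v, hv⟩
  have h1 := hS.one_le ⟨u', hu'⟩ ⟨v', hv'⟩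
  rw [hS.dist_lt_iff hs.1 hf hS.left_le hS.le_right (by simp) (by simpa) huc] at h
  have huu : G.Adj u' u :=
    (hs.1.adj_iff _ _).2 (by rw [hu']; exact (hf.latticeAdj _).symm)
  exact hS.dist_lt hs.1 hf (s := 1) (by have := hS.left_le; omega) h1 (by simpa) (by simpa)
    (huu.reachable.trans huc) h

/-- Two neighbours of `u` that are both closer to `c` span a square with `u`. -/
theorem IsSolidGridEmbedding.square_of_closer (hs : IsSolidGridEmbedding G φ) {u v q c : V}
    (huv : G.Adj u v) (huq : G.Adj u q) (hqv : q ≠ v) (huc : G.Reachable u c)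
    (hvc : G.dist v c < G.dist u c) (hqc : G.dist q c < G.dist u c) :
    ∃ d n, IsFrame d n ∧ φ v = φ u + n ∧ φ q = φ u + d ∧ φ u + d + n ∈ Set.range φ := by
  have side : ∀ d n, IsFrame d n → φ v = φ u + n → φ q = φ u + d →
      φ u + d + n ∈ Set.range φ := by
    intro d n hf hv hq
    by_contra hno
    obtain ⟨a, b, χ, hS⟩ := hs.exists_strip hf ⟨u, rfl⟩ ⟨v, hv⟩
    -- Without the fourth corner the strip ends at rung `0`, so all positions `s` are at most `0`
    -- and `q` lies beyond the end.
    have hb : b = 0 := by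
      have := hS.le_right
      by_contra hb
      exact hno (by simpa using hS.far 1 (by have := hS.left_le; omega) (by omega))
    refine hS.not_both_closer hs.1 hf hv huq hqv (fun s h1 h2 => ?_) huc hvc hqc
    rw [hq, ← one_smul ℤ d, smul_smul, hf.latticeDist_line, mul_one,
      abs_of_nonneg (show 0 ≤ 1 - s by omega), abs_of_nonpos (by omega)]
    ring
  obtain ⟨d, n, hf, hv⟩ := LatticeAdj.exists_frame ((hs.1.adj_iff _ _).1 huv)
  have h1 : LatticeAdj (φ u) (φ q) := (hs.1.adj_iff _ _).1 huq
  rcases h1.eq_add hf with h | h | h | h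
  · exact ⟨d, n, hf, hv, h, side d n hf hv h⟩
  · rw [sub_eq_add_neg] at h
    exact ⟨-d, n, hf.neg_left, hv, h, side _ n hf.neg_left hv h⟩
  · exact absurd (hs.1.injective (h.trans hv.symm)) hqv
  -- Opposite neighbours cannot both be closer: `φ u - n` has distance `|s| + 1` from position `s`
  -- of the near row.
  · obtain ⟨a, b, χ, hS⟩ := hs.exists_strip hf ⟨u, rfl⟩ ⟨v, hv⟩
    refine (hS.not_both_closer hs.1 hf hv huq hqv (fun s h1 h2 => ?_) huc hvc hqc).elim
    rw [h]
    rcases hf with ⟨rfl | rfl, rfl | rfl⟩ | ⟨rfl | rfl, rfl | rfl⟩ <;>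
      simp [latticeDist, add_comm]

/-- Two vertices such that no neighbour of `x` is closer to both have `x` between them. -/
theorem IsSolidGridEmbedding.dist_eq_add (hs : IsSolidGridEmbedding G φ) {x c c' : V}
    (hxc : G.Reachable x c) (hxc' : G.Reachable x c')
    (h : ∀ y, G.Adj x y → G.dist y c < G.dist x c → ¬ G.dist y c' < G.dist x c') :
    G.dist c c' = G.dist c x + G.dist x c' := by
  induction hk : G.dist x c' using Nat.strong_induction_on generalizing x with
  | _ k ih =>
    obtain ⟨w, hw⟩ := hxc'.exists_walk_length_eq_dist
    cases w with
    | nil => simp at hk; simp [← hk]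
    | @cons _ v _ hxv w =>
      have hv : G.dist v c' < G.dist x c' := by
        have := SimpleGraph.dist_le w
        rw [SimpleGraph.Walk.length_cons] at hw
        omega
      have hvc : G.dist x c < G.dist v c :=
        (hs.dist_lt_or_lt hxv hxc).resolve_left fun h' => h v hxv h' hv
      have hvr := hxv.symm.reachable.trans hxc
      have hvr' := hxv.symm.reachable.trans hxc'
      by_cases hall : ∀ y, G.Adj v y → G.dist y c < G.dist v c → ¬ G.dist y c' < G.dist v c'
      -- The step from `x` to `v` moves away from `c` and gains at most one towards `c'`, so the
      -- equation at `v` yields the one at `x`.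
      · have h1 := ih _ (by omega) hvr hvr' hall rfl
        have h2 : G.dist x c' ≤ G.dist v c' + 1 := by
          obtain ⟨w', hw'⟩ := hvr'.exists_walk_length_eq_dist
          have := SimpleGraph.dist_le (SimpleGraph.Walk.cons hxv w')
          rwa [SimpleGraph.Walk.length_cons, hw'] at this
        have h3 : G.dist c c' ≤ G.dist c x + G.dist x c' := by
          obtain ⟨w₁, h₁⟩ := hxc.symm.exists_walk_length_eq_dist
          obtain ⟨w₂, h₂⟩ := hxc'.exists_walk_length_eq_dist
          have := SimpleGraph.dist_le (w₁.append w₂)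
          rwa [SimpleGraph.Walk.length_append, h₁, h₂] at this
        rw [G.dist_comm (u := c) (v := v)] at h1
        rw [G.dist_comm (u := c) (v := x)] at h3 ⊢
        omega
      · push Not at hall
        obtain ⟨y, hvy, hyc, hyc'⟩ := hall
        -- Seen from `v`, both `x` and `y` are closer to `c`, so they span a square with fourth
        -- corner `z`. Its edges `vy` and `xz` are opposite, so `z` is closer than `x` to both `c`
        -- and `c'`, against `h`.
        have hyx : y ≠ x := by rintro rfl; omega
        obtain ⟨d, n, hf, hxd, hyd, z, hz⟩ := hs.square_of_closer hxv.symm hvy hyx hvr hvc hyc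
        have hxz : G.Adj x z := (hs.1.adj_iff _ _).2 (by
          rw [hxd, hz, add_right_comm]; exact hf.latticeAdj _)
        rw [add_right_comm] at hz
        exact absurd (hs.dist_lt_of_square hf.symm hyd hxd hz hvr' hyc')
          (h z hxz (hs.dist_lt_of_square hf.symm hyd hxd hz hvr hyc))

end Metric

/-! ### Ladders -/

/-- A ladder of `O`: the points `p + i • d` for `i ≤ k` form a maximal row of `O`, all the points
next to the row in direction `n` belong to `O`, and none of those on the other side does. -/
structure IsLadder (O : Set (ℤ × ℤ)) (p d n : ℤ × ℤ) (k : ℕ) : Prop where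
  frame : IsFrame d n
  one_le : 1 ≤ k
  before : p - d ∉ O
  after : p + (k + 1 : ℤ) • d ∉ O
  row : ∀ i : ℕ, i ≤ k → p + (i : ℤ) • d ∈ O
  top : ∀ i : ℕ, i ≤ k → p + (i : ℤ) • d + n ∈ O
  bottom : ∀ i : ℕ, i ≤ k → p + (i : ℤ) • d - n ∉ O

lemma IsLadder.reverse {O : Set (ℤ × ℤ)} {p d n : ℤ × ℤ} {k : ℕ} (h : IsLadder O p d n k) :
    IsLadder O (p + (k : ℤ) • d) (-d) n k := by
  have e : ∀ i : ℕ, i ≤ k → p + (k : ℤ) • d + (i : ℤ) • (-d) = p + ((k - i : ℕ) : ℤ) • d := by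
    intro i hi
    rw [Nat.cast_sub hi, smul_neg, sub_smul]; abel
  refine ⟨h.frame.neg_left, h.one_le, ?_, ?_, fun i hi => ?_, fun i hi => ?_, fun i hi => ?_⟩
  · have := h.after
    rw [add_smul, one_smul, ← add_assoc] at this
    rwa [sub_neg_eq_add]
  · have := h.before
    rwa [show p + (k : ℤ) • d + (k + 1 : ℤ) • (-d) = p - d by
      rw [smul_neg, add_smul, one_smul]; abel]
  · rw [e i hi]; exact h.row _ (by omega)
  · rw [e i hi]; exact h.top _ (by omega)
  · rw [e i hi]; exact h.bottom _ (by omega)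

lemma SimpleGraph.Reachable.of_forall_adj {V : Type*} {G : SimpleGraph V} {R : V → Prop} {a b : V}
    (hab : G.Reachable a b) (h : ∀ x y, G.Adj x y → R x → R y) (ha : R a) : R b := by
  obtain ⟨w⟩ := hab
  induction w with
  | nil => exact ha
  | cons hxy _ ih => exact ih (h _ _ hxy ha)

/-- A walk through `v` enters and leaves by neighbours of `v`, which are joined in the rest of the
graph. The predicate carried along the walk replaces `v` by `t`. -/
lemma not_isCutVertex_of_neighbors {V : Type*} {G : SimpleGraph V} {v t : V} (ht : G.Adj v t)
    (h : ∀ x (hx : G.Adj v x), (G.induce {x | x ≠ v}).Reachable ⟨x, hx.ne'⟩ ⟨t, ht.ne'⟩) :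
    ¬ IsCutVertex G v := by
  classical
  rintro ⟨a, b, ha, hb, hab, hn⟩
  refine hn ?_
  have := hab.of_forall_adj (R := fun z => if hz : z = v then
      (G.induce {x | x ≠ v}).Reachable ⟨a, ha⟩ ⟨t, ht.ne'⟩ else
      (G.induce {x | x ≠ v}).Reachable ⟨a, ha⟩ ⟨z, hz⟩) ?_ (by simp [ha])
  · simpa [hb] using this
  · intro x y hxy hx
    by_cases hxv : x = v
    · subst hxv
      simp only [dite_true] at hx
      simp only [hxy.ne', dite_false]
      exact hx.trans (h y hxy).symm
    · simp only [hxv, dite_false] at hx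
      by_cases hyv : y = v
      · subst hyv
        simp only [dite_true]
        exact hx.trans (h x hxy.symm)
      · simp only [hyv, dite_false]
        exact hx.trans (SimpleGraph.Adj.reachable (by simpa using hxy))

/-! ### Degrees in the lattice, and corner vertices in halfspaces -/

section Degree

variable {V : Type*} [Fintype V] {G : SimpleGraph V} [DecidableRel G.Adj] {φ : V → ℤ × ℤ}

open Classical in
lemma IsGridEmbedding.degree_eq (hφ : IsGridEmbedding G φ) {d n : ℤ × ℤ} (hf : IsFrame d n)
    (u : V) : G.degree u = (if φ u + d ∈ Set.range φ then 1 else 0) +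
      (if φ u - d ∈ Set.range φ then 1 else 0) + (if φ u + n ∈ Set.range φ then 1 else 0) +
      (if φ u - n ∈ Set.range φ then 1 else 0) := by
  have h1 : (G.neighborFinset u).image φ =
      ({φ u + d, φ u - d, φ u + n, φ u - n} : Finset (ℤ × ℤ)).filter (· ∈ Set.range φ) := by
    ext q
    simp only [Finset.mem_image, SimpleGraph.mem_neighborFinset, Finset.mem_filter,
      Finset.mem_insert, Finset.mem_singleton]
    constructor
    · rintro ⟨v, huv, rfl⟩
      have hl : LatticeAdj (φ u) (φ v) := (hφ.adj_iff _ _).1 huv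
      exact ⟨hl.eq_add hf, v, rfl⟩
    · rintro ⟨h, v, rfl⟩
      refine ⟨v, (hφ.adj_iff _ _).2 ?_, rfl⟩
      rcases h with h | h | h | h <;> rw [h]
      · exact hf.latticeAdj _
      · rw [sub_eq_add_neg]; exact hf.neg_left.latticeAdj _
      · exact hf.symm.latticeAdj _
      · rw [sub_eq_add_neg]; exact hf.neg_right.symm.latticeAdj _
  rw [← G.card_neighborFinset_eq_degree u, ← Finset.card_image_of_injective _ hφ.injective, h1,
    Finset.card_filter, Finset.sum_insert, Finset.sum_insert, Finset.sum_insert,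
    Finset.sum_singleton, add_assoc, add_assoc]
  all_goals
    rcases hf with ⟨rfl | rfl, rfl | rfl⟩ | ⟨rfl | rfl, rfl | rfl⟩ <;> simp [Prod.ext_iff] <;>
      omega

lemma IsLadder.degree_start {u : V} {d n : ℤ × ℤ} {k : ℕ}
    (h : IsLadder (Set.range φ) (φ u) d n k) (hφ : IsGridEmbedding G φ) : G.degree u = 2 := by
  have h1 := h.row 1 h.one_le
  have h2 := h.top 0 (Nat.zero_le _)
  have h3 := h.bottom 0 (Nat.zero_le _)
  simp only [Nat.cast_one, one_smul, Nat.cast_zero, zero_smul, add_zero] at h1 h2 h3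
  rw [hφ.degree_eq h.frame, if_pos h1, if_neg h.before, if_pos h2, if_neg h3]

lemma IsLadder.degree_inner {u v : V} {d n : ℤ × ℤ} {k i : ℕ}
    (h : IsLadder (Set.range φ) (φ u) d n k) (hφ : IsGridEmbedding G φ) (hi : 0 < i) (hik : i < k)
    (hv : φ v = φ u + (i : ℤ) • d) : G.degree v = 3 := by
  have h1 := h.row (i + 1) hik
  have h2 := h.row (i - 1) (by omega)
  have h3 := h.top i hik.le
  have h4 := h.bottom i hik.le
  rw [Nat.cast_add, Nat.cast_one, add_smul, one_smul, ← add_assoc, ← hv] at h1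
  rw [Nat.cast_sub hi, Nat.cast_one, sub_smul, one_smul, ← add_sub_assoc, ← hv] at h2
  rw [← hv] at h3 h4
  rw [hφ.degree_eq h.frame, if_pos h1, if_pos h2, if_pos h3, if_neg h4]

lemma IsLadder.degree_end {u v : V} {d n : ℤ × ℤ} {k : ℕ}
    (h : IsLadder (Set.range φ) (φ u) d n k) (hφ : IsGridEmbedding G φ)
    (hv : φ v = φ u + (k : ℤ) • d) : G.degree v = 2 := by
  have := h.reverse
  rw [← hv] at this
  exact this.degree_start hφ

lemma IsLadder.degree_row {u v : V} {d n : ℤ × ℤ} {k i : ℕ}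
    (h : IsLadder (Set.range φ) (φ u) d n k) (hφ : IsGridEmbedding G φ) (hik : i ≤ k)
    (hv : φ v = φ u + (i : ℤ) • d) : G.degree v = 2 ∨ G.degree v = 3 := by
  rcases Nat.eq_zero_or_pos i with rfl | hi
  · left
    obtain rfl : v = u := hφ.injective (by simpa using hv)
    exact h.degree_start hφ
  · rcases hik.eq_or_lt with rfl | hik
    · exact Or.inl (h.degree_end hφ hv)
    · exact Or.inr (h.degree_inner hφ hi hik hv)

/-- The vertices of degree one and the ends of ladders. -/
def IsCornerVertex (G : SimpleGraph V) [DecidableRel G.Adj] (φ : V → ℤ × ℤ) (c : V) : Prop :=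
  G.degree c = 1 ∨ ∃ d n k, IsLadder (Set.range φ) (φ c) d n k

/-! ### Corner vertices form a geodetic set -/

/-- Every halfspace contains a corner vertex. -/
theorem IsSolidGridEmbedding.exists_corner_closer (hs : IsSolidGridEmbedding G φ) {u v : V}
    (huv : G.Adj u v) :
    ∃ c, IsCornerVertex G φ c ∧ G.Reachable u c ∧ G.dist v c < G.dist u c := by
  induction hm : Set.ncard {c | G.Reachable u c ∧ G.dist v c < G.dist u c}
    using Nat.strong_induction_on generalizing u v with
  | _ m ih =>
    by_contra hno
    have hvu : LatticeAdj (φ v) (φ u) := (hs.1.adj_iff _ _).1 huv.symm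
    obtain ⟨d, n, hf, hu⟩ := hvu.exists_frame
    obtain ⟨a, b, χ, hS⟩ := hs.exists_strip hf ⟨v, rfl⟩ ⟨u, hu⟩
    -- Every rung of the strip defines the same halfspace as `uv`.
    have mem_iff : ∀ s, a ≤ s → s ≤ b → ∀ x y, φ x = φ v + s • d → φ y = φ v + s • d + n →
        ∀ c, G.Reachable u c ∧ G.dist v c < G.dist u c ↔
          G.Reachable y c ∧ G.dist x c < G.dist y c := by
      intro s h1 h2 x y hx hy c
      obtain ⟨w, -⟩ := hS.exists_walk_near hs.1 hf hS.left_le hS.le_right h1 h2 (u := v) (v := x)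
        (by simp) hx
      have hxy : G.Adj x y := (hs.1.adj_iff _ _).2 (by rw [hx, hy]; exact hf.symm.latticeAdj _)
      have huy : G.Reachable u y := huv.reachable.trans (w.reachable.trans hxy.reachable)
      have e : ∀ {x y}, φ x = φ v + s • d → φ y = φ v + s • d + n → G.Adj x y →
          G.Reachable x c → (G.dist x c < G.dist y c ↔ χ (φ c) = χ (φ v)) := by
        intro x y hx hy hxy hr
        have h3 := hS.dist_lt_iff hs.1 hf h1 h2 hx hy hr
        have h4 := hs.dist_lt_or_lt hxy hr
        constructor
        · intro h5
          by_contra h6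
          have := h3.2 h6
          omega
        · intro h5
          exact h4.resolve_left fun h6 => h3.1 h6 h5
      have e0 : G.Reachable u c → (G.dist v c < G.dist u c ↔ χ (φ c) = χ (φ v)) := by
        intro hr
        have h3 := hS.dist_lt_iff hs.1 hf hS.left_le hS.le_right (u := v) (v := u) (c := c)
          (by simp) (by simpa) (huv.symm.reachable.trans hr)
        have h4 := hs.dist_lt_or_lt huv.symm (huv.symm.reachable.trans hr)
        constructor
        · intro h5
          by_contra h6
          have := h3.2 h6
          omega
        · intro h5
          exact h4.resolve_left fun h6 => h3.1 h6 h5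
      constructor
      · rintro ⟨hr, h3⟩
        have hr' := huy.symm.trans hr
        exact ⟨hr', (e hx hy hxy (hxy.reachable.trans hr')).2 ((e0 hr).1 h3)⟩
      · rintro ⟨hr', h3⟩
        have hr := huy.trans hr'
        exact ⟨hr, (e0 hr).2 ((e hx hy hxy (hxy.reachable.trans hr')).1 h3)⟩
    -- Let `xz` leave the near row without spanning a square with the rung `xy`. Its halfspace lies
    -- in the present one: a vertex closer both to `z` and to `y` than to `x` would produce the
    -- square by `square_of_closer`. It is smaller, as `x` belongs to the present one only, so by
    -- induction it contains a corner vertex.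
    have no_exit : ∀ s, a ≤ s → s ≤ b → ∀ x y z, φ x = φ v + s • d → φ y = φ v + s • d + n →
        G.Adj x z → z ≠ y → ¬ (IsFrame (φ z - φ x) n ∧ φ z + n ∈ Set.range φ) → False := by
      intro s h1 h2 x y z hx hy hxz hzy hsq
      have hxy : G.Adj x y := (hs.1.adj_iff _ _).2 (by rw [hx, hy]; exact hf.symm.latticeAdj _)
      have hsub : {c | G.Reachable x c ∧ G.dist z c < G.dist x c} ⊆
          {c | G.Reachable u c ∧ G.dist v c < G.dist u c} := by
        rintro c ⟨hr, hc⟩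
        refine (mem_iff s h1 h2 x y hx hy c).2 ⟨hxy.symm.reachable.trans hr, ?_⟩
        refine (hs.dist_lt_or_lt hxy hr).resolve_left fun hyc => hsq ?_
        obtain ⟨d', n', hf', hy', hz', hmem⟩ := hs.square_of_closer hxy hxz hzy hr hyc hc
        obtain rfl : n' = n := by
          rw [hy, ← hx] at hy'
          exact (add_left_cancel hy').symm
        rw [hz', add_sub_cancel_left]
        exact ⟨hf', hmem⟩
      have hx1 : x ∈ {c | G.Reachable u c ∧ G.dist v c < G.dist u c} := by
        refine (mem_iff s h1 h2 x y hx hy x).2 ⟨hxy.symm.reachable, ?_⟩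
        rw [SimpleGraph.dist_self, SimpleGraph.dist_eq_one_iff_adj.2 hxy.symm]
        exact one_pos
      have hx2 : x ∉ {c | G.Reachable x c ∧ G.dist z c < G.dist x c} := by
        simp
      have hlt := Set.ncard_lt_ncard (Set.ssubset_iff_subset_ne.2
        ⟨hsub, fun h => hx2 (h ▸ hx1)⟩) (Set.toFinite _)
      obtain ⟨c, hc, hc'⟩ := ih _ (hm ▸ hlt) hxz rfl
      exact hno ⟨c, hc, hsub hc'⟩
    -- Hence nothing lies below the near row or beyond its ends. It is a ladder row, or a single
    -- vertex of degree one if the strip has only one rung.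
    have hrow := hS.near
    have htop := hS.far
    have hbot : ∀ s, a ≤ s → s ≤ b → φ v + s • d - n ∉ Set.range φ := by
      rintro s h1 h2 ⟨z, hz⟩
      obtain ⟨x, hx⟩ := hrow s h1 h2
      obtain ⟨y, hy⟩ := htop s h1 h2
      refine no_exit s h1 h2 x y z hx hy ((hs.1.adj_iff _ _).2 ?_) ?_ ?_
      · rw [hz, hx, sub_eq_add_neg]
        exact hf.neg_right.symm.latticeAdj _
      · rintro rfl
        rw [hy] at hz
        rcases hf with ⟨rfl | rfl, rfl | rfl⟩ | ⟨rfl | rfl, rfl | rfl⟩ <;>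
          simp [Prod.ext_iff] at hz <;> omega
      · rw [hz, hx, sub_sub_cancel_left]
        rintro ⟨h, -⟩
        exact h.neg_left.ne.1 (by simp)
    have side : ∀ e, (e = d ∨ e = -d) → ∀ s, a ≤ s → s ≤ b →
        φ v + s • d + e + n ∉ Set.range φ → φ v + s • d + e ∉ Set.range φ := by
      rintro e he s h1 h2 hn ⟨z, hz⟩
      have hfe : IsFrame e n := by
        rcases he with rfl | rfl
        · exact hf
        · exact hf.neg_left
      obtain ⟨x, hx⟩ := hrow s h1 h2
      obtain ⟨y, hy⟩ := htop s h1 h2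
      refine no_exit s h1 h2 x y z hx hy ((hs.1.adj_iff _ _).2 ?_) ?_ ?_
      · rw [hz, hx]
        exact hfe.latticeAdj _
      · rintro rfl
        rw [hy] at hz
        exact hfe.ne.1 (add_left_cancel hz).symm
      · rw [hz]
        exact fun h => hn h.2
    have hleft : φ v + a • d - d ∉ Set.range φ := by
      intro h
      have e : φ v + a • d + -d = φ v + (a - 1) • d := by rw [sub_smul, one_smul]; abel
      rw [sub_eq_add_neg] at h
      refine side (-d) (Or.inr rfl) a le_rfl (hS.left_le.trans hS.le_right) (fun h' => ?_) h
      rw [e] at h h'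
      exact hS.left_end ⟨h, h'⟩
    have hright : φ v + (b + 1) • d ∉ Set.range φ := by
      intro h
      have e : φ v + b • d + d = φ v + (b + 1) • d := by rw [add_smul, one_smul]; abel
      refine side d (Or.inl rfl) b (hS.left_le.trans hS.le_right) le_rfl (fun h' => ?_) (e ▸ h)
      rw [e] at h'
      exact hS.right_end ⟨h, h'⟩
    have hab := hS.left_le.trans hS.le_right
    obtain ⟨x, hx⟩ := hrow a le_rfl hab
    obtain ⟨y, hy⟩ := htop a le_rfl hab
    have hxy : G.Adj x y := (hs.1.adj_iff _ _).2 (by rw [hx, hy]; exact hf.symm.latticeAdj _)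
    refine hno ⟨x, ?_, (mem_iff a le_rfl hab x y hx hy x).2 ⟨hxy.symm.reachable, ?_⟩⟩
    · obtain ⟨k, hk⟩ := Int.eq_ofNat_of_zero_le (sub_nonneg.2 hab)
      obtain rfl : b = a + k := by omega
      have e : ∀ t : ℤ, φ x + t • d = φ v + (a + t) • d := by
        intro t; rw [hx, add_smul, add_assoc]
      rcases Nat.eq_zero_or_pos k with rfl | hk0
      · left
        have h1 := htop a le_rfl hab
        have h2 := hbot a le_rfl hab
        have h3 : φ x + d ∉ Set.range φ := by
          have := e 1
          rw [one_smul] at this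
          rw [this]
          simpa using hright
        rw [← hx] at h1 h2 hleft
        rw [hs.1.degree_eq hf, if_neg h3, if_neg hleft, if_pos h1, if_neg h2]
      · right
        refine ⟨d, n, k, hf, hk0, hx ▸ hleft, ?_, fun i hi => ?_, fun i hi => ?_, fun i hi => ?_⟩
        · rw [e, ← add_assoc]; exact hright
        · rw [e]; exact hrow _ (by omega) (by omega)
        · rw [e]; exact htop _ (by omega) (by omega)
        · rw [e]; exact hbot _ (by omega) (by omega)
    · rw [SimpleGraph.dist_self, SimpleGraph.dist_eq_one_iff_adj.2 hxy.symm]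
      exact one_pos

/-- Otherwise, by `dist_eq_add`, any two corner vertices in the component of `x` have a neighbour of
`x` closer to both. Choosing corner vertices on both sides of the edge `x y₀` and behind `x` with
respect to `y₁` produces neighbours in too many perpendicular directions, as two neighbours closer
to the same vertex are perpendicular. -/
theorem IsSolidGridEmbedding.exists_corner_interval (hs : IsSolidGridEmbedding G φ) {x : V}
    (hx : G.degree x ≠ 0) : ∃ c c', IsCornerVertex G φ c ∧ IsCornerVertex G φ c' ∧
      x ∈ geodesicInterval G c c' := by
  by_contra hno
  have pair : ∀ c c', IsCornerVertex G φ c → IsCornerVertex G φ c' → G.Reachable x c →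
      G.Reachable x c' → ∃ y, G.Adj x y ∧ G.dist y c < G.dist x c ∧ G.dist y c' < G.dist x c' := by
    intro c c' hc hc' hr hr'
    by_contra hy
    push Not at hy
    refine hno ⟨c, c', hc, hc', mem_geodesicInterval_of_dist_eq hr.symm hr' ?_⟩
    exact hs.dist_eq_add hr hr' fun y h1 h2 => not_lt.2 (hy y h1 h2)
  have square : ∀ y y' c, G.Adj x y → G.Adj x y' → y' ≠ y → G.Reachable x c →
      G.dist y c < G.dist x c → G.dist y' c < G.dist x c →
        IsFrame (φ y' - φ x) (φ y - φ x) := by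
    intro y y' c h1 h2 h3 h4 h5 h6
    obtain ⟨d, n, hf, hy, hy', -⟩ := hs.square_of_closer h1 h2 h3 h4 h5 h6
    rwa [hy, hy', add_sub_cancel_left, add_sub_cancel_left]
  obtain ⟨y₀, hy₀⟩ := (G.degree_pos_iff_exists_adj x).1 (Nat.pos_of_ne_zero hx)
  obtain ⟨c₁, hc₁, hr₁, h₁⟩ := hs.exists_corner_closer hy₀
  obtain ⟨c₂, hc₂, hr₂, h₂⟩ := hs.exists_corner_closer hy₀.symm
  replace hr₂ := hy₀.reachable.trans hr₂
  obtain ⟨y₁, hy₁, h₁₁, h₁₂⟩ := pair c₁ c₂ hc₁ hc₂ hr₁ hr₂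
  obtain ⟨c₃, hc₃, hr₃, h₃⟩ := hs.exists_corner_closer hy₁.symm
  replace hr₃ := hy₁.reachable.trans hr₃
  obtain ⟨y₂, hy₂, h₂₂, h₂₃⟩ := pair c₂ c₃ hc₂ hc₃ hr₂ hr₃
  obtain ⟨y₃, hy₃, h₃₁, h₃₃⟩ := pair c₁ c₃ hc₁ hc₃ hr₁ hr₃
  have n₁₀ : y₁ ≠ y₀ := by rintro rfl; omega
  have n₂₀ : y₂ ≠ y₀ := by rintro rfl; omega
  have n₂₁ : y₂ ≠ y₁ := by rintro rfl; omega
  have n₃₁ : y₃ ≠ y₁ := by rintro rfl; omega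
  have f₁₀ := square _ _ _ hy₀ hy₁ n₁₀ hr₁ h₁ h₁₁
  have f₂₁ := square _ _ _ hy₁ hy₂ n₂₁ hr₂ h₁₂ h₂₂
  -- If `y₃ = y₀`, then `y₀`, `y₁`, `y₂` are pairwise perpendicular because of `c₁`, `c₂` and `c₃`.
  -- Otherwise `y₀`, `y₁`, `y₃` are all closer to `c₁`.
  by_cases n₃₀ : y₃ = y₀
  · subst n₃₀
    exact f₂₁.not_pairwise (square _ _ _ hy₃ hy₂ n₂₀ hr₃ h₃₃ h₂₃) f₁₀
  · exact (square _ _ _ hy₁ hy₃ n₃₁ hr₁ h₁₁ h₃₁).not_pairwise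
      (square _ _ _ hy₀ hy₃ n₃₀ hr₁ h₁ h₃₁) f₁₀

end Degree

/-! ### Corner paths and ladders -/

section CornerPath

variable {V : Type*} [Fintype V] {G : SimpleGraph V} [DecidableRel G.Adj] {φ : V → ℤ × ℤ}

/-- The neighbours of `v` in the row reach the vertex above `v` through the parallel row, which
avoids `v`. -/
lemma IsLadder.not_isCutVertex {V : Type*} {G : SimpleGraph V} {φ : V → ℤ × ℤ} {u v : V} {d n : ℤ × ℤ} {k i : ℕ}
    (h : IsLadder (Set.range φ) (φ u) d n k) (hφ : IsGridEmbedding G φ) (hik : i ≤ k)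
    (hv : φ v = φ u + (i : ℤ) • d) : ¬ IsCutVertex G v := by
  obtain ⟨t, ht⟩ := h.top i hik
  have hbot := h.bottom i hik
  rw [← hv] at ht hbot
  have hvt : G.Adj v t := (hφ.adj_iff _ _).2 (by rw [ht]; exact h.frame.symm.latticeAdj _)
  have via : ∀ x y, ∀ hx : G.Adj v x, ∀ e, IsFrame e n → φ x = φ v + e → φ y = φ v + e + n →
      (G.induce {x | x ≠ v}).Reachable ⟨x, hx.ne'⟩ ⟨t, hvt.ne'⟩ := by
    intro x y hx e he hxe hye
    have hyv : y ≠ v := by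
      rintro rfl
      rw [add_assoc] at hye
      have h0 : e + n = 0 := by simpa using hye.symm
      exact he.ne.2.1 (eq_neg_of_add_eq_zero_left h0)
    have h1 : G.Adj x y := (hφ.adj_iff _ _).2 (by rw [hxe, hye]; exact he.symm.latticeAdj _)
    have h2 : G.Adj t y := (hφ.adj_iff _ _).2 (by
      rw [ht, hye, add_right_comm]; exact he.latticeAdj _)
    have h3 : (G.induce {x | x ≠ v}).Adj ⟨x, hx.ne'⟩ ⟨y, hyv⟩ := by simpa using h1
    have h4 : (G.induce {x | x ≠ v}).Adj ⟨t, hvt.ne'⟩ ⟨y, hyv⟩ := by simpa using h2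
    exact h3.reachable.trans h4.symm.reachable
  refine not_isCutVertex_of_neighbors hvt fun x hx => ?_
  have hl : LatticeAdj (φ v) (φ x) := (hφ.adj_iff _ _).1 hx
  rcases hl.eq_add h.frame with hx' | hx' | hx' | hx'
  · have hi : i < k := by
      by_contra hi
      obtain rfl : i = k := by omega
      refine h.after ⟨x, ?_⟩
      rw [hx', hv, add_smul, one_smul, add_assoc]
    obtain ⟨y, hy⟩ := h.top (i + 1) hi
    refine via x y hx d h.frame hx' ?_
    rw [hy, hv, Nat.cast_add, Nat.cast_one, add_smul, one_smul, ← add_assoc]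
  · have hi : 0 < i := by
      by_contra hi
      obtain rfl : i = 0 := by omega
      refine h.before ⟨x, ?_⟩
      rw [hx', hv]; simp
    obtain ⟨y, hy⟩ := h.top (i - 1) (by omega)
    rw [sub_eq_add_neg] at hx'
    refine via x y hx (-d) h.frame.neg_left hx' ?_
    rw [hy, hv, Nat.cast_sub hi, Nat.cast_one, sub_smul, one_smul]; abel
  · obtain rfl : x = t := hφ.injective (hx'.trans ht.symm)
    rfl
  · exact absurd ⟨x, hx'⟩ hbot

lemma IsLadder.exists_cornerPath {u : V} {d n : ℤ × ℤ} {k : ℕ}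
    (h : IsLadder (Set.range φ) (φ u) d n k) (hφ : IsGridEmbedding G φ) :
    ∃ (v : V) (P : G.Walk u v), IsCornerPath G φ P := by
  obtain ⟨v, hv⟩ := h.row k le_rfl
  obtain ⟨w, hw, hws⟩ := hφ.exists_walk_line h.frame k hv h.row
  have huv : u ≠ v := by
    rintro rfl
    have h1 : (k : ℤ) • d = (0 : ℤ) • d := by simpa using hv.symm
    have := h.frame.smul_inj h1
    have := h.one_le
    omega
  refine ⟨v, w, ?_, huv, fun x hx => ?_, h.degree_start hφ, h.degree_end hφ hv,
    fun x hx hxu hxv => ?_, ?_⟩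
  · refine w.isPath_of_length_eq_dist (le_antisymm ?_ (SimpleGraph.dist_le w))
    obtain ⟨w', hw'⟩ := w.reachable.exists_walk_length_eq_dist
    have h1 := hφ.latticeDist_le w'
    have h2 := h.frame.latticeDist_line (φ u) 0 k
    rw [zero_smul, add_zero, ← hv, zero_sub, abs_neg, Nat.abs_cast] at h2
    omega
  · obtain ⟨i, hi, hxi⟩ := (hws x).1 hx
    exact h.not_isCutVertex hφ hi hxi
  · obtain ⟨i, hi, hxi⟩ := (hws x).1 hx
    refine h.degree_inner hφ (Nat.pos_of_ne_zero ?_) (lt_of_le_of_ne hi ?_) hxi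
    · rintro rfl
      exact hxu (hφ.injective (by simpa using hxi))
    · rintro rfl
      exact hxv (hφ.injective (hxi.trans hv.symm))
  · rcases h.frame with ⟨h1, -⟩ | ⟨h1, -⟩
    · right
      intro x hx
      obtain ⟨i, hi, hxi⟩ := (hws x).1 hx
      rw [hxi]
      rcases h1 with h1 | h1 <;> simp [h1]
    · left
      intro x hx
      obtain ⟨i, hi, hxi⟩ := (hws x).1 hx
      rw [hxi]
      rcases h1 with h1 | h1 <;> simp [h1]

/-- All steps are along one axis, and a change of direction would return to a vertex already
visited. -/
lemma IsGridEmbedding.exists_line_of_straight {V : Type*} {G : SimpleGraph V} {φ : V → ℤ × ℤ}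
    (hφ : IsGridEmbedding G φ) {u v : V} {P : G.Walk u v} (hP : P.IsPath) (huv : u ≠ v)
    (hst : (∀ w ∈ P.support, (φ w).1 = (φ u).1) ∨ (∀ w ∈ P.support, (φ w).2 = (φ u).2)) :
    ∃ d n, IsFrame d n ∧ ∀ i : ℕ, i ≤ P.length → φ (P.getVert i) = φ u + (i : ℤ) • d := by
  have hlen : 0 < P.length := by
    rw [Nat.pos_iff_ne_zero]
    exact fun h => huv (SimpleGraph.Walk.eq_of_length_eq_zero h)
  obtain ⟨e, n, hf, hstep⟩ : ∃ e n, IsFrame e n ∧ ∀ i, i < P.length →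
      φ (P.getVert (i + 1)) = φ (P.getVert i) + e ∨
        φ (P.getVert (i + 1)) = φ (P.getVert i) - e := by
    have hadj : ∀ i, i < P.length → LatticeAdj (φ (P.getVert i)) (φ (P.getVert (i + 1))) :=
      fun i hi => (hφ.adj_iff _ _).1 (P.adj_getVert_succ hi)
    rcases hst with hst | hst
    · refine ⟨(0, 1), (1, 0), by simp [IsFrame], fun i hi => ?_⟩
      have h1 := hst _ (P.getVert_mem_support i)
      have h2 := hst _ (P.getVert_mem_support (i + 1))
      rcases (hadj i hi).cases with h | h | h | h
      · rw [h] at h2; simp at h2; omega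
      · rw [h] at h2; simp at h2; omega
      · exact Or.inl h
      · exact Or.inr (by rw [h]; simp [sub_eq_add_neg])
    · refine ⟨(1, 0), (0, 1), by simp [IsFrame], fun i hi => ?_⟩
      have h1 := hst _ (P.getVert_mem_support i)
      have h2 := hst _ (P.getVert_mem_support (i + 1))
      rcases (hadj i hi).cases with h | h | h | h
      · exact Or.inl h
      · exact Or.inr (by rw [h]; simp [sub_eq_add_neg])
      · rw [h] at h2; simp at h2; omega
      · rw [h] at h2; simp at h2; omega
  obtain ⟨d, hfd, hd1, hd⟩ : ∃ d, IsFrame d n ∧ φ (P.getVert 1) = φ (P.getVert 0) + d ∧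
      ∀ i, i < P.length → φ (P.getVert (i + 1)) = φ (P.getVert i) + d ∨
        φ (P.getVert (i + 1)) = φ (P.getVert i) - d := by
    rcases hstep 0 hlen with h | h
    · exact ⟨e, hf, h, hstep⟩
    · exact ⟨-e, hf.neg_left, by rw [h, sub_eq_add_neg], fun i hi => by
        rw [sub_neg_eq_add, ← sub_eq_add_neg]; exact (hstep i hi).symm⟩
  refine ⟨d, n, hfd, fun i => ?_⟩
  induction i using Nat.strong_induction_on with
  | _ i ih =>
    intro hi
    match i, hi with
    | 0, _ => simp
    | 1, _ => rw [hd1]; simp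
    | i + 2, hi =>
      have h1 := ih i (by omega) (by omega)
      have h2 := ih (i + 1) (by omega) (by omega)
      rcases hd (i + 1) (by omega) with h | h
      · rw [h, h2]; push_cast; simp only [add_smul, one_smul, add_assoc]; abel
      · rw [h2] at h
        have h3 : φ (P.getVert (i + 2)) = φ (P.getVert i) := by
          rw [h, h1]; push_cast; rw [add_smul, one_smul]; abel
        have := hP.getVert_injOn (by simpa using hi) (by simp; omega) (hφ.injective h3)
        omega

/-- If the edge `wx` were in no square, its strip would have a single rung and `wx` would be a
bridge. Then `w`, having another neighbour `y`, would separate `y` from `x`. -/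
lemma IsSolidGridEmbedding.square_of_not_isCutVertex {V : Type*} [Finite V] {G : SimpleGraph V}
    {φ : V → ℤ × ℤ} (hs : IsSolidGridEmbedding G φ) {w x y : V} {d n : ℤ × ℤ} (hf : IsFrame d n)
    (hw : ¬ IsCutVertex G w) (hx : φ x = φ w + d) (hwy : G.Adj w y) (hxy : y ≠ x) :
    (φ w + n ∈ Set.range φ ∧ φ w + n + d ∈ Set.range φ) ∨
      (φ w - n ∈ Set.range φ ∧ φ w - n + d ∈ Set.range φ) := by
  by_contra hno
  push Not at hno
  obtain ⟨a, b, χ, hS⟩ := hs.exists_strip hf.symm ⟨w, rfl⟩ ⟨x, hx⟩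
  have ha := hS.left_le
  have hb := hS.le_right
  have hb0 : b = 0 := by
    by_contra hb0
    have h1 := hS.near 1 (by omega) (by omega)
    have h2 := hS.far 1 (by omega) (by omega)
    rw [one_smul] at h1 h2
    exact hno.1 h1 h2
  have ha0 : a = 0 := by
    by_contra ha0
    have h1 := hS.near (-1) (by omega) (by omega)
    have h2 := hS.far (-1) (by omega) (by omega)
    rw [neg_one_smul, ← sub_eq_add_neg] at h1 h2
    exact hno.2 h1 h2
  subst hb0 ha0
  have hcross : ∀ p q, G.Adj p q → χ (φ p) ≠ χ (φ q) → (p = w ∧ q = x) ∨ (q = w ∧ p = x) := by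
    intro p q hpq hne
    obtain ⟨s, h1, h2, h3⟩ := hS.cross _ ⟨p, rfl⟩ _ ⟨q, rfl⟩ ((hs.1.adj_iff _ _).1 hpq) hne
    obtain rfl : s = 0 := by omega
    rw [zero_smul, add_zero, ← hx] at h3
    rcases h3 with ⟨h3, h4⟩ | ⟨h3, h4⟩
    · exact Or.inl ⟨hs.1.injective h3, hs.1.injective h4⟩
    · exact Or.inr ⟨hs.1.injective h3, hs.1.injective h4⟩
  have hwx : G.Adj w x := (hs.1.adj_iff _ _).2 (by rw [hx]; exact hf.latticeAdj _)
  have hreach : (G.induce {z | z ≠ w}).Reachable ⟨y, hwy.ne'⟩ ⟨x, hwx.ne'⟩ := by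
    by_contra hr
    exact hw ⟨y, x, hwy.ne', hwx.ne', hwy.symm.reachable.trans hwx.reachable, hr⟩
  have hyx : χ (φ x) = χ (φ y) := by
    refine SimpleGraph.Reachable.of_forall_adj
      (R := fun z : ↥{z | z ≠ w} => χ (φ z.1) = χ (φ y)) hreach ?_ rfl
    rintro ⟨p, hp⟩ ⟨q, hq⟩ hpq h
    rw [← h]
    by_contra hne
    rcases hcross p q (by simpa using hpq) (Ne.symm hne) with h1 | h1
    · exact hp h1.1
    · exact hq h1.1
  have hwy' : χ (φ w) = χ (φ y) := by
    by_contra hne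
    rcases hcross w y hwy hne with h1 | h1
    · exact hxy h1.2
    · exact hwx.ne h1.2
  have := hS.ne 0 le_rfl le_rfl
  rw [zero_smul, add_zero, ← hx] at this
  exact this (hwy'.trans hyx.symm)

/-- Every edge of the path lies in a square, since its vertices are not cut vertices and have
another neighbour. At `u`, degree two leaves only one side for the square. The degrees two and three
propagate this side along the path, as they leave no room for a neighbour on the other side. -/
theorem IsCornerPath.exists_ladder (hs : IsSolidGridEmbedding G φ) {u v : V} {P : G.Walk u v}
    (hP : IsCornerPath G φ P) : ∃ d n, IsLadder (Set.range φ) (φ u) d n P.length ∧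
      ∀ i : ℕ, i ≤ P.length → φ (P.getVert i) = φ u + (i : ℤ) • d := by
  classical
  obtain ⟨d, n₀, hf₀, hline⟩ := hs.1.exists_line_of_straight hP.isPath hP.ne hP.straight
  have hlen : 0 < P.length := by
    rw [Nat.pos_iff_ne_zero]
    exact fun h => hP.ne (SimpleGraph.Walk.eq_of_length_eq_zero h)
  have hrow : ∀ i : ℕ, i ≤ P.length → φ u + (i : ℤ) • d ∈ Set.range φ :=
    fun i hi => ⟨_, hline i hi⟩
  have hsucc : ∀ i : ℕ, φ u + ((i + 1 : ℕ) : ℤ) • d = φ u + (i : ℤ) • d + d := fun i => by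
    rw [Nat.cast_add, Nat.cast_one, add_smul, one_smul, add_assoc]
  -- every edge of the path lies in a square
  have hsq : ∀ n, IsFrame d n → ∀ i, i < P.length →
      (φ u + (i : ℤ) • d + n ∈ Set.range φ ∧ φ u + ((i + 1 : ℕ) : ℤ) • d + n ∈ Set.range φ) ∨
      (φ u + (i : ℤ) • d - n ∈ Set.range φ ∧
        φ u + ((i + 1 : ℕ) : ℤ) • d - n ∈ Set.range φ) := by
    intro n hf i hi
    have hmem := P.getVert_mem_support i
    have hx : φ (P.getVert (i + 1)) = φ (P.getVert i) + d := by
      rw [hline i hi.le, hline (i + 1) hi, hsucc]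
    have hdeg : 1 < G.degree (P.getVert i) := by
      by_cases h1 : P.getVert i = u
      · rw [h1, hP.degree_left]; norm_num
      · by_cases h2 : P.getVert i = v
        · rw [h2, hP.degree_right]; norm_num
        · rw [hP.degree_inner _ hmem h1 h2]; norm_num
    obtain ⟨y, hy, hyx⟩ := Finset.exists_mem_ne (s := G.neighborFinset (P.getVert i))
      (by rwa [G.card_neighborFinset_eq_degree]) (P.getVert (i + 1))
    have := hs.square_of_not_isCutVertex hf (hP.not_cut _ hmem) hx
      ((G.mem_neighborFinset _ _).1 hy) hyx
    rw [hline i hi.le] at this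
    rw [hsucc]
    simpa only [add_right_comm _ n d, sub_add_eq_add_sub] using this
  obtain ⟨n, hf, hn⟩ : ∃ n, IsFrame d n ∧ φ u + n ∈ Set.range φ := by
    rcases hsq n₀ hf₀ 0 hlen with h | h
    · exact ⟨n₀, hf₀, by simpa using h.1⟩
    · exact ⟨-n₀, hf₀.neg_right, by simpa [sub_eq_add_neg] using h.1⟩
  have hd1 : φ u + d ∈ Set.range φ := by simpa using hrow 1 hlen
  have hdegu := hs.1.degree_eq hf u
  rw [hP.degree_left, if_pos hd1, if_pos hn] at hdegu
  have hbefore : φ u - d ∉ Set.range φ := by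
    intro h
    rw [if_pos h] at hdegu
    omega
  have hbot0 : φ u - n ∉ Set.range φ := by
    intro h
    rw [if_neg hbefore, if_pos h] at hdegu
    omega
  have main : ∀ i : ℕ, i ≤ P.length → φ u + (i : ℤ) • d + n ∈ Set.range φ ∧
      φ u + (i : ℤ) • d - n ∉ Set.range φ ∧
      (i = P.length → φ u + ((i + 1 : ℕ) : ℤ) • d ∉ Set.range φ) := by
    intro i
    induction i with
    | zero => exact fun _ => ⟨by simpa using hn, by simpa using hbot0, fun h => absurd h hlen.ne⟩
    | succ i ih =>
      intro hi
      obtain ⟨h1, h2, -⟩ := ih (by omega)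
      have htop := ((hsq n hf i hi).resolve_right fun h => h2 h.1).2
      have hx := hline (i + 1) hi
      have hback : φ (P.getVert (i + 1)) - d ∈ Set.range φ := by
        rw [hx, hsucc, add_sub_cancel_right]; exact hrow i (by omega)
      have hdeg := hs.1.degree_eq hf (P.getVert (i + 1))
      rw [if_pos hback, if_pos (show φ (P.getVert (i + 1)) + n ∈ Set.range φ by
        rw [hx]; exact htop)] at hdeg
      by_cases hlast : i + 1 = P.length
      · have hv : P.getVert (i + 1) = v := by rw [hlast, P.getVert_length]
        rw [hv, hP.degree_right, ← hv] at hdeg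
        refine ⟨htop, fun h => ?_, fun _ h => ?_⟩
        · rw [if_pos (show φ (P.getVert (i + 1)) - n ∈ Set.range φ by rwa [hx])] at hdeg
          split_ifs at hdeg <;> omega
        · rw [if_pos (show φ (P.getVert (i + 1)) + d ∈ Set.range φ by
            rwa [hx, ← hsucc])] at hdeg
          omega
      · have hnu : P.getVert (i + 1) ≠ u := by
          intro h
          have h0 := hP.isPath.getVert_injOn (show i + 1 ∈ {i | i ≤ P.length} from hi)
            (show 0 ∈ {i | i ≤ P.length} from Nat.zero_le _) (by simpa using h)
          omega
        have hnv : P.getVert (i + 1) ≠ v := by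
          intro h
          have h0 := hP.isPath.getVert_injOn (show i + 1 ∈ {i | i ≤ P.length} from hi)
            (show P.length ∈ {i | i ≤ P.length} from le_refl P.length) (by simpa using h)
          omega
        rw [hP.degree_inner _ (P.getVert_mem_support _) hnu hnv, if_pos (show
          φ (P.getVert (i + 1)) + d ∈ Set.range φ by
            rw [hx, ← hsucc]; exact hrow _ (by omega))] at hdeg
        refine ⟨htop, fun h => ?_, fun h => absurd h hlast⟩
        rw [if_pos (show φ (P.getVert (i + 1)) - n ∈ Set.range φ by rwa [hx])] at hdeg
        omega
  refine ⟨d, n, ⟨hf, hlen, hbefore, ?_, hrow, fun i hi => (main i hi).1,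
    fun i hi => (main i hi).2.1⟩, hline⟩
  simpa using (main _ le_rfl).2.2 rfl

lemma mem_cornerVertices_iff (hs : IsSolidGridEmbedding G φ) {c : V} :
    c ∈ cornerVertices G φ ↔ IsCornerVertex G φ c := by
  refine or_congr_right ⟨?_, ?_⟩
  · rintro ⟨u, v, P, hP, h⟩
    obtain ⟨d, n, hL, hline⟩ := hP.exists_ladder hs
    rcases h with rfl | rfl
    · exact ⟨d, n, _, hL⟩
    · have h1 := hL.reverse
      rw [← hline _ le_rfl, P.getVert_length] at h1
      exact ⟨_, _, _, h1⟩
  · rintro ⟨d, n, k, hL⟩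
    obtain ⟨v, P, hP⟩ := hL.exists_cornerPath hs.1
    exact ⟨c, v, P, hP, Or.inl rfl⟩

/-- Every geodetic set meets every ladder row. -/
theorem IsGeodeticSet.exists_mem_ladder {V : Type*} [Finite V] {G : SimpleGraph V}
    {φ : V → ℤ × ℤ} (hs : IsSolidGridEmbedding G φ) {S : Set V}
    (hS : IsGeodeticSet G S) {u : V} {d n : ℤ × ℤ} {k : ℕ}
    (h : IsLadder (Set.range φ) (φ u) d n k) :
    ∃ s ∈ S, ∃ i : ℕ, i ≤ k ∧ φ s = φ u + (i : ℤ) • d := by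
  have hf := h.frame
  by_contra hno
  push Not at hno
  obtain ⟨c, hc, c', hc', hI⟩ := hS u
  obtain ⟨hr, hr', hdist⟩ := dist_eq_of_mem_geodesicInterval hI
  have hn : φ u + n ∈ Set.range φ := by simpa using h.top 0 (Nat.zero_le _)
  obtain ⟨y, hy⟩ := hn
  obtain ⟨a, b, χ, hT⟩ := hs.exists_strip hf ⟨u, rfl⟩ ⟨y, hy⟩
  have ha0 : a = 0 := by
    by_contra ha
    have := hT.left_le
    have h1 := hT.near (-1) (by omega) (by have := hT.le_right; omega)
    rw [neg_one_smul, ← sub_eq_add_neg] at h1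
    exact h.before h1
  have hbk : b ≤ k := by
    by_contra hb
    exact h.after (hT.near (k + 1) (by omega) (by omega))
  subst ha0
  -- Within its component the near side of the strip is just the row: no edge other than a rung
  -- leaves a ladder row, and a crossing back to the near side ends in the row.
  have far : ∀ c, G.Reachable u c → (∀ i : ℕ, i ≤ k → φ c ≠ φ u + (i : ℤ) • d) →
      χ (φ c) ≠ χ (φ u) := by
    intro c hr hc
    have hkb : (k : ℤ) ≤ b := by
      by_contra hkb
      obtain ⟨m, rfl⟩ := Int.eq_ofNat_of_zero_le hT.le_right
      refine hT.right_end ?_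
      exact_mod_cast And.intro (h.row (m + 1) (by omega)) (h.top (m + 1) (by omega))
    have hrowχ : ∀ i : ℕ, i ≤ k → χ (φ u + (i : ℤ) • d) = χ (φ u) := by
      intro i hi
      rw [hT.near_const hf (s := i) (t := 0) (by omega) (by omega) le_rfl hT.le_right]
      simp
    have := hr.of_forall_adj
      (R := fun z => (∃ i : ℕ, i ≤ k ∧ φ z = φ u + (i : ℤ) • d) ∨ χ (φ z) ≠ χ (φ u)) ?_
      (Or.inl ⟨0, Nat.zero_le _, by simp⟩)
    · exact this.resolve_left fun ⟨i, hi, hi'⟩ => hc i hi hi'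
    · intro x z hxz hx
      have hl : LatticeAdj (φ x) (φ z) := (hs.1.adj_iff _ _).1 hxz
      by_cases hz : χ (φ z) = χ (φ u)
      · left
        rcases hx with ⟨i, hi, hxi⟩ | hx
        · rcases hl.eq_add hf with h1 | h1 | h1 | h1
          · refine ⟨i + 1, ?_, by rw [h1, hxi]; push_cast; rw [add_smul, one_smul, add_assoc]⟩
            by_contra hik
            obtain rfl : i = k := by omega
            refine h.after ⟨z, ?_⟩
            rw [h1, hxi, add_smul, one_smul, add_assoc]
          · have hi0 : i ≠ 0 := by
              rintro rfl
              refine h.before ⟨z, ?_⟩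
              rw [h1, hxi]; simp
            refine ⟨i - 1, by omega, ?_⟩
            rw [h1, hxi, Nat.cast_sub (by omega), Nat.cast_one, sub_smul, one_smul]; abel
          · have h2 := hT.ne i (by omega) (by omega)
            rw [← hxi, ← h1, hxi, hrowχ i hi] at h2
            exact absurd hz.symm h2
          · exact absurd ⟨z, by rw [h1, hxi]⟩ (h.bottom i hi)
        · obtain ⟨s, h1, h2, h3, h4⟩ := hT.cross_near hf ⟨z, rfl⟩ ⟨x, rfl⟩ hl.symm hz hx
          obtain ⟨m, rfl⟩ := Int.eq_ofNat_of_zero_le h1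
          exact ⟨m, by omega, h3⟩
      · exact Or.inr hz
  -- Both ends of the geodesic are closer to `y`, above `u`, than to `u`. So the route through `y`
  -- is shorter than the one through `u`.
  have h1 := hT.dist_lt hs.1 hf le_rfl hT.le_right (u := u) (v := y) (by simp) (by simpa) hr
    (far c hr fun i hi => hno c hc i hi)
  have h2 := hT.dist_lt hs.1 hf le_rfl hT.le_right (u := u) (v := y) (by simp) (by simpa) hr'
    (far c' hr' fun i hi => hno c' hc' i hi)
  have huy : G.Adj u y := (hs.1.adj_iff _ _).2 (by rw [hy]; exact hf.symm.latticeAdj _)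
  obtain ⟨w₁, e₁⟩ := (huy.symm.reachable.trans hr).exists_walk_length_eq_dist
  obtain ⟨w₂, e₂⟩ := (huy.symm.reachable.trans hr').exists_walk_length_eq_dist
  have h3 := SimpleGraph.dist_le (w₁.reverse.append w₂)
  rw [SimpleGraph.Walk.length_append, SimpleGraph.Walk.length_reverse] at h3
  omega

/-- Vertices of degree at most one belong to every geodetic set. -/
lemma IsGeodeticSet.mem_of_degree_le_one {S : Set V} (hS : IsGeodeticSet G S) {x : V}
    (hx : G.degree x ≤ 1) : x ∈ S := by
  obtain ⟨c, hc, c', hc', hI⟩ := hS x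
  obtain ⟨hr, hr', hdist⟩ := dist_eq_of_mem_geodesicInterval hI
  obtain ⟨w₁, e₁⟩ := hr.exists_walk_length_eq_dist
  obtain ⟨w₂, e₂⟩ := hr'.exists_walk_length_eq_dist
  cases w₁ with
  | nil => exact hc
  | @cons _ y _ hxy w₁ =>
    cases w₂ with
    | nil => exact hc'
    | @cons _ z _ hxz w₂ =>
      -- Both parts of the geodesic use the only neighbour of `x`, so the visit to `x` can be cut
      -- out.
      obtain rfl : y = z := by
        rw [← G.card_neighborFinset_eq_degree] at hx
        exact Finset.card_le_one.1 hx y (by simpa) z (by simpa)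
      have h3 := SimpleGraph.dist_le (w₁.reverse.append w₂)
      rw [SimpleGraph.Walk.length_append, SimpleGraph.Walk.length_reverse] at h3
      rw [SimpleGraph.Walk.length_cons] at e₁ e₂
      omega

/-! ### Counting corner vertices -/

/-- `c` is charged to `s`: either `c = s` has degree at most one, or a ladder row from `c`
contains `s`. -/
def ChargedTo (G : SimpleGraph V) [DecidableRel G.Adj] (φ : V → ℤ × ℤ) (s c : V) : Prop :=
  (G.degree c ≤ 1 ∧ c = s) ∨ ∃ d n k, IsLadder (Set.range φ) (φ c) d n k ∧
    ∃ i : ℕ, i ≤ k ∧ φ s = φ c + (i : ℤ) • d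

-- A ladder row from some `c ≠ s` arrives at `s` through a neighbour of `s`, and different starts
-- use different neighbours. So at most `G.degree s` vertices other than `s` are charged to `s`. If
-- there are any, `s` lies in a ladder row and has degree two or three; in the latter case `s` is
-- not charged to itself.
open Classical in
lemma card_chargedTo_le (hφ : IsGridEmbedding G φ) (s : V) :
    (Finset.univ.filter (ChargedTo G φ s)).card ≤ 3 := by
  set A := Finset.univ.filter (ChargedTo G φ s) with hA
  have hmem : ∀ c, c ∈ A ↔ ChargedTo G φ s c := fun c => by simp [hA]
  have hcard : (A.erase s).card ≤ G.degree s := by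
    rw [← G.card_neighborFinset_eq_degree]
    refine Finset.card_le_card_of_forall_subsingleton (fun c y => ∃ d n k, ∃ i : ℕ,
      IsLadder (Set.range φ) (φ c) d n k ∧ i < k ∧ φ s = φ c + ((i + 1 : ℕ) : ℤ) • d ∧
      φ y = φ s - d) ?_ ?_
    · intro c hc
      obtain ⟨hcs, hc⟩ := Finset.mem_erase.1 hc
      rcases (hmem c).1 hc with h | ⟨d, n, k, hL, i, hi, hs⟩
      · exact absurd h.2 hcs
      · cases i with
        | zero => exact absurd (hφ.injective (by simpa using hs.symm)) hcs
        | succ i =>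
          obtain ⟨y, hy⟩ := hL.row i (by omega)
          have e : φ y = φ s - d := by
            rw [hy, hs, Nat.cast_add, Nat.cast_one, add_smul, one_smul]; abel
          refine ⟨y, ?_, d, n, k, i, hL, hi, hs, e⟩
          rw [G.mem_neighborFinset, hφ.adj_iff, e, sub_eq_add_neg]
          exact hL.frame.neg_left.latticeAdj _
    · rintro y - c₁ ⟨-, d, n, k, i, hL, hi, hs, hy⟩ c₂ ⟨-, d', n', k', i', hL', hi', hs', hy'⟩
      obtain rfl : d = d' := sub_right_injective (hy.symm.trans hy')
      -- Of two rows arriving through the same neighbour, the one starting further back would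
      -- contain the point before the start of the other, which is unoccupied.
      have no : ∀ c₁ c₂ : V, ∀ n n' k k', ∀ i i' : ℕ, IsLadder (Set.range φ) (φ c₁) d n k →
          IsLadder (Set.range φ) (φ c₂) d n' k' → i' < k' →
          φ s = φ c₁ + ((i + 1 : ℕ) : ℤ) • d →
          φ s = φ c₂ + ((i' + 1 : ℕ) : ℤ) • d → ¬ i < i' := by
        intro c₁ c₂ n n' k k' i i' hL hL' hi' hs hs' hlt
        refine hL.before ?_
        have := hL'.row (i' - i - 1) (by omega)
        rwa [show φ c₁ - d = φ c₂ + ((i' - i - 1 : ℕ) : ℤ) • d by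
          have e1 : φ c₁ = φ s - ((i + 1 : ℕ) : ℤ) • d := by rw [hs]; abel
          rw [e1, hs', Nat.cast_sub (by omega), Nat.cast_sub hlt.le]
          push_cast
          simp only [sub_smul, add_smul, one_smul]
          abel]
      have h1 := no c₁ c₂ n n' k k' i i' hL hL' hi' hs hs'
      have h2 := no c₂ c₁ n' n k' k i' i hL' hL hi hs' hs
      obtain rfl : i = i' := by omega
      exact hφ.injective (add_right_cancel (hs.symm.trans hs'))
  by_cases hempty : A.erase s = ∅
  · have := Finset.pred_card_le_card_erase (s := A) (a := s)
    rw [hempty, Finset.card_empty] at this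
    omega
  · obtain ⟨c, hc⟩ := Finset.nonempty_iff_ne_empty.2 hempty
    obtain ⟨hcs, hc⟩ := Finset.mem_erase.1 hc
    rcases (hmem c).1 hc with h | ⟨d, n, k, hL, i, hi, hs⟩
    · exact absurd h.2 hcs
    · rcases hL.degree_row hφ hi hs with h2 | h3
      · have := Finset.pred_card_le_card_erase (s := A) (a := s)
        omega
      · have hsA : s ∉ A := by
          rw [hmem]
          rintro (h | ⟨d, n, k, hL, -⟩)
          · omega
          · have := hL.degree_start hφ
            omega
        rw [Finset.erase_eq_of_notMem hsA] at hcard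
        omega

/-- There are at most three times as many isolated and corner vertices as vertices in a geodetic
set. -/
theorem IsGeodeticSet.ncard_corner_le (hs : IsSolidGridEmbedding G φ) {S : Set V}
    (hS : IsGeodeticSet G S) :
    {c | G.degree c = 0 ∨ IsCornerVertex G φ c}.ncard ≤ 3 * S.ncard := by
  classical
  have hsub : {c | G.degree c = 0 ∨ IsCornerVertex G φ c} ⊆
      ((S.toFinset.biUnion fun s => Finset.univ.filter (ChargedTo G φ s) : Finset V) : Set V) := by
    intro c hc
    rw [Finset.coe_biUnion, Set.mem_iUnion₂]
    have low : G.degree c ≤ 1 → ∃ s, ∃ _ : s ∈ (S.toFinset : Set V),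
        c ∈ ((Finset.univ.filter (ChargedTo G φ s) : Finset V) : Set V) := fun h =>
      ⟨c, by simpa using hS.mem_of_degree_le_one h, by
        rw [Finset.mem_coe, Finset.mem_filter]
        exact ⟨Finset.mem_univ _, Or.inl ⟨h, rfl⟩⟩⟩
    rcases hc with hc | hc | ⟨d, n, k, hL⟩
    · exact low (by omega)
    · exact low (by omega)
    · obtain ⟨s, hsS, i, hi, hi'⟩ := hS.exists_mem_ladder hs hL
      refine ⟨s, by simpa, ?_⟩
      rw [Finset.mem_coe, Finset.mem_filter]
      exact ⟨Finset.mem_univ _, Or.inr ⟨d, n, k, hL, i, hi, hi'⟩⟩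
  calc _ ≤ _ := Set.ncard_le_ncard hsub (Finset.finite_toSet _)
    _ = _ := Set.ncard_coe_finset _
    _ ≤ S.toFinset.card * 3 := Finset.card_biUnion_le_card_mul _ _ _ fun s _ =>
        card_chargedTo_le hs.1 s
    _ = 3 * S.ncard := by rw [Set.ncard_eq_toFinset_card', mul_comm]

lemma exists_isGeodeticSet_ncard_eq {V : Type*} [Fintype V] (G : SimpleGraph V) :
    ∃ S : Set V, IsGeodeticSet G S ∧ S.ncard = geodeticNumber G := by
  have : {k | ∃ S : Set V, IsGeodeticSet G S ∧ S.ncard = k}.Nonempty :=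
    ⟨_, Set.univ, fun x => ⟨x, trivial, x, trivial, .nil, by simp, by simp, by simp⟩, rfl⟩
  exact Nat.sInf_mem this

lemma IsSolidGridEmbedding.ncard_corner_le (hs : IsSolidGridEmbedding G φ) :
    {c | G.degree c = 0 ∨ IsCornerVertex G φ c}.ncard ≤ 3 * geodeticNumber G := by
  obtain ⟨S, hS, hcard⟩ := exists_isGeodeticSet_ncard_eq G
  rw [← hcard]
  exact hS.ncard_corner_le hs

/-- An isolated vertex lies only in its own interval, so the algorithm has to add it to the corner
vertices. -/
lemma IsSolidGridEmbedding.isGeodeticSet_corner (hs : IsSolidGridEmbedding G φ) :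
    IsGeodeticSet G {c | G.degree c = 0 ∨ IsCornerVertex G φ c} := by
  intro x
  by_cases hx : G.degree x = 0
  · exact ⟨x, Or.inl hx, x, Or.inl hx, .nil, by simp, by simp, by simp⟩
  · obtain ⟨c, c', hc, hc', h⟩ := hs.exists_corner_interval hx
    exact ⟨c, Or.inr hc, c', Or.inr hc', h⟩

end CornerPath

theorem IsSolidGridEmbedding.cornerVertices_spec {V : Type*} [Fintype V] {G : SimpleGraph V}
    [DecidableRel G.Adj] {φ : V → ℤ × ℤ} (hs : IsSolidGridEmbedding G φ) :
    ((∀ v : V, G.degree v ≠ 0) → IsGeodeticSet G (cornerVertices G φ)) ∧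
      (∀ S : Set V, IsGeodeticSet G S → ∀ (u v : V) (P : G.Walk u v), IsCornerPath G φ P →
        ∃ w ∈ P.support, w ∈ S) ∧
      (cornerVertices G φ).ncard ≤ 3 * geodeticNumber G := by
  refine ⟨fun h0 x => ?_, fun S hS u v P hP => ?_, ?_⟩
  · obtain ⟨c, c', hc, hc', h⟩ := hs.exists_corner_interval (h0 x)
    exact ⟨c, (mem_cornerVertices_iff hs).2 hc, c', (mem_cornerVertices_iff hs).2 hc', h⟩
  · obtain ⟨d, n, hL, hline⟩ := hP.exists_ladder hs
    obtain ⟨s, hsS, i, hi, hsi⟩ := hS.exists_mem_ladder hs hL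
    rw [← hline i hi] at hsi
    obtain rfl := hs.1.injective hsi
    exact ⟨_, P.getVert_mem_support i, hsS⟩
  · refine (Set.ncard_le_ncard (fun c hc => ?_) (Set.toFinite _)).trans hs.ncard_corner_le
    exact Or.inr ((mem_cornerVertices_iff hs).1 hc)

/-! ### Reasoning about programs -/

/-- The program `p`, started in `s`, halts after at most `T` steps in a memory satisfying `Q`. -/
def Runs (B : ℕ) (p : RamProgram) (s : RamState) (T : ℕ) (Q : RamState → Prop) : Prop :=
  ∃ t s', RamExec B p s t s' ∧ t ≤ T ∧ Q s'

namespace Runs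

variable {B T T' : ℕ} {p q : RamProgram} {s : RamState} {Q Q' : RamState → Prop}

lemma mono (h : Runs B p s T Q) (hT : T ≤ T') (hQ : ∀ s', Q s' → Q' s') : Runs B p s T' Q' := by
  obtain ⟨t, s', h1, h2, h3⟩ := h
  exact ⟨t, s', h1, h2.trans hT, hQ _ h3⟩

lemma skip (h : Q s) : Runs B .skip s (T + 1) Q := ⟨1, s, .skip s, by omega, h⟩

lemma instr {c : RamInstr} (hc : c.value s ≤ B) (h : Q (c.run s)) :
    Runs B (.instr c) s (T + 1) Q := ⟨1, _, .instr c s hc, by omega, h⟩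

lemma seq (h : Runs B p s T fun s' => Runs B q s' T' Q) : Runs B (.seq p q) s (T + T') Q := by
  obtain ⟨t, s', h1, h2, t', s'', h3, h4, h5⟩ := h
  exact ⟨_, _, .seq h1 h3, by omega, h5⟩

lemma instr_seq {c : RamInstr} (hc : c.value s ≤ B) (h : Runs B q (c.run s) T Q) :
    Runs B (.seq (.instr c) q) s (T + 1) Q := by
  rw [add_comm]
  exact seq ⟨1, _, .instr c s hc, le_rfl, h⟩

lemma ite {b : RamTest} (h : b.Holds s → Runs B p s T Q) (h' : ¬ b.Holds s → Runs B q s T Q) :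
    Runs B (.ite b p q) s (T + 1) Q := by
  by_cases hb : b.Holds s
  · obtain ⟨t, s', h1, h2, h3⟩ := h hb
    exact ⟨_, _, .ite_true hb h1, by omega, h3⟩
  · obtain ⟨t, s', h1, h2, h3⟩ := h' hb
    exact ⟨_, _, .ite_false hb h1, by omega, h3⟩

/-- A loop with a decreasing variant `m`. -/
lemma while_variant {b : RamTest} {Inv : ℕ → RamState → Prop}
    (h : ∀ m s, Inv m s → b.Holds s → Runs B p s T fun s' => ∃ m' < m, Inv m' s') {m : ℕ}
    (hs : Inv m s) :
    Runs B (.while b p) s ((T + 1) * m + 1) fun s' => ¬ b.Holds s' ∧ ∃ m', Inv m' s' := by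
  induction m using Nat.strong_induction_on generalizing s with
  | _ m ih =>
    by_cases hb : b.Holds s
    · obtain ⟨t, s', h1, h2, m', hm, h3⟩ := h m s hs hb
      obtain ⟨t', s'', h4, h5, h6⟩ := ih m' hm h3
      refine ⟨_, _, .while_true hb h1 h4, ?_, h6⟩
      have : (T + 1) * m' + (T + 1) ≤ (T + 1) * m := by
        rw [← Nat.mul_succ]; exact Nat.mul_le_mul_left _ hm
      omega
    · exact ⟨1, s, .while_false hb, by omega, hb, m, hs⟩

/-- A loop over an interval, with a time bound for each iteration. -/
lemma while_range {i e : ℕ} {Inv : ℕ → RamState → Prop} {cost : ℕ → ℕ} {lo hi : ℕ}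
    (h : ∀ k s, lo ≤ k → k < hi → Inv k s → s.reg i = k → s.reg e = hi →
      Runs B p s (cost k) fun s' => Inv (k + 1) s' ∧ s'.reg i = k + 1 ∧ s'.reg e = hi)
    (hs : Inv lo s) (hi' : s.reg i = lo) (he : s.reg e = hi) (hle : lo ≤ hi) :
    Runs B (.while (.lt i e) p) s (∑ k ∈ Finset.Ico lo hi, (cost k + 1) + 1) (Inv hi) := by
  induction hm : hi - lo generalizing lo s with
  | zero =>
    obtain rfl : lo = hi := by omega
    exact ⟨1, s, .while_false (by simp [RamTest.Holds, hi', he]), by omega, hs⟩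
  | succ m ih =>
    have hlt : lo < hi := by omega
    obtain ⟨t, s', h1, h2, h3, h4, h5⟩ := h lo s le_rfl hlt hs hi' he
    obtain ⟨t', s'', h6, h7, h8⟩ := ih (fun k s hk => h k s (by omega)) h3 h4 h5 hlt (by omega)
    refine ⟨_, _, .while_true (by simp [RamTest.Holds, hi', he, hlt]) h1 h6, ?_, h8⟩
    rw [Finset.sum_eq_sum_Ico_succ_bot hlt]
    omega

end Runs

/-! ### Memory updates, the stored graph, and scratch registers -/

@[simp] lemma RamState.setReg_reg (s : RamState) (x k y : ℕ) :
    (s.setReg x k).reg y = if y = x then k else s.reg y := by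
  simp [RamState.setReg, Function.update_apply]

@[simp] lemma RamState.setReg_arr (s : RamState) (x k : ℕ) : (s.setReg x k).arr = s.arr := rfl

@[simp] lemma RamState.setArr_reg (s : RamState) (a i k : ℕ) : (s.setArr a i k).reg = s.reg := rfl

lemma RamState.setArr_arr (s : RamState) (a i k b j : ℕ) :
    (s.setArr a i k).arr b j = if b = a ∧ j = i then k else s.arr b j := by
  by_cases h : b = a
  · subst h; simp [RamState.setArr, Function.update_apply]
  · simp [RamState.setArr, h]

/-- The arrays `A₀` and `A₁` store the adjacency lists of `G`. -/
structure StoresGraph {n : ℕ} (G : SimpleGraph (Fin n)) [DecidableRel G.Adj] (B : ℕ)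
    (A₀ A₁ : ℕ → ℕ) : Prop where
  step : ∀ v : Fin n, A₀ (v + 1) = A₀ v + G.degree v
  sound : ∀ (v : Fin n) (k : ℕ), A₀ v ≤ k → k < A₀ (v + 1) → ∃ w : Fin n, G.Adj v w ∧ A₁ k = w
  complete : ∀ v w : Fin n, G.Adj v w → ∃ k, A₀ v ≤ k ∧ k < A₀ (v + 1) ∧ A₁ k = w
  bound : ∀ i ≤ n, A₀ i ≤ B
  degree_le : ∀ v, G.degree v ≤ 4
  size : n + 4 ≤ B

/-- The memory holds the graph, and the constants in the registers `1`, `2` and `3`. -/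
structure Ready {n : ℕ} (G : SimpleGraph (Fin n)) [DecidableRel G.Adj] (B : ℕ) (s : RamState) :
    Prop where
  graph : StoresGraph G B (s.arr 0) (s.arr 1)
  one : s.reg 1 = 1
  two : s.reg 2 = 2
  three : s.reg 3 = 3

/-- The registers below `30` and the arrays are unchanged. -/
def SameFrame (s s' : RamState) : Prop := (∀ r < 30, s'.reg r = s.reg r) ∧ s'.arr = s.arr

lemma SameFrame.refl (s : RamState) : SameFrame s s := ⟨fun _ _ => rfl, rfl⟩

lemma SameFrame.trans {s s' s'' : RamState} (h : SameFrame s s') (h' : SameFrame s' s'') :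
    SameFrame s s'' := ⟨fun r hr => (h'.1 r hr).trans (h.1 r hr), h'.2.trans h.2⟩

lemma SameFrame.setReg {s s' : RamState} (h : SameFrame s s') {x k : ℕ} (hx : 30 ≤ x) :
    SameFrame s (s'.setReg x k) := by
  refine ⟨fun r hr => ?_, h.2⟩
  rw [RamState.setReg_reg, if_neg (by omega), h.1 r hr]

lemma Ready.of_sameFrame {n : ℕ} {G : SimpleGraph (Fin n)} [DecidableRel G.Adj] {B : ℕ}
    {s s' : RamState} (h : Ready G B s) (hs : SameFrame s s') : Ready G B s' :=
  ⟨by rw [hs.2]; exact h.graph, by rw [hs.1 1 (by norm_num), h.one],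
    by rw [hs.1 2 (by norm_num), h.two], by rw [hs.1 3 (by norm_num), h.three]⟩

/-! ### The program -/

/-- Let register `i` run through the positions of the adjacency list of the vertex in register
`x`. -/
def forNeighbors (i e x : ℕ) (p : RamProgram) : RamProgram :=
  .seq (.instr (.load i 0 x)) (.seq (.instr (.add e x 1)) (.seq (.instr (.load e 0 e))
    (.while (.lt i e) (.seq p (.instr (.add i i 1))))))

/-- There are at most four iterations, because degrees are at most four. The invariant is stated for
the memory after the increment, so the loop body only has to preserve the registers that control the
loop. -/
lemma Runs.forNeighbors {n : ℕ} {G : SimpleGraph (Fin n)} [DecidableRel G.Adj] {B T i e x : ℕ}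
    {p : RamProgram} {s : RamState} {Q : RamState → Prop} {Inv : ℕ → RamState → Prop}
    (hs : Ready G B s) (v : Fin n) (hx : s.reg x = v) (hie : i ≠ e) (hix : i ≠ x)
    (hi1 : i ≠ 1)
    (h0 : ∀ s', s'.arr = s.arr → (∀ r, r ≠ i → r ≠ e → s'.reg r = s.reg r) →
      Inv (s.arr 0 v) s')
    (hp : ∀ k s', s.arr 0 v ≤ k → k < s.arr 0 (v + 1) → Inv k s' → s'.reg i = k →
      Runs B p s' T fun s'' => s''.reg i = k ∧ s''.reg 1 = 1 ∧ s''.reg e = s'.reg e ∧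
        Inv (k + 1) (s''.setReg i (k + 1)))
    (hQ : ∀ s', Inv (s.arr 0 (v + 1)) s' → Q s') :
    Runs B (forNeighbors i e x p) s (4 * (T + 2) + 4) Q := by
  have hv1 : (v : ℕ) + 1 ≤ n := v.isLt
  have hstep := hs.graph.step v
  have hdeg := hs.graph.degree_le v
  have hsize := hs.graph.size
  refine instr_seq (T := 4 * (T + 2) + 3) ?_ (instr_seq (T := 4 * (T + 2) + 2) ?_
    (instr_seq (T := 4 * (T + 2) + 1) ?_ ?_))
  · simp only [RamInstr.value, hx]
    exact hs.graph.bound _ (by omega)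
  · simp only [RamInstr.value, RamInstr.run, RamState.setReg_reg, if_neg hix.symm,
      if_neg hi1.symm, hx, hs.one]
    omega
  · simp only [RamInstr.value, RamInstr.run, RamState.setReg_reg, if_neg hix.symm,
      if_neg hi1.symm, hx, hs.one, if_true, RamState.setReg_arr]
    exact hs.graph.bound _ hv1
  · simp only [RamInstr.value, RamInstr.run, RamState.setReg_reg, if_neg hix.symm,
      if_neg hi1.symm, hx, hs.one, if_true, RamState.setReg_arr]
    refine mono (while_range (lo := s.arr 0 v) (hi := s.arr 0 (v + 1)) (cost := fun _ => T + 1)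
      (Inv := Inv) ?_ (h0 _ rfl ?_) ?_ ?_ (by omega)) ?_ hQ
    · intro k s' h1 h2 h3 h4 h5
      refine seq (mono (hp k s' h1 h2 h3 h4) le_rfl ?_)
      rintro s'' ⟨h6, h7, h8, h9⟩
      have hb := hs.graph.bound _ hv1
      refine instr (T := 0) ?_ ?_
      · simp only [RamInstr.value, h6, h7]; omega
      · simp only [RamInstr.run, RamInstr.value, h6, h7]
        exact ⟨h9, by simp, by rw [RamState.setReg_reg, if_neg hie.symm, h8, h5]⟩
    · intro r hi he
      simp [hi, he]
    · simp [hie]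
    · simp
    · rw [Finset.sum_const, Nat.card_Ico, smul_eq_mul]
      have : (s.arr 0 (v + 1) - s.arr 0 v) * (T + 1 + 1) ≤ 4 * (T + 2) :=
        Nat.mul_le_mul (by omega) le_rfl
      omega

/-- Set register `30` to `1` and register `31` to a common neighbour of the vertices in the
registers `6` and `7` that differs from the one in register `5`, if there is one; otherwise set
register `30` to `0`. -/
def findCommon : RamProgram :=
  .seq (.instr (.const 30 0)) (forNeighbors 32 33 6
    (.seq (.instr (.load 34 1 32)) (.ite (.eq 34 5) .skip (forNeighbors 35 36 7
      (.seq (.instr (.load 37 1 35)) (.ite (.eq 37 34)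
        (.seq (.instr (.const 30 1)) (.instr (.copy 31 34))) .skip))))))

/-- Set register `39` to a neighbour of the vertex in register `6` that differs from the vertices
in the registers `5` and `31`, if there is one. -/
def findThird : RamProgram :=
  forNeighbors 32 33 6 (.seq (.instr (.load 34 1 32)) (.ite (.eq 34 5) .skip
    (.ite (.eq 34 31) .skip (.instr (.copy 39 34)))))

/-! ### Correctness of the searches among neighbours -/

section Search

variable {n : ℕ} {G : SimpleGraph (Fin n)} [DecidableRel G.Adj] {B : ℕ} {s : RamState}

/-- Register `30` is set and register `31` holds a common neighbour of `x` and `z` different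
from `w`. -/
def CommonFound (G : SimpleGraph (Fin n)) (w x z : Fin n) (s : RamState) : Prop :=
  s.reg 30 = 1 ∧ ∃ y : Fin n, s.reg 31 = y ∧ G.Adj x y ∧ G.Adj z y ∧ y ≠ w

/-- Outer invariant: either a common neighbour has been stored, or no entry of the list of `x` read
so far is one, apart from `w`. Inner invariant, for the current entry `u`: nothing has been stored
and `u` is not among the entries of `z` read so far, or a common neighbour has been stored. -/
lemma runs_findCommon (hs : Ready G B s) {w x z : Fin n} (hw : s.reg 5 = w) (hx : s.reg 6 = x)
    (hz : s.reg 7 = z) : Runs B findCommon s 200 fun s' => SameFrame s s' ∧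
      ((s'.reg 30 = 0 ∧ ∀ y, G.Adj x y → G.Adj z y → y = w) ∨ CommonFound G w x z s') := by
  have hsize := hs.graph.size
  refine Runs.instr_seq (T := 199) (by simp [RamInstr.value]) ?_
  have hs1 : SameFrame s (RamInstr.run (.const 30 0) s) := (SameFrame.refl s).setReg le_rfl
  set s₁ := RamInstr.run (.const 30 0) s with hs₁
  have hr1 := hs.of_sameFrame hs1
  have harr : s₁.arr = s.arr := rfl
  refine Runs.mono (Runs.forNeighbors (T := 42) (n := n) (G := G) (Q := fun s' => SameFrame s s' ∧
      ((s'.reg 30 = 0 ∧ ∀ y, G.Adj x y → G.Adj z y → y = w) ∨ CommonFound G w x z s'))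
    (Inv := fun k s' => SameFrame s s' ∧ ((s'.reg 30 = 0 ∧ ∀ m, s.arr 0 x ≤ m → m < k →
      ∀ y : Fin n, s.arr 1 m = y → G.Adj z y → y = w) ∨ CommonFound G w x z s'))
    hr1 x (by rw [hs1.1 6 (by norm_num), hx]) (by norm_num) (by norm_num) (by norm_num)
    ?_ ?_ ?_) (by norm_num) fun _ h => h
  · intro s' ha hr
    refine ⟨⟨fun r hr' => ?_, ha⟩, Or.inl ⟨?_, fun m h1 h2 => ?_⟩⟩
    · rw [hr r (by omega) (by omega), hs1.1 r hr']
    · rw [hr 30 (by norm_num) (by norm_num)]; simp [hs₁, RamInstr.run, RamInstr.value]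
    · rw [harr] at h2; omega
  · intro k s' h1 h2 ⟨hf, hinv⟩ hk
    rw [harr] at h1 h2
    obtain ⟨u, hxu, hu⟩ := hs.graph.sound x k h1 h2
    have hval : RamInstr.value (.load 34 1 32) s' = u := by
      simp [RamInstr.value, hf.2, hk, hu]
    refine Runs.instr_seq (T := 41) (by rw [hval]; omega) ?_
    have hs2 : SameFrame s (RamInstr.run (.load 34 1 32) s') := by
      simp only [RamInstr.run]; exact hf.setReg (by norm_num)
    have g : ∀ r, r ≠ 34 → (RamInstr.run (.load 34 1 32) s').reg r = s'.reg r := by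
      intro r hr; simp [RamInstr.run, hr]
    have g34 : (RamInstr.run (.load 34 1 32) s').reg 34 = u := by
      simp only [RamInstr.run, hval, RamState.setReg_reg, if_true]
    set s₂ := RamInstr.run (.load 34 1 32) s' with hs₂
    have hr2 := hs.of_sameFrame hs2
    have hinv₂ : (s₂.reg 30 = 0 ∧ ∀ m, s.arr 0 x ≤ m → m < k →
        ∀ y : Fin n, s.arr 1 m = y → G.Adj z y → y = w) ∨ CommonFound G w x z s₂ := by
      unfold CommonFound
      rw [g 30 (by norm_num), g 31 (by norm_num)]
      exact hinv
    have lift : ∀ s₃ : RamState, SameFrame s s₃ → s₃.reg 32 = k → s₃.reg 33 = s'.reg 33 →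
        ((s₃.reg 30 = 0 ∧ ∀ m, s.arr 0 x ≤ m → m < k + 1 →
          ∀ y : Fin n, s.arr 1 m = y → G.Adj z y → y = w) ∨ CommonFound G w x z s₃) →
        s₃.reg 32 = k ∧ s₃.reg 1 = 1 ∧ s₃.reg 33 = s'.reg 33 ∧
          SameFrame s (s₃.setReg 32 (k + 1)) ∧ (((s₃.setReg 32 (k + 1)).reg 30 = 0 ∧
            ∀ m, s.arr 0 x ≤ m → m < k + 1 →
              ∀ y : Fin n, s.arr 1 m = y → G.Adj z y → y = w) ∨
            CommonFound G w x z (s₃.setReg 32 (k + 1))) := by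
      intro s₃ h3 h4 h5 h6
      refine ⟨h4, (hs.of_sameFrame h3).one, h5, h3.setReg (by norm_num), ?_⟩
      simpa [CommonFound] using h6
    refine Runs.ite (T := 40) (fun hb => ?_) fun hb => ?_
    · refine Runs.skip (T := 39) (lift s₂ hs2 ?_ (g 33 (by norm_num)) ?_)
      · rw [g 32 (by norm_num), hk]
      · refine hinv₂.imp_left fun ⟨h3, h4⟩ => ⟨h3, fun m h5 h6 y h7 h8 => ?_⟩
        rcases (Nat.lt_succ_iff_lt_or_eq.1 h6) with h9 | rfl
        · exact h4 m h5 h9 y h7 h8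
        · have h10 : s₂.reg 34 = s₂.reg 5 := hb
          rw [g34, hs2.1 5 (by norm_num), hw] at h10
          rw [hu] at h7
          exact Fin.ext (h7.symm.trans h10)
    · have huw : u ≠ w := by
        rintro rfl
        exact hb (show s₂.reg 34 = s₂.reg 5 by rw [g34, hs2.1 5 (by norm_num), hw])
      refine Runs.mono (Runs.forNeighbors (T := 4) (n := n) (G := G)
        (Q := fun s'' => s''.reg 32 = k ∧ s''.reg 1 = 1 ∧ s''.reg 33 = s'.reg 33 ∧
          SameFrame s (s''.setReg 32 (k + 1)) ∧ (((s''.setReg 32 (k + 1)).reg 30 = 0 ∧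
            ∀ m, s.arr 0 x ≤ m → m < k + 1 →
              ∀ y : Fin n, s.arr 1 m = y → G.Adj z y → y = w) ∨
            CommonFound G w x z (s''.setReg 32 (k + 1))))
        (Inv := fun j s₃ => SameFrame s s₃ ∧ s₃.reg 32 = k ∧ s₃.reg 33 = s'.reg 33 ∧
          s₃.reg 34 = u ∧ ((s₃.reg 30 = 0 ∧ (∀ m, s.arr 0 x ≤ m → m < k →
            ∀ y : Fin n, s.arr 1 m = y → G.Adj z y → y = w) ∧
            ∀ m, s.arr 0 z ≤ m → m < j → s.arr 1 m ≠ u) ∨ CommonFound G w x z s₃))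
        hr2 z (by rw [hs2.1 7 (by norm_num), hz]) (by norm_num) (by norm_num) (by norm_num)
        ?_ ?_ ?_) (by norm_num) fun _ h => h
      · intro s₃ ha hr
        refine ⟨⟨fun r hr' => ?_, ha.trans hs2.2⟩, ?_, ?_, ?_, ?_⟩
        · rw [hr r (by omega) (by omega), hs2.1 r hr']
        · rw [hr 32 (by norm_num) (by norm_num), g 32 (by norm_num), hk]
        · rw [hr 33 (by norm_num) (by norm_num), g 33 (by norm_num)]
        · rw [hr 34 (by norm_num) (by norm_num), g34]
        · unfold CommonFound at hinv₂ ⊢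
          rw [hr 30 (by norm_num) (by norm_num), hr 31 (by norm_num) (by norm_num)]
          refine hinv₂.imp_left fun ⟨h3, h4⟩ => ⟨h3, h4, fun m h5 h6 => ?_⟩
          rw [hs2.2] at h6
          omega
      · rintro j s₃ h3 h4 ⟨hf3, e32, e33, e34, hinv3⟩ hj
        rw [hs2.2] at h3 h4
        obtain ⟨t, hzt, ht⟩ := hs.graph.sound z j h3 h4
        have hval3 : RamInstr.value (.load 37 1 35) s₃ = t := by
          simp [RamInstr.value, hf3.2, hj, ht]
        refine Runs.instr_seq (T := 3) (by rw [hval3]; omega) ?_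
        simp only [RamInstr.run, hval3]
        have hone := (hs.of_sameFrame hf3).one
        refine Runs.ite (T := 2) (fun hb => ?_) fun hb => ?_
        · simp only [RamTest.Holds, RamState.setReg_reg] at hb
          norm_num at hb
          rw [e34] at hb
          obtain rfl : t = u := Fin.ext hb
          refine Runs.instr_seq (T := 1) (by simp [RamInstr.value]; omega) ?_
          refine Runs.instr (T := 0) ?_ ?_
          · simp [RamInstr.value, RamInstr.run, e34]; omega
          · simp only [RamInstr.run, RamInstr.value]
            refine ⟨by simp [hj], by simp [hone], by simp, ?_, by simp [e32], by simp [e33],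
              by simp [e34], Or.inr ⟨by simp, t, by simp [e34], hxu, hzt, huw⟩⟩
            exact (((hf3.setReg (by norm_num)).setReg (by norm_num)).setReg (by norm_num)).setReg
              (by norm_num)
        · simp only [RamTest.Holds, RamState.setReg_reg] at hb
          norm_num at hb
          rw [e34] at hb
          refine Runs.skip (T := 1) ?_
          refine ⟨by simp [hj], by simp [hone], by simp, ?_, by simp [e32], by simp [e33],
              by simp [e34], ?_⟩
          · exact (hf3.setReg (by norm_num)).setReg (by norm_num)
          · unfold CommonFound at hinv3 ⊢
            simp only [RamState.setReg_reg]
            norm_num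
            refine hinv3.imp_left fun ⟨h5, h6, h7⟩ => ⟨h5, h6, fun m h8 h9 => ?_⟩
            rcases (show m < j ∨ m = j by omega) with h10 | rfl
            · exact h7 m h8 h10
            · rw [ht]; exact hb
      · rintro s₃ ⟨hf3, e32, e33, e34, hinv3⟩
        rw [hs2.2] at hinv3
        refine lift s₃ hf3 e32 e33 (hinv3.imp_left fun ⟨h5, h6, h7⟩ => ⟨h5, ?_⟩)
        intro m h8 h9 y h10 h11
        rcases (Nat.lt_succ_iff_lt_or_eq.1 h9) with h12 | rfl
        · exact h6 m h8 h12 y h10 h11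
        · obtain ⟨m', h13, h14, h15⟩ := hs.graph.complete z y h11
          exact absurd (h15.trans (h10.symm.trans hu)) (h7 m' h13 h14)
  · rintro s' ⟨hf, hinv⟩
    refine ⟨hf, hinv.imp_left fun ⟨h1, h2⟩ => ⟨h1, fun y h3 h4 => ?_⟩⟩
    obtain ⟨m, h5, h6, h7⟩ := hs.graph.complete x y h3
    exact h2 m h5 h6 y h7 h4

lemma runs_findThird (hs : Ready G B s) {w x y : Fin n} (hw : s.reg 5 = w) (hx : s.reg 6 = x)
    (hy : s.reg 31 = y) (hex : ∃ u, G.Adj x u ∧ u ≠ w ∧ u ≠ y) :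
    Runs B findThird s 40 fun s' => SameFrame s s' ∧ s'.reg 31 = y ∧
      ∃ u : Fin n, s'.reg 39 = u ∧ G.Adj x u ∧ u ≠ w ∧ u ≠ y := by
  have hsize := hs.graph.size
  refine Runs.mono (Runs.forNeighbors (T := 4) (n := n) (G := G)
    (Q := fun s' => SameFrame s s' ∧ s'.reg 31 = y ∧
      ∃ u : Fin n, s'.reg 39 = u ∧ G.Adj x u ∧ u ≠ w ∧ u ≠ y)
    (Inv := fun k s' => SameFrame s s' ∧ s'.reg 31 = y ∧ ((∀ m, s.arr 0 x ≤ m → m < k →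
      ∀ u : Fin n, s.arr 1 m = u → u = w ∨ u = y) ∨
      ∃ u : Fin n, s'.reg 39 = u ∧ G.Adj x u ∧ u ≠ w ∧ u ≠ y))
    hs x hx (by norm_num) (by norm_num) (by norm_num) ?_ ?_ ?_) (by norm_num) fun _ h => h
  · intro s' ha hr
    refine ⟨⟨fun r hr' => ?_, ha⟩, ?_, Or.inl fun m h1 h2 => ?_⟩
    · rw [hr r (by omega) (by omega)]
    · rw [hr 31 (by norm_num) (by norm_num), hy]
    · omega
  · rintro k s' h1 h2 ⟨hf, h31, hinv⟩ hk
    obtain ⟨u, hxu, hu⟩ := hs.graph.sound x k h1 h2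
    have hval : RamInstr.value (.load 34 1 32) s' = u := by
      simp [RamInstr.value, hf.2, hk, hu]
    have hone := (hs.of_sameFrame hf).one
    have h5 : s'.reg 5 = w := by rw [hf.1 5 (by norm_num), hw]
    refine Runs.instr_seq (T := 3) (by rw [hval]; omega) ?_
    simp only [RamInstr.run, hval]
    have skipped : (u = w ∨ u = y) → ((s'.setReg 34 u).reg 32 = k ∧ (s'.setReg 34 u).reg 1 = 1 ∧
        (s'.setReg 34 u).reg 33 = s'.reg 33 ∧
        SameFrame s ((s'.setReg 34 u).setReg 32 (k + 1)) ∧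
        ((s'.setReg 34 u).setReg 32 (k + 1)).reg 31 = y ∧
        ((∀ m, s.arr 0 x ≤ m → m < k + 1 → ∀ u : Fin n, s.arr 1 m = u → u = w ∨ u = y) ∨
        ∃ v : Fin n, ((s'.setReg 34 u).setReg 32 (k + 1)).reg 39 = v ∧ G.Adj x v ∧ v ≠ w ∧
          v ≠ y)) := by
      intro huw
      refine ⟨by simp [hk], by simp [hone], by simp,
        (hf.setReg (by norm_num)).setReg (by norm_num), by simp [h31], ?_⟩
      rcases hinv with hinv | hinv
      · left
        intro m h3 h4 u' h6
        rcases (Nat.lt_succ_iff_lt_or_eq.1 h4) with h7 | rfl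
        · exact hinv m h3 h7 u' h6
        · obtain rfl : u = u' := Fin.ext (hu.symm.trans h6)
          exact huw
      · right
        simpa using hinv
    refine Runs.ite (T := 2) (fun hb => ?_) fun hb => ?_
    · refine Runs.skip (T := 1) (skipped ?_)
      simp only [RamTest.Holds, RamState.setReg_reg] at hb
      norm_num at hb
      rw [h5] at hb
      exact Or.inl (Fin.ext hb)
    · simp only [RamTest.Holds, RamState.setReg_reg] at hb
      norm_num at hb
      rw [h5] at hb
      refine Runs.ite (T := 1) (fun hb' => ?_) fun hb' => ?_
      · refine Runs.skip (T := 0) (skipped ?_)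
        simp only [RamTest.Holds, RamState.setReg_reg] at hb'
        norm_num at hb'
        rw [h31] at hb'
        exact Or.inr (Fin.ext hb')
      · simp only [RamTest.Holds, RamState.setReg_reg] at hb'
        norm_num at hb'
        rw [h31] at hb'
        refine Runs.instr (T := 0) (by simp [RamInstr.value]; omega) ?_
        simp only [RamInstr.value, RamInstr.run]
        refine ⟨by simp [hk], by simp [hone], by simp, ?_, by simp [h31],
          Or.inr ⟨u, by simp, hxu, fun h => hb (by rw [h]), fun h => hb' (by rw [h])⟩⟩
        exact ((hf.setReg (by norm_num)).setReg (by norm_num)).setReg (by norm_num)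
  · rintro s' ⟨hf, h31, hinv⟩
    refine ⟨hf, h31, hinv.resolve_left fun h => ?_⟩
    obtain ⟨u, h1, h2, h3⟩ := hex
    obtain ⟨m, h5, h6, h7⟩ := hs.graph.complete x u h1
    rcases h m h5 h6 u h7 with h8 | h8
    · exact h2 h8
    · exact h3 h8

end Search

/-! ### Following a ladder -/

section Follow

variable {V : Type*} [Fintype V] {G : SimpleGraph V} [DecidableRel G.Adj] {φ : V → ℤ × ℤ}

lemma exists_third_neighbor {x : V} (h3 : G.degree x = 3) (w y : V) :
    ∃ u, G.Adj x u ∧ u ≠ w ∧ u ≠ y := by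
  classical
  by_contra hno
  push Not at hno
  have hsub : G.neighborFinset x ⊆ {w, y} := by
    intro u hu
    rw [G.mem_neighborFinset] at hu
    rw [Finset.mem_insert, Finset.mem_singleton, or_iff_not_imp_left]
    exact hno u hu
  have h4 := Finset.card_le_card hsub
  rw [G.card_neighborFinset_eq_degree, h3] at h4
  have := Finset.card_le_two (a := w) (b := y)
  omega

/-- Opposite corners of a unit square have only the two other corners as common lattice neighbours.
This lets the program find squares without coordinates. -/
lemma IsGridEmbedding.eq_of_common_neighbor {V : Type*} {G : SimpleGraph V} {φ : V → ℤ × ℤ}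
    (hφ : IsGridEmbedding G φ) {d n : ℤ × ℤ} (hf : IsFrame d n) {w x y z : V}
    (hx : φ x = φ w + d) (hz : φ z = φ w + n) (hxy : G.Adj x y) (hzy : G.Adj z y) (hyw : y ≠ w) :
    φ y = φ w + d + n := by
  have h1 : LatticeAdj (φ x) (φ y) := (hφ.adj_iff _ _).1 hxy
  have h2 : LatticeAdj (φ z) (φ y) := (hφ.adj_iff _ _).1 hzy
  have h3 : φ y ≠ φ w := fun h => hyw (hφ.injective h)
  rw [hx] at h1
  rw [hz] at h2
  generalize φ y = b at *
  generalize φ w = a at *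
  obtain ⟨a₁, a₂⟩ := a
  obtain ⟨b₁, b₂⟩ := b
  rcases hf with ⟨rfl | rfl, rfl | rfl⟩ | ⟨rfl | rfl, rfl | rfl⟩ <;>
    rcases h1.cases with h | h | h | h <;> rcases h2.cases with h' | h' | h' | h' <;>
      simp only [Prod.mk_add_mk, Prod.mk.injEq, ne_eq] at h h' h3 ⊢ <;> omega

/-- Two points on opposite sides of `w` have only `w` as a common neighbour, so a search that has
turned off the row fails at its next step. -/
lemma IsGridEmbedding.eq_of_common_neighbor_opposite {V : Type*} {G : SimpleGraph V}
    {φ : V → ℤ × ℤ} (hφ : IsGridEmbedding G φ) {d n : ℤ × ℤ} (hf : IsFrame d n) {w x y z : V}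
    (hx : φ x = φ w + d) (hz : φ z = φ w - d) (hxy : G.Adj x y) (hzy : G.Adj z y) : y = w := by
  have h1 : LatticeAdj (φ x) (φ y) := (hφ.adj_iff _ _).1 hxy
  have h2 : LatticeAdj (φ z) (φ y) := (hφ.adj_iff _ _).1 hzy
  refine hφ.injective ?_
  rw [hx] at h1
  rw [hz] at h2
  generalize φ y = b at *
  generalize φ w = a at *
  obtain ⟨a₁, a₂⟩ := a
  obtain ⟨b₁, b₂⟩ := b
  rcases hf with ⟨rfl | rfl, -⟩ | ⟨rfl | rfl, -⟩ <;>
    rcases h1.cases with h | h | h | h <;> rcases h2.cases with h' | h' | h' | h' <;>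
      simp only [Prod.mk_add_mk, Prod.mk_sub_mk, Prod.mk.injEq] at h h' ⊢ <;> omega

/-- The vertices `w`, `x`, `z` are the positions `i` and `i + 1` of a row from `v` in direction `d`
and position `i` of the parallel row, and so far these rows look like a ladder. -/
structure FollowsLadder (G : SimpleGraph V) [DecidableRel G.Adj] (φ : V → ℤ × ℤ) (v : V)
    (d n : ℤ × ℤ) (i : ℕ) (w x z : V) : Prop where
  frame : IsFrame d n
  before : φ v - d ∉ Set.range φ
  row : ∀ j : ℕ, j ≤ i → φ v + (j : ℤ) • d ∈ Set.range φ
  top : ∀ j : ℕ, j ≤ i → φ v + (j : ℤ) • d + n ∈ Set.range φ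
  bottom : ∀ j : ℕ, j ≤ i → φ v + (j : ℤ) • d - n ∉ Set.range φ
  degree : ∀ j : ℕ, 1 ≤ j → j ≤ i → ∀ u, φ u = φ v + (j : ℤ) • d → G.degree u = 3
  pos_left : φ w = φ v + (i : ℤ) • d
  pos_right : φ x = φ w + d
  pos_top : φ z = φ w + n

/-- The search has left the row, and there is no ladder. -/
structure LeftLadder (φ : V → ℤ × ℤ) (v : V) (d n : ℤ × ℤ) (w x z : V) : Prop where
  opposite : ∃ e e', IsFrame e e' ∧ φ x = φ w + e ∧ φ z = φ w - e
  not_ladder : ¬ ∃ k, IsLadder (Set.range φ) (φ v) d n k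

open Classical in
/-- The vertices on the ray from `v` in direction `d`, up to the first one of degree other than
three. -/
noncomputable def rayVertices (G : SimpleGraph V) [DecidableRel G.Adj] (φ : V → ℤ × ℤ) (v : V)
    (d : ℤ × ℤ) : Finset V :=
  Finset.univ.filter fun u => ∃ i : ℕ, 1 ≤ i ∧ φ u = φ v + (i : ℤ) • d ∧
    ∀ j : ℕ, 1 ≤ j → j < i → ∀ u', φ u' = φ v + (j : ℤ) • d → G.degree u' = 3

open Classical in
lemma mem_rayVertices {v u : V} {d : ℤ × ℤ} : u ∈ rayVertices G φ v d ↔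
    ∃ i : ℕ, 1 ≤ i ∧ φ u = φ v + (i : ℤ) • d ∧
      ∀ j : ℕ, 1 ≤ j → j < i → ∀ u', φ u' = φ v + (j : ℤ) • d → G.degree u' = 3 := by
  exact Finset.mem_filter.trans (and_iff_right (Finset.mem_univ _))

variable {v w x z : V} {d n : ℤ × ℤ} {i : ℕ}

namespace FollowsLadder

lemma pos_right' (h : FollowsLadder G φ v d n i w x z) :
    φ x = φ v + ((i + 1 : ℕ) : ℤ) • d := by
  rw [h.pos_right, h.pos_left, Nat.cast_add, Nat.cast_one, add_smul, one_smul, add_assoc]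

/-- Position `i + 1` is occupied, so a ladder with this frame cannot end before it. -/
lemma lt_of_ladder (h : FollowsLadder G φ v d n i w x z) {k : ℕ}
    (hL : IsLadder (Set.range φ) (φ v) d n k) : i + 1 ≤ k := by
  by_contra hk
  refine hL.after ?_
  have e : (k + 1 : ℤ) = ((k + 1 : ℕ) : ℤ) := by push_cast; ring
  rw [e]
  rcases (show k + 1 ≤ i ∨ k = i by omega) with h1 | rfl
  · exact h.row _ h1
  · exact ⟨x, h.pos_right'⟩

lemma not_ladder_of_common (h : FollowsLadder G φ v d n i w x z) (hφ : IsGridEmbedding G φ)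
    (hno : ∀ y, G.Adj x y → G.Adj z y → y = w) :
    ¬ ∃ k, IsLadder (Set.range φ) (φ v) d n k := by
  rintro ⟨k, hL⟩
  obtain ⟨y, hy⟩ := hL.top (i + 1) (h.lt_of_ladder hL)
  rw [← h.pos_right'] at hy
  have h1 : y = w := by
    refine hno y ((hφ.adj_iff _ _).2 ?_) ((hφ.adj_iff _ _).2 ?_)
    · rw [hy]; exact h.frame.symm.latticeAdj _
    · rw [hy, h.pos_right, h.pos_top, add_right_comm]; exact h.frame.latticeAdj _
  rw [h1, h.pos_right, add_assoc] at hy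
  have h2 : d + n = 0 := by simpa using hy.symm
  exact h.frame.ne.2.1 (eq_neg_of_add_eq_zero_left h2)

lemma not_ladder_of_degree (h : FollowsLadder G φ v d n i w x z) (hφ : IsGridEmbedding G φ)
    (h2 : G.degree x ≠ 2) (h3 : G.degree x ≠ 3) :
    ¬ ∃ k, IsLadder (Set.range φ) (φ v) d n k := by
  rintro ⟨k, hL⟩
  rcases hL.degree_row hφ (h.lt_of_ladder hL) h.pos_right' with h1 | h1
  · exact h2 h1
  · exact h3 h1

lemma back_mem (h : FollowsLadder G φ v d n i w x z) : φ x - d ∈ Set.range φ :=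
  ⟨w, by rw [h.pos_right, add_sub_cancel_right]⟩

/-- With `w` behind and `y` above, degree two leaves nothing ahead of `x` or below it. -/
lemma ladder_of_degree (h : FollowsLadder G φ v d n i w x z) (hφ : IsGridEmbedding G φ) {y : V}
    (hxy : G.Adj x y) (hzy : G.Adj z y) (hyw : y ≠ w) (h2 : G.degree x = 2) :
    IsLadder (Set.range φ) (φ v) d n (i + 1) := by
  have hy := hφ.eq_of_common_neighbor h.frame h.pos_right h.pos_top hxy hzy hyw
  rw [← h.pos_right] at hy
  have hdeg := hφ.degree_eq h.frame x
  rw [h2, if_pos h.back_mem, if_pos (show φ x + n ∈ Set.range φ from ⟨y, hy⟩)] at hdeg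
  have h4 : φ x - n ∉ Set.range φ := by
    intro h4
    rw [if_pos h4] at hdeg
    split_ifs at hdeg <;> omega
  have h5 : φ x + d ∉ Set.range φ := by
    intro h5
    rw [if_pos h5] at hdeg
    omega
  have ext : ∀ {P : ℕ → Prop}, (∀ j, j ≤ i → P j) → P (i + 1) → ∀ j, j ≤ i + 1 → P j := by
    intro P h6 h7 j hj
    rcases hj.eq_or_lt with rfl | hj
    · exact h7
    · exact h6 j (by omega)
  refine ⟨h.frame, by omega, h.before, ?_, ext h.row ⟨x, h.pos_right'⟩, ext h.top ⟨y, ?_⟩,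
    ext h.bottom ?_⟩
  · rwa [add_smul, one_smul, ← add_assoc, ← h.pos_right']
  · rw [hy, h.pos_right']
  · rwa [← h.pos_right']

/-- The third neighbour of `x` is ahead or below. If it is ahead, degree three excludes one below,
and the row continues. If it is below, no ladder with this frame starts at `v`. -/
lemma step (h : FollowsLadder G φ v d n i w x z) (hφ : IsGridEmbedding G φ) {y u : V}
    (hxy : G.Adj x y) (hzy : G.Adj z y) (hyw : y ≠ w) (h3 : G.degree x = 3) (hxu : G.Adj x u)
    (huw : u ≠ w) (huy : u ≠ y) :
    FollowsLadder G φ v d n (i + 1) x u y ∨ LeftLadder φ v d n x u y := by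
  have hy := hφ.eq_of_common_neighbor h.frame h.pos_right h.pos_top hxy hzy hyw
  rw [← h.pos_right] at hy
  have hl : LatticeAdj (φ x) (φ u) := (hφ.adj_iff _ _).1 hxu
  rcases hl.eq_add h.frame with h1 | h1 | h1 | h1
  · left
    have hdeg := hφ.degree_eq h.frame x
    rw [h3, if_pos h.back_mem, if_pos (show φ x + n ∈ Set.range φ from ⟨y, hy⟩),
      if_pos (show φ x + d ∈ Set.range φ from ⟨u, h1⟩)] at hdeg
    have h4 : φ x - n ∉ Set.range φ := by
      intro h4
      rw [if_pos h4] at hdeg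
      omega
    have ext : ∀ {P : ℕ → Prop}, (∀ j, j ≤ i → P j) → P (i + 1) → ∀ j, j ≤ i + 1 → P j := by
      intro P h6 h7 j hj
      rcases hj.eq_or_lt with rfl | hj
      · exact h7
      · exact h6 j (by omega)
    refine ⟨h.frame, h.before, ext h.row ⟨x, h.pos_right'⟩, ext h.top ⟨y, ?_⟩,
      ext h.bottom ?_, fun j hj1 hj u' hu' => ?_, h.pos_right', h1, hy⟩
    · rw [hy, h.pos_right']
    · rwa [← h.pos_right']
    · rcases hj.eq_or_lt with rfl | hj
      · rw [← h.pos_right'] at hu'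
        rw [hφ.injective hu', h3]
      · exact h.degree j hj1 (by omega) u' hu'
  · rw [h.pos_right, add_sub_cancel_right] at h1
    exact absurd (hφ.injective h1) huw
  · exact absurd (hφ.injective (h1.trans hy.symm)) huy
  · right
    refine ⟨⟨-n, d, h.frame.neg_right.symm, by rw [h1, sub_eq_add_neg],
      by rw [hy, sub_neg_eq_add]⟩, ?_⟩
    rintro ⟨k, hL⟩
    refine hL.bottom (i + 1) (h.lt_of_ladder hL) ⟨u, ?_⟩
    rw [h1, h.pos_right']

/-- The positions `1` to `i + 1` of the row belong to the ray, because those before the last have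
degree three. This charges the steps of the search to the ray. -/
lemma succ_le_card_ray (h : FollowsLadder G φ v d n i w x z) :
    i + 1 ≤ (rayVertices G φ v d).card := by
  have hmem : ∀ j : Fin (i + 1), ∃ u, u ∈ rayVertices G φ v d ∧
      φ u = φ v + ((j + 1 : ℕ) : ℤ) • d := by
    intro j
    have hj : ((j : ℕ) + 1 ≤ i) ∨ (j : ℕ) = i := by omega
    obtain ⟨u, hu⟩ : φ v + (((j : ℕ) + 1 : ℕ) : ℤ) • d ∈ Set.range φ := by
      rcases hj with hj | hj
      · exact h.row _ hj
      · exact ⟨x, by rw [h.pos_right', hj]⟩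
    refine ⟨u, ?_, hu⟩
    exact mem_rayVertices.2 ⟨j + 1, by omega, hu, fun j' h1 h2 u' hu' =>
      h.degree j' h1 (by omega) u' hu'⟩
  choose f hf hf' using hmem
  have hinj : Function.Injective f := by
    intro j j' hjj
    have h1 := (hf' j).symm.trans ((congrArg φ hjj).trans (hf' j'))
    have h2 := h.frame.smul_inj (add_left_cancel h1)
    exact Fin.ext (by omega)
  have := Finset.card_le_card_of_injOn (s := Finset.univ) f (fun j _ => hf j) hinj.injOn
  simpa using this

end FollowsLadder

/-- If the two neighbours of `v` are perpendicular, degree two leaves the other two sides empty. If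
they are opposite, they do not form a frame. -/
lemma start_followsLadder (hφ : IsGridEmbedding G φ) {p q : V} (hv : G.degree v = 2)
    (hp : G.Adj v p) (hq : G.Adj v q) (hpq : p ≠ q) :
    FollowsLadder G φ v (φ p - φ v) (φ q - φ v) 0 v p q ∨
      LeftLadder φ v (φ p - φ v) (φ q - φ v) v p q := by
  have h1 : LatticeAdj (φ v) (φ p) := (hφ.adj_iff _ _).1 hp
  have h2 : LatticeAdj (φ v) (φ q) := (hφ.adj_iff _ _).1 hq
  obtain ⟨d', d, hf', hd⟩ := h1.exists_frame
  have key : ∀ n, IsFrame d n → φ q = φ v + n →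
      FollowsLadder G φ v (φ p - φ v) (φ q - φ v) 0 v p q := by
    intro n hf hn
    rw [hd, hn, add_sub_cancel_left, add_sub_cancel_left]
    have hdeg := hφ.degree_eq hf v
    rw [hv, if_pos (show φ v + d ∈ Set.range φ from ⟨p, hd⟩),
      if_pos (show φ v + n ∈ Set.range φ from ⟨q, hn⟩)] at hdeg
    have h3 : φ v - d ∉ Set.range φ := by
      intro h3
      rw [if_pos h3] at hdeg
      omega
    have h4 : φ v - n ∉ Set.range φ := by
      intro h4
      rw [if_neg h3, if_pos h4] at hdeg
      omega
    refine ⟨hf, h3, ?_, ?_, ?_, fun j hj1 hj => by omega, by simp, hd, hn⟩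
    · intro j hj
      obtain rfl : j = 0 := by omega
      exact ⟨v, by simp⟩
    · intro j hj
      obtain rfl : j = 0 := by omega
      exact ⟨q, by simpa using hn⟩
    · intro j hj
      obtain rfl : j = 0 := by omega
      rw [Nat.cast_zero, zero_smul, add_zero]
      exact h4
  rcases h2.eq_add hf'.symm with h | h | h | h
  · exact absurd (hφ.injective (hd.trans h.symm)) hpq
  · right
    refine ⟨⟨d, d', hf'.symm, hd, h⟩, ?_⟩
    rintro ⟨k, hL⟩
    have := hL.frame
    rw [hd, h, add_sub_cancel_left, sub_sub_cancel_left] at this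
    exact this.neg_right.ne.1 (by simp)
  · exact Or.inl (key d' hf'.symm h)
  · rw [sub_eq_add_neg] at h
    exact Or.inl (key (-d') hf'.symm.neg_right h)

/-- The unit vectors of the lattice. -/
def latticeUnits : Finset (ℤ × ℤ) := {(1, 0), (-1, 0), (0, 1), (0, -1)}

/-- The total length of the rays from `v` that are explored, if `v` has degree two. -/
noncomputable def rayCost (G : SimpleGraph V) [DecidableRel G.Adj] (φ : V → ℤ × ℤ) (v : V) : ℕ :=
  if G.degree v = 2 then ∑ d ∈ latticeUnits, (rayVertices G φ v d).card else 0

lemma card_ray_le_rayCost (hv : G.degree v = 2) (hd : d ∈ latticeUnits) :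
    (rayVertices G φ v d).card ≤ rayCost G φ v := by
  rw [rayCost, if_pos hv]
  exact Finset.single_le_sum (f := fun d => (rayVertices G φ v d).card)
    (fun _ _ => Nat.zero_le _) hd

/-- In a fixed direction a vertex lies on the ray of at most one vertex of degree two: of two
starting vertices, the nearer would be an inner position of the ray of the other, where the degree
must be three. Unoccupied positions on a ray do no harm to this argument. There are four directions.
-/
lemma sum_rayCost_le (hφ : IsGridEmbedding G φ) :
    ∑ v, rayCost G φ v ≤ 4 * Fintype.card V := by
  classical
  have h1 : ∑ v, rayCost G φ v = ∑ d ∈ latticeUnits,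
      ∑ v ∈ Finset.univ.filter (fun v => G.degree v = 2), (rayVertices G φ v d).card := by
    rw [Finset.sum_comm, Finset.sum_filter]
    rfl
  have h2 : ∀ d ∈ latticeUnits,
      ∑ v ∈ Finset.univ.filter (fun v => G.degree v = 2), (rayVertices G φ v d).card ≤
        Fintype.card V := by
    intro d hd
    have h3 := Finset.sum_card_bipartiteAbove_eq_sum_card_bipartiteBelow
      (s := Finset.univ.filter (fun v => G.degree v = 2)) (t := (Finset.univ : Finset V))
      (fun v u => u ∈ rayVertices G φ v d)
    have h4 : ∀ v, (Finset.univ : Finset V).bipartiteAbove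
        (fun v u => u ∈ rayVertices G φ v d) v = rayVertices G φ v d := by
      intro v
      ext u
      simp [Finset.bipartiteAbove]
    simp only [h4] at h3
    rw [h3, ← Finset.card_univ, Finset.card_eq_sum_ones]
    refine Finset.sum_le_sum fun u _ => Finset.card_le_one.2 fun v₁ hv₁ v₂ hv₂ => ?_
    simp only [Finset.bipartiteBelow, Finset.mem_filter, Finset.mem_univ, true_and,
      mem_rayVertices] at hv₁ hv₂
    obtain ⟨hd₁, i₁, hi₁, e₁, f₁⟩ := hv₁
    obtain ⟨hd₂, i₂, hi₂, e₂, f₂⟩ := hv₂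
    have no : ∀ v₁ v₂ : V, ∀ i₁ i₂ : ℕ, G.degree v₁ = 2 → 1 ≤ i₁ → φ u = φ v₁ + (i₁ : ℤ) • d →
        φ u = φ v₂ + (i₂ : ℤ) • d → (∀ j : ℕ, 1 ≤ j → j < i₂ → ∀ u',
          φ u' = φ v₂ + (j : ℤ) • d → G.degree u' = 3) → ¬ i₁ < i₂ := by
      intro v₁ v₂ i₁ i₂ hd₁ hi₁ e₁ e₂ f₂ hlt
      have := f₂ (i₂ - i₁) (by omega) (by omega) v₁ (by
        have e3 : φ v₁ = φ u - (i₁ : ℤ) • d := by rw [e₁]; abel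
        rw [e3, e₂, Nat.cast_sub hlt.le, sub_smul]; abel)
      omega
    have n₁ := no v₁ v₂ i₁ i₂ hd₁ hi₁ e₁ e₂ f₂
    have n₂ := no v₂ v₁ i₂ i₁ hd₂ hi₂ e₂ e₁ f₁
    obtain rfl : i₁ = i₂ := by omega
    exact hφ.injective (add_right_cancel (e₁.symm.trans e₂))
  rw [h1]
  calc _ ≤ ∑ d ∈ latticeUnits, Fintype.card V := Finset.sum_le_sum h2
    _ = 4 * Fintype.card V := by
      rw [Finset.sum_const, smul_eq_mul]
      rfl

end Follow

/-! ### The algorithm -/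

/-- Follow a ladder by one step. -/
def followStep : RamProgram :=
  .seq findCommon (.ite (.eq 30 1)
    (.seq (.instr (.add 38 6 1)) (.seq (.instr (.load 33 0 38)) (.seq (.instr (.load 32 0 6))
      (.seq (.instr (.sub 40 33 32)) (.ite (.eq 40 2)
        (.seq (.instr (.store 2 4 1)) (.instr (.const 8 0)))
        (.ite (.eq 40 3)
          (.seq findThird (.seq (.instr (.copy 5 6)) (.seq (.instr (.copy 6 39))
            (.instr (.copy 7 31)))))
          (.instr (.const 8 0))))))))
    (.instr (.const 8 0)))

/-- Follow a ladder from the vertex in register `4`, in direction of the vertex in register `6` and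
next to the vertex in register `7`, and mark it if the other end is reached. -/
def follow : RamProgram :=
  .seq (.instr (.const 8 1)) (.seq (.instr (.copy 5 4)) (.while (.eq 8 1) followStep))

/-- Decide whether the vertex in register `4` is an output vertex. -/
def treatVertex : RamProgram :=
  .seq (.instr (.add 38 4 1)) (.seq (.instr (.load 33 0 38)) (.seq (.instr (.load 32 0 4))
    (.seq (.instr (.sub 40 33 32)) (.ite (.lt 40 2) (.instr (.store 2 4 1)) (.ite (.eq 40 2)
      (.seq (.instr (.load 20 1 32)) (.seq (.instr (.add 38 32 1)) (.seq (.instr (.load 21 1 38))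
        (.seq (.instr (.copy 6 20)) (.seq (.instr (.copy 7 21)) (.seq follow
          (.seq (.instr (.copy 6 21)) (.seq (.instr (.copy 7 20)) follow))))))))
      .skip)))))

/-- Mark all vertices of degree at most one and all ends of ladders. -/
def markCorners : RamProgram :=
  .seq (.instr (.const 1 1)) (.seq (.instr (.const 2 2)) (.seq (.instr (.const 3 3))
    (.seq (.instr (.const 4 0)) (.while (.lt 4 0) (.seq treatVertex (.instr (.add 4 4 1)))))))

/-! ### Correctness and running time of the marking program -/

section Correctness

variable {n : ℕ} {G : SimpleGraph (Fin n)} [DecidableRel G.Adj] {B : ℕ} {s : RamState}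
  {φ : Fin n → ℤ × ℤ}

/-- All registers but `5`, …, `8` below `30`, and all array cells but `(2, v)`, agree. -/
structure SameOutside (v : ℕ) (s s' : RamState) : Prop where
  reg : ∀ r < 30, r ≠ 5 → r ≠ 6 → r ≠ 7 → r ≠ 8 → s'.reg r = s.reg r
  arr : ∀ a j, ¬ (a = 2 ∧ j = v) → s'.arr a j = s.arr a j

lemma SameOutside.refl (v : ℕ) (s : RamState) : SameOutside v s s :=
  ⟨fun _ _ _ _ _ _ => rfl, fun _ _ _ => rfl⟩

lemma SameOutside.trans {v : ℕ} {s s' s'' : RamState} (h : SameOutside v s s')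
    (h' : SameOutside v s' s'') : SameOutside v s s'' :=
  ⟨fun r h1 h2 h3 h4 h5 => (h'.reg r h1 h2 h3 h4 h5).trans (h.reg r h1 h2 h3 h4 h5),
    fun a j hj => (h'.arr a j hj).trans (h.arr a j hj)⟩

lemma SameOutside.setReg {v : ℕ} {s s' : RamState} (h : SameOutside v s s') {x k : ℕ}
    (hx : x = 5 ∨ x = 6 ∨ x = 7 ∨ x = 8 ∨ 30 ≤ x) : SameOutside v s (s'.setReg x k) := by
  refine ⟨fun r h1 h2 h3 h4 h5 => ?_, h.arr⟩
  rw [RamState.setReg_reg, if_neg (by omega), h.reg r h1 h2 h3 h4 h5]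

lemma SameOutside.setArr {v : ℕ} {s s' : RamState} (h : SameOutside v s s') {k : ℕ} :
    SameOutside v s (s'.setArr 2 v k) := by
  refine ⟨h.reg, fun a j hj => ?_⟩
  rw [RamState.setArr_arr, if_neg hj, h.arr a j hj]

lemma SameFrame.sameOutside {s s' : RamState} (h : SameFrame s s') (v : ℕ) :
    SameOutside v s s' := ⟨fun r hr _ _ _ _ => h.1 r hr, fun a j _ => by rw [h.2]⟩

lemma SameOutside.ready {v : ℕ} {s s' : RamState} (hs : SameOutside v s s') (h : Ready G B s) :
    Ready G B s' := by
  have h0 : s'.arr 0 = s.arr 0 := funext fun j => hs.arr 0 j (by omega)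
  have h1 : s'.arr 1 = s.arr 1 := funext fun j => hs.arr 1 j (by omega)
  refine ⟨by rw [h0, h1]; exact h.graph, ?_, ?_, ?_⟩
  · rw [hs.reg 1 (by norm_num) (by norm_num) (by norm_num) (by norm_num) (by norm_num), h.one]
  · rw [hs.reg 2 (by norm_num) (by norm_num) (by norm_num) (by norm_num) (by norm_num), h.two]
  · rw [hs.reg 3 (by norm_num) (by norm_num) (by norm_num) (by norm_num) (by norm_num), h.three]

lemma runs_degree {x r : ℕ} (hs : Ready G B s) (v : Fin n) (hx : s.reg x = v)
    (h33 : x ≠ 33) (h38 : x ≠ 38) {T : ℕ} {p : RamProgram} {Q : RamState → Prop} (hr : 38 < r)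
    (h : ∀ s', SameFrame s s' → s'.reg 30 = s.reg 30 → s'.reg 31 = s.reg 31 →
      s'.reg 32 = s.arr 0 v → s'.reg r = G.degree v → Runs B p s' T Q) :
    Runs B (.seq (.instr (.add 38 x 1)) (.seq (.instr (.load 33 0 38))
      (.seq (.instr (.load 32 0 x)) (.seq (.instr (.sub r 33 32)) p)))) s (T + 4) Q := by
  have hv1 : (v : ℕ) + 1 ≤ n := v.isLt
  have hstep := hs.graph.step v
  have hb := hs.graph.bound _ hv1
  have hsize := hs.graph.size
  refine Runs.instr_seq ?_ (Runs.instr_seq ?_ (Runs.instr_seq ?_ (Runs.instr_seq ?_ (h _ ?_ ?_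
    ?_ ?_ ?_))))
  · simp only [RamInstr.value, hx, hs.one]; omega
  · simp [RamInstr.value, RamInstr.run, hx, hs.one]; omega
  · simp [RamInstr.value, RamInstr.run, hx, hs.one, h33, h38]; omega
  · simp [RamInstr.value, RamInstr.run, hx, hs.one, h33, h38]; omega
  · exact ((((SameFrame.refl s).setReg (by omega)).setReg (by omega)).setReg (by omega)).setReg
      (by omega)
  · simp [RamInstr.run, show (30 : ℕ) ≠ r by omega]
  · simp [RamInstr.run, show (31 : ℕ) ≠ r by omega]
  · simp [RamInstr.run, RamInstr.value, show (32 : ℕ) ≠ r by omega, hx, h33, h38]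
  · simp [RamInstr.run, RamInstr.value, hx, hs.one, h33, h38]; omega

/-- The outcome of following a ladder from `v`. -/
structure Followed (φ : Fin n → ℤ × ℤ) (v : Fin n) (d e : ℤ × ℤ) (s s' : RamState) : Prop where
  same : SameOutside v s s'
  success : (∃ k, IsLadder (Set.range φ) (φ v) d e k) → s'.arr 2 v = 1
  failure : (¬ ∃ k, IsLadder (Set.range φ) (φ v) d e k) → s'.arr 2 v = s.arr 2 v

/-- The invariant of the search, where `m` bounds the number of remaining steps. -/
def FollowInv (G : SimpleGraph (Fin n)) [DecidableRel G.Adj] (φ : Fin n → ℤ × ℤ) (v : Fin n)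
    (d e : ℤ × ℤ) (s : RamState) (m : ℕ) (s' : RamState) : Prop :=
  (s'.reg 8 = 0 ∧ Followed φ v d e s s') ∨
    (s'.reg 8 = 1 ∧ SameOutside v s s' ∧ s'.arr 2 v = s.arr 2 v ∧ ∃ w x z : Fin n,
      s'.reg 5 = w ∧ s'.reg 6 = x ∧ s'.reg 7 = z ∧
      ((∃ i, m + i = (rayVertices G φ v d).card + 1 ∧ FollowsLadder G φ v d e i w x z) ∨
        (0 < m ∧ LeftLadder φ v d e w x z)))

lemma runs_followStep (hφ : IsGridEmbedding G φ) (hs : Ready G B s) {v : Fin n}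
    (hv : s.reg 4 = v) {d e : ℤ × ℤ} {m : ℕ} {s' : RamState} (h : FollowInv G φ v d e s m s')
    (h8 : s'.reg 8 = 1) :
    Runs B followStep s' 300 fun s'' => ∃ m' < m, FollowInv G φ v d e s m' s'' := by
  obtain ⟨h0, -⟩ | ⟨-, hsame, h2, w, x, z, hw, hx, hz, hstate⟩ := h
  · omega
  have hr := hsame.ready hs
  have hsize := hs.graph.size
  have hm : 0 < m := by
    rcases hstate with ⟨i, hi, hF⟩ | ⟨hm, -⟩
    · have := hF.succ_le_card_ray
      omega
    · exact hm
  have fail : ∀ s'' : RamState, SameOutside v s s'' → s''.arr 2 v = s.arr 2 v →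
      (¬ ∃ k, IsLadder (Set.range φ) (φ v) d e k) → ∀ T, Runs B (.instr (.const 8 0)) s'' (T + 1)
        fun s'' => ∃ m' < m, FollowInv G φ v d e s m' s'' := by
    intro s'' h3 h4 hno T
    refine Runs.instr (by simp [RamInstr.value]) ⟨0, hm, Or.inl ⟨by simp [RamInstr.run,
      RamInstr.value], ?_, fun h => absurd h hno, fun _ => h4⟩⟩
    exact h3.setReg (by norm_num)
  refine Runs.mono (Runs.seq (T' := 99) (Runs.mono (runs_findCommon hr hw hx hz) le_rfl ?_))
    (by norm_num) fun _ h => h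
  rintro s₁ ⟨hf, hres⟩
  have hr₁ := hr.of_sameFrame hf
  have hsame₁ := hsame.trans (hf.sameOutside v)
  have h2₁ : s₁.arr 2 v = s.arr 2 v := by rw [hf.2, h2]
  refine Runs.ite (T := 98) (fun hb => ?_) fun hb => ?_
  · have h30 : s₁.reg 30 = s₁.reg 1 := hb
    rw [hr₁.one] at h30
    obtain ⟨-, y, hy, hxy, hzy, hyw⟩ := hres.resolve_left fun h => by omega
    -- Since a common neighbour other than `w` was found, the search has not left the row.
    obtain ⟨i, hi, hF⟩ : ∃ i, m + i = (rayVertices G φ v d).card + 1 ∧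
        FollowsLadder G φ v d e i w x z := by
      refine hstate.resolve_right ?_
      rintro ⟨-, ⟨⟨a, b, hab, hxa, hza⟩, -⟩⟩
      exact hyw (hφ.eq_of_common_neighbor_opposite hab hxa hza hxy hzy)
    refine runs_degree (T := 94) hr₁ x (by rw [hf.1 6 (by norm_num), hx]) (by norm_num)
      (by norm_num) (by norm_num) fun s₂ hf₂ _ h31 _ h40 => ?_
    have hr₂ := hr₁.of_sameFrame hf₂
    have hsame₂ := hsame₁.trans (hf₂.sameOutside v)
    have h2₂ : s₂.arr 2 v = s.arr 2 v := by rw [hf₂.2, h2₁]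
    rw [hy] at h31
    refine Runs.ite (T := 93) (fun hb => ?_) fun hb => ?_
    · have hdeg : s₂.reg 40 = s₂.reg 2 := hb
      rw [h40, hr₂.two] at hdeg
      have hv₂ : s₂.reg 4 = v := by
        rw [hsame₂.reg 4 (by norm_num) (by norm_num) (by norm_num) (by norm_num) (by norm_num), hv]
      refine Runs.instr_seq (T := 92) (by simp only [RamInstr.value, hr₂.one]; omega) ?_
      refine Runs.instr (T := 91) (by simp [RamInstr.value]) ⟨0, hm, Or.inl ⟨by
        simp [RamInstr.run, RamInstr.value], ?_, fun _ => ?_, fun hno => ?_⟩⟩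
      · simp only [RamInstr.run, RamInstr.value, hv₂]
        exact hsame₂.setArr.setReg (by norm_num)
      · simp [RamInstr.run, RamInstr.value, hv₂, RamState.setArr_arr, hr₂.one]
      · exact absurd ⟨_, hF.ladder_of_degree hφ hxy hzy hyw hdeg⟩ hno
    · have hdeg : ¬ s₂.reg 40 = s₂.reg 2 := hb
      rw [h40, hr₂.two] at hdeg
      refine Runs.ite (T := 92) (fun hb' => ?_) fun hb' => ?_
      · have hdeg' : s₂.reg 40 = s₂.reg 3 := hb'
        rw [h40, hr₂.three] at hdeg'
        refine Runs.mono (Runs.seq (T' := 3) (Runs.mono (runs_findThird hr₂ (w := w) (x := x)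
          (y := y) ?_ ?_ h31 (exists_third_neighbor hdeg' w y)) le_rfl ?_)) (by norm_num)
          fun _ h => h
        · rw [hf₂.1 5 (by norm_num), hf.1 5 (by norm_num), hw]
        · rw [hf₂.1 6 (by norm_num), hf.1 6 (by norm_num), hx]
        · rintro s₃ ⟨hf₃, h31', u, hu, hxu, huw, huy⟩
          have hx₃ : s₃.reg 6 = x := by
            rw [hf₃.1 6 (by norm_num), hf₂.1 6 (by norm_num), hf.1 6 (by norm_num), hx]
          refine Runs.instr_seq (T := 2) (by simp only [RamInstr.value, hx₃]; omega) ?_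
          refine Runs.instr_seq (T := 1) (by simp [RamInstr.value, RamInstr.run, hu]; omega) ?_
          refine Runs.instr (T := 0) (by simp [RamInstr.value, RamInstr.run, h31']; omega) ?_
          have hsame₃ := hsame₂.trans (hf₃.sameOutside v)
          simp only [RamInstr.run, RamInstr.value]
          refine ⟨m - 1, by omega, Or.inr ⟨?_, ?_, ?_, x, u, y, ?_, ?_, ?_, ?_⟩⟩
          · simp [hf₃.1 8, hf₂.1 8, hf.1 8, h8]
          · exact ((hsame₃.setReg (by norm_num)).setReg (by norm_num)).setReg (by norm_num)
          · simp only [RamState.setReg_arr]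
            rw [hf₃.2, h2₂]
          · simp [hx₃]
          · simp [hu]
          · simp [h31']
          -- Here `m` is at least two: the `+ 1` in the variant is kept for one failing step after
          -- the row has been left, so `m - 1` is still positive.
          · have := hF.succ_le_card_ray
            rcases hF.step hφ hxy hzy hyw hdeg' hxu huw huy with h | h
            · exact Or.inl ⟨i + 1, by omega, h⟩
            · exact Or.inr ⟨by omega, h⟩
      · have hdeg' : ¬ s₂.reg 40 = s₂.reg 3 := hb'
        rw [h40, hr₂.three] at hdeg'
        exact fail s₂ hsame₂ h2₂ (hF.not_ladder_of_degree hφ hdeg hdeg') 91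
  · have h30 : ¬ s₁.reg 30 = s₁.reg 1 := hb
    rw [hr₁.one] at h30
    obtain ⟨-, hno⟩ := hres.resolve_right fun h => h30 h.1
    refine fail s₁ hsame₁ h2₁ ?_ 97
    rcases hstate with ⟨i, -, hF⟩ | ⟨-, hL⟩
    · exact hF.not_ladder_of_common hφ hno
    · exact hL.not_ladder

/-- The variant starts at one more than the size of the ray, and an iteration costs at most `301`
steps including the test. -/
lemma runs_follow (hφ : IsGridEmbedding G φ) (hs : Ready G B s) {v p q : Fin n}
    (hv : s.reg 4 = v) (hp : s.reg 6 = p) (hq : s.reg 7 = q) (hdeg : G.degree v = 2)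
    (hvp : G.Adj v p) (hvq : G.Adj v q) (hpq : p ≠ q) :
    Runs B follow s (301 * (rayVertices G φ v (φ p - φ v)).card + 304)
      (Followed φ v (φ p - φ v) (φ q - φ v) s) := by
  have hsize := hs.graph.size
  set R := (rayVertices G φ v (φ p - φ v)).card with hR
  refine Runs.mono (Runs.instr_seq (T := 301 * (R + 1) + 2) (by simp [RamInstr.value]; omega)
    (Runs.instr_seq (T := 301 * (R + 1) + 1) (by simp [RamInstr.value, RamInstr.run, hv]; omega)
    (Runs.mono (Runs.while_variant (T := 300) (m := R + 1)
      (Inv := FollowInv G φ v (φ p - φ v) (φ q - φ v) s) ?_ ?_) le_rfl ?_)))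
    (by omega) fun _ h => h
  · intro m s' hm hb
    have hb' : s'.reg 8 = s'.reg 1 := hb
    have h1 : s'.reg 1 = 1 := by
      rcases hm with ⟨-, hm⟩ | ⟨-, hm, -⟩
      · exact (hm.same.ready hs).one
      · exact (hm.ready hs).one
    exact runs_followStep hφ hs hv hm (hb'.trans h1)
  · simp only [RamInstr.run, RamInstr.value]
    refine Or.inr ⟨by simp, ?_, rfl, v, p, q, by simp [hv], by simp [hp], by simp [hq], ?_⟩
    · exact ((SameOutside.refl v s).setReg (by norm_num)).setReg (by norm_num)
    · rcases start_followsLadder hφ hdeg hvp hvq hpq with h | h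
      · exact Or.inl ⟨0, by omega, h⟩
      · exact Or.inr ⟨by omega, h⟩
  · rintro s' ⟨hb, m, ⟨-, h⟩ | ⟨h8, hm, -⟩⟩
    · exact h
    · exact absurd (h8.trans (hm.ready hs).one.symm) hb

/-- The vertices that the algorithm outputs. -/
def IsOutput (G : SimpleGraph (Fin n)) [DecidableRel G.Adj] (φ : Fin n → ℤ × ℤ) (v : Fin n) :
    Prop := G.degree v = 0 ∨ IsCornerVertex G φ v

/-- The frame of a ladder from `v` points to the two neighbours of `v`, so two searches, one for
each order of the neighbours, decide the question. -/
lemma isOutput_iff_of_degree_two (hφ : IsGridEmbedding G φ) {v p q : Fin n}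
    (hdeg : G.degree v = 2) (hvp : G.Adj v p) (hvq : G.Adj v q) (hpq : p ≠ q) :
    IsOutput G φ v ↔ (∃ k, IsLadder (Set.range φ) (φ v) (φ p - φ v) (φ q - φ v) k) ∨
      ∃ k, IsLadder (Set.range φ) (φ v) (φ q - φ v) (φ p - φ v) k := by
  constructor
  · rintro (h | h | ⟨d, e, k, hL⟩)
    · omega
    · omega
    · obtain ⟨a, ha⟩ := hL.row 1 hL.one_le
      obtain ⟨b, hb⟩ := hL.top 0 (Nat.zero_le _)
      simp only [Nat.cast_one, one_smul, Nat.cast_zero, zero_smul, add_zero] at ha hb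
      have hva : G.Adj v a := (hφ.adj_iff _ _).2 (by rw [ha]; exact hL.frame.latticeAdj _)
      have hvb : G.Adj v b := (hφ.adj_iff _ _).2 (by rw [hb]; exact hL.frame.symm.latticeAdj _)
      have hab : a ≠ b := by
        rintro rfl
        exact hL.frame.ne.1 (add_left_cancel (ha.symm.trans hb))
      have hN : G.neighborFinset v = {p, q} := by
        refine (Finset.eq_of_subset_of_card_le ?_ ?_).symm
        · intro u hu
          rw [Finset.mem_insert, Finset.mem_singleton] at hu
          rw [G.mem_neighborFinset]
          rcases hu with rfl | rfl <;> assumption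
        · rw [G.card_neighborFinset_eq_degree, hdeg, Finset.card_pair hpq]
      have ha' : a = p ∨ a = q := by
        rw [← G.mem_neighborFinset, hN, Finset.mem_insert, Finset.mem_singleton] at hva
        exact hva
      have hb' : b = p ∨ b = q := by
        rw [← G.mem_neighborFinset, hN, Finset.mem_insert, Finset.mem_singleton] at hvb
        exact hvb
      have hd : d = φ a - φ v := by rw [ha, add_sub_cancel_left]
      have he : e = φ b - φ v := by rw [hb, add_sub_cancel_left]
      rw [hd, he] at hL
      rcases ha' with rfl | rfl <;> rcases hb' with rfl | rfl
      · exact absurd rfl hab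
      · exact Or.inl ⟨k, hL⟩
      · exact Or.inr ⟨k, hL⟩
      · exact absurd rfl hab
  · rintro (⟨k, hL⟩ | ⟨k, hL⟩) <;> exact Or.inr (Or.inr ⟨_, _, k, hL⟩)

lemma LatticeAdj.sub_mem_units {p q : ℤ × ℤ} (h : LatticeAdj p q) : q - p ∈ latticeUnits := by
  rcases h.cases with rfl | rfl | rfl | rfl <;> simp [latticeUnits]

/-- The outcome of treating the vertex `v`. -/
structure Treated (G : SimpleGraph (Fin n)) [DecidableRel G.Adj] (φ : Fin n → ℤ × ℤ) (v : Fin n)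
    (s s' : RamState) : Prop where
  reg : ∀ r ≤ 4, s'.reg r = s.reg r
  arr : ∀ a j : ℕ, ¬ (a = 2 ∧ j = v) → s'.arr a j = s.arr a j
  mem_iff : s'.arr 2 v ≠ 0 ↔ IsOutput G φ v

lemma runs_treatVertex (hφ : IsGridEmbedding G φ) (hs : Ready G B s) {v : Fin n}
    (hv : s.reg 4 = v) (h0 : s.arr 2 v = 0) :
    Runs B treatVertex s (602 * rayCost G φ v + 700) (Treated G φ v s) := by
  have hsize := hs.graph.size
  refine Runs.mono (runs_degree (T := 602 * rayCost G φ v + 696) hs v hv (by norm_num)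
    (by norm_num) (by norm_num) fun s₁ hf₁ _ _ h32 h40 => ?_) (by omega) fun _ h => h
  have hr₁ := hs.of_sameFrame hf₁
  refine Runs.ite (T := 602 * rayCost G φ v + 695) (fun hb => ?_) fun hb => ?_
  · have hdeg : s₁.reg 40 < s₁.reg 2 := hb
    rw [h40, hr₁.two] at hdeg
    refine Runs.instr (T := 602 * rayCost G φ v + 694)
      (by simp only [RamInstr.value, hr₁.one]; omega) ⟨fun r hr => ?_, fun a j hj => ?_, ?_⟩
    · simp [RamInstr.run, hf₁.1 r (by omega)]
    · simp only [RamInstr.run, hf₁.1 4 (by norm_num), hv, RamState.setArr_arr, if_neg hj, hf₁.2]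
    · simp only [RamInstr.run, RamInstr.value, hf₁.1 4 (by norm_num), hv, RamState.setArr_arr,
        hr₁.one]
      simp only [and_self, if_true, ne_eq, one_ne_zero, not_false_eq_true, true_iff]
      rcases (show G.degree v = 0 ∨ G.degree v = 1 by omega) with h | h
      · exact Or.inl h
      · exact Or.inr (Or.inl h)
  · have hdeg : ¬ s₁.reg 40 < s₁.reg 2 := hb
    rw [h40, hr₁.two] at hdeg
    refine Runs.ite (T := 602 * rayCost G φ v + 694) (fun hb' => ?_) fun hb' => ?_
    · have hdeg2 : s₁.reg 40 = s₁.reg 2 := hb'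
      rw [h40, hr₁.two] at hdeg2
      have hstep := hs.graph.step v
      rw [hdeg2] at hstep
      have hb : s.arr 0 (v + 1) ≤ B := hs.graph.bound _ v.isLt
      obtain ⟨p, hvp, hp⟩ := hs.graph.sound v (s.arr 0 v) le_rfl (by omega)
      obtain ⟨q, hvq, hq⟩ := hs.graph.sound v (s.arr 0 v + 1) (by omega) (by omega)
      -- `StoresGraph` does not exclude repetitions, but equal entries would make the list too short
      -- for two neighbours.
      have hpq : p ≠ q := by
        rintro rfl
        have hsub : G.neighborFinset v ⊆ {p} := by
          intro u hu
          obtain ⟨k, h1, h2, h3⟩ := hs.graph.complete v u ((G.mem_neighborFinset _ _).1 hu)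
          rw [Finset.mem_singleton]
          refine Fin.ext ?_
          rcases (show k = s.arr 0 v ∨ k = s.arr 0 v + 1 by omega) with rfl | rfl
          · exact h3.symm.trans hp
          · exact h3.symm.trans hq
        have := Finset.card_le_card hsub
        rw [G.card_neighborFinset_eq_degree, hdeg2] at this
        simp at this
      set C := rayCost G φ v with hC
      have hcp : (rayVertices G φ v (φ p - φ v)).card ≤ C := card_ray_le_rayCost hdeg2
        (LatticeAdj.sub_mem_units ((hφ.adj_iff _ _).1 hvp))
      have hcq : (rayVertices G φ v (φ q - φ v)).card ≤ C := card_ray_le_rayCost hdeg2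
        (LatticeAdj.sub_mem_units ((hφ.adj_iff _ _).1 hvq))
      have ha₁ : s₁.arr = s.arr := hf₁.2
      have hv₁ : s₁.reg 4 = v := by rw [hf₁.1 4 (by norm_num), hv]
      have hone := hr₁.one
      refine Runs.instr_seq (T := 602 * C + 693) (by
        simp [RamInstr.value, ha₁, h32, hp]; omega) ?_
      refine Runs.instr_seq (T := 602 * C + 692) (by
        simp [RamInstr.value, RamInstr.run, h32, hone]; omega) ?_
      refine Runs.instr_seq (T := 602 * C + 691) (by
        simp [RamInstr.value, RamInstr.run, h32, hone, ha₁, hq]; omega) ?_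
      refine Runs.instr_seq (T := 602 * C + 690) (by
        simp [RamInstr.value, RamInstr.run, ha₁, h32, hp]; omega) ?_
      refine Runs.instr_seq (T := 602 * C + 689) (by
        simp [RamInstr.value, RamInstr.run, h32, hone, ha₁, hq]; omega) ?_
      simp only [RamInstr.value, RamInstr.run]
      set s₂ := ((((s₁.setReg 20 _).setReg 38 _).setReg 21 _).setReg 6 _).setReg 7 _ with hs₂
      have ha₂ : s₂.arr = s.arr := by rw [hs₂]; simp [ha₁]
      have g₂ : ∀ r ≤ 4, s₂.reg r = s.reg r := by
        intro r hr
        rw [hs₂, ← hf₁.1 r (by omega)]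
        simp only [RamState.setReg_reg]
        rw [if_neg (by omega), if_neg (by omega), if_neg (by omega), if_neg (by omega),
          if_neg (by omega)]
      have hr₂ : Ready G B s₂ := ⟨by rw [ha₂]; exact hs.graph,
        by rw [g₂ 1 (by norm_num), hs.one], by rw [g₂ 2 (by norm_num), hs.two],
        by rw [g₂ 3 (by norm_num), hs.three]⟩
      have h6 : s₂.reg 6 = p := by rw [hs₂]; simp [ha₁, h32, hp]
      have h7 : s₂.reg 7 = q := by rw [hs₂]; simp [ha₁, h32, hone, hq]
      have h20 : s₂.reg 20 = p := by rw [hs₂]; simp [ha₁, h32, hp]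
      have h21 : s₂.reg 21 = q := by rw [hs₂]; simp [ha₁, h32, hone, hq]
      have hv₂ : s₂.reg 4 = v := by rw [g₂ 4 le_rfl, hv]
      clear_value s₂
      refine Runs.mono (Runs.seq (T' := 301 * C + 306) (Runs.mono
        (runs_follow hφ hr₂ hv₂ h6 h7 hdeg2 hvp hvq hpq) (T' := 301 * C + 304)
        (by omega) ?_)) (by omega) fun _ h => h
      intro s₃ hF
      have k₃ : ∀ r, r < 30 → r ≠ 5 → r ≠ 6 → r ≠ 7 → r ≠ 8 → s₃.reg r = s₂.reg r := hF.same.reg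
      have h20₃ : s₃.reg 20 = p := by
        rw [k₃ 20 (by norm_num) (by norm_num) (by norm_num) (by norm_num) (by norm_num), h20]
      have h21₃ : s₃.reg 21 = q := by
        rw [k₃ 21 (by norm_num) (by norm_num) (by norm_num) (by norm_num) (by norm_num), h21]
      refine Runs.instr_seq (T := 301 * C + 305) (by
        simp only [RamInstr.value, h21₃]; omega) ?_
      refine Runs.instr_seq (T := 301 * C + 304) (by
        simp [RamInstr.value, RamInstr.run, h20₃]; omega) ?_
      simp only [RamInstr.value, RamInstr.run]
      set s₄ := (s₃.setReg 6 _).setReg 7 _ with hs₄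
      have hO : SameOutside v s₃ s₄ :=
        ((SameOutside.refl v s₃).setReg (by norm_num)).setReg (by norm_num)
      have ha₄ : s₄.arr = s₃.arr := rfl
      have hr₄ := hO.ready (hF.same.ready hr₂)
      have hv₄ : s₄.reg 4 = v := by
        rw [hO.reg 4 (by norm_num) (by norm_num) (by norm_num) (by norm_num) (by norm_num),
          k₃ 4 (by norm_num) (by norm_num) (by norm_num) (by norm_num) (by norm_num), hv₂]
      have h6₄ : s₄.reg 6 = q := by rw [hs₄]; simp [h21₃]
      have h7₄ : s₄.reg 7 = p := by rw [hs₄]; simp [h20₃]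
      clear_value s₄
      refine Runs.mono (runs_follow hφ hr₄ hv₄ h6₄ h7₄ hdeg2 hvq hvp hpq.symm)
        (by omega) fun s₅ hF' => ?_
      have hall := (hF.same.trans hO).trans hF'.same
      refine ⟨fun r hr => ?_, fun a j hj => ?_, ?_⟩
      · rw [hall.reg r (by omega) (by omega) (by omega) (by omega) (by omega), g₂ r hr]
      · rw [hall.arr a j hj, ha₂]
      -- A failing second search leaves the cell alone, so a mark set by the first one survives; the
      -- cell was zero at the start.
      · rw [isOutput_iff_of_degree_two hφ hdeg2 hvp hvq hpq]
        by_cases hL' : ∃ k, IsLadder (Set.range φ) (φ v) (φ q - φ v) (φ p - φ v) k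
        · simp only [hF'.success hL', hL', or_true, iff_true]
          norm_num
        · rw [hF'.failure hL', ha₄]
          by_cases hL : ∃ k, IsLadder (Set.range φ) (φ v) (φ p - φ v) (φ q - φ v) k
          · simp only [hF.success hL, hL, true_or, iff_true]
            norm_num
          · simp only [hF.failure hL, ha₂, h0, hL, hL', or_self, iff_false]
            norm_num
    · have hdeg2 : ¬ s₁.reg 40 = s₁.reg 2 := hb'
      rw [h40, hr₁.two] at hdeg2
      refine Runs.skip (T := 602 * rayCost G φ v + 693) ⟨fun r hr => hf₁.1 r (by omega),
        fun a j _ => by rw [hf₁.2], ?_⟩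
      rw [hf₁.2, h0]
      refine iff_of_false (fun h => h rfl) ?_
      rintro (h | h | ⟨d, e, k, hL⟩)
      · omega
      · omega
      · exact hdeg2 (hL.degree_start hφ)

/-- The vertex `v` costs `602 * rayCost G φ v + 702` steps with loop overhead, and the ray costs add
up to at most `4 * n`. This gives `3110 * n` steps and a constant number of further ones. -/
lemma runs_markCorners (hφ : IsGridEmbedding G φ) (hg : StoresGraph G B (s.arr 0) (s.arr 1))
    (hn : s.reg 0 = n) (h2 : ∀ j, s.arr 2 j = 0) :
    Runs B markCorners s (4000 * (n + 1)) fun s' => vertexOutput n s' = {v | IsOutput G φ v} := by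
  have hsize := hg.size
  set Inv : ℕ → RamState → Prop := fun k s' => Ready G B s' ∧
    (∀ v : Fin n, (v : ℕ) < k → (s'.arr 2 v ≠ 0 ↔ IsOutput G φ v)) ∧
    ∀ j, k ≤ j → s'.arr 2 j = 0 with hInv
  set cost : ℕ → ℕ := fun k => if h : k < n then 602 * rayCost G φ ⟨k, h⟩ + 701 else 0 with hcost
  have htime : ∑ k ∈ Finset.Ico 0 n, (cost k + 1) + 1 + 4 ≤ 4000 * (n + 1) := by
    have h3 : ∑ k ∈ Finset.Ico 0 n, (cost k + 1) =
        ∑ v : Fin n, (602 * rayCost G φ v + 702) := by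
      rw [Nat.Ico_zero_eq_range, ← Fin.sum_univ_eq_sum_range]
      refine Finset.sum_congr rfl fun v _ => ?_
      simp [hcost]
    have h4 := sum_rayCost_le (G := G) hφ
    rw [h3, Finset.sum_add_distrib, ← Finset.mul_sum]
    simp only [Finset.sum_const, Finset.card_univ, Fintype.card_fin, smul_eq_mul] at h4 ⊢
    omega
  refine Runs.mono (Runs.instr_seq (by simp [RamInstr.value]; omega) (Runs.instr_seq
    (by simp [RamInstr.value]; omega) (Runs.instr_seq (by simp [RamInstr.value]; omega)
    (Runs.instr_seq (by simp [RamInstr.value]) (Runs.while_range (lo := 0) (hi := n) (Inv := Inv)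
    (cost := cost) ?_ ?_ ?_ ?_ (Nat.zero_le _)))))) htime ?_
  · rintro k s' - hk ⟨hr, hdone, hzero⟩ h4 h0
    have hc : cost k = 602 * rayCost G φ ⟨k, hk⟩ + 700 + 1 := by simp [hcost, hk]
    rw [hc]
    refine Runs.seq (Runs.mono (runs_treatVertex (v := ⟨k, hk⟩) hφ hr h4 (hzero k le_rfl)) le_rfl
      fun s'' hT => ?_)
    have hr'' : Ready G B s'' := by
      have a0 : s''.arr 0 = s'.arr 0 := funext fun j => hT.arr 0 j (by omega)
      have a1 : s''.arr 1 = s'.arr 1 := funext fun j => hT.arr 1 j (by omega)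
      exact ⟨by rw [a0, a1]; exact hr.graph, by rw [hT.reg 1 (by norm_num), hr.one],
        by rw [hT.reg 2 (by norm_num), hr.two], by rw [hT.reg 3 (by norm_num), hr.three]⟩
    have h4'' : s''.reg 4 = k := by rw [hT.reg 4 le_rfl, h4]
    refine Runs.instr (T := 0) (by simp only [RamInstr.value, h4'', hr''.one]; omega) ?_
    simp only [RamInstr.run, RamInstr.value]
    refine ⟨⟨⟨hr''.graph, by simp [hr''.one], by simp [hr''.two], by simp [hr''.three]⟩,
      fun v hv => ?_, fun j hj => ?_⟩, by simp [h4'', hr''.one], ?_⟩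
    · rw [RamState.setReg_arr]
      rcases (show (v : ℕ) < k ∨ (v : ℕ) = k by omega) with h | h
      · rw [hT.arr 2 v (fun h' => h.ne h'.2)]
        exact hdone v h
      · obtain rfl : v = ⟨k, hk⟩ := Fin.ext h
        exact hT.mem_iff
    · rw [RamState.setReg_arr, hT.arr 2 j (fun h' => by have := h'.2; simp at this; omega)]
      exact hzero j (by omega)
    · simp only [RamState.setReg_reg]
      rw [if_neg (by norm_num), hT.reg 0 (by norm_num), h0]
  · refine ⟨⟨hg, ?_, ?_, ?_⟩, fun v hv => absurd hv (Nat.not_lt_zero _), fun j _ => h2 j⟩ <;>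
      simp [RamInstr.run, RamInstr.value]
  · simp [RamInstr.run, RamInstr.value]
  · simp [RamInstr.run, hn]
  · rintro s' ⟨-, hdone, -⟩
    ext v
    exact hdone v v.isLt

end Correctness

/-! ### The input -/

lemma flatten_getElem?_of_sum {α : Type*} (L : List (List α)) {i : ℕ} (hi : i < L.length) {j : ℕ}
    (hj : j < L[i].length) :
    L.flatten[((L.take i).map List.length).sum + j]? = some L[i][j] := by
  induction L generalizing i with
  | nil => simp at hi
  | cons l L ih =>
    cases i with
    | zero =>
      simp only [List.getElem_cons_zero] at hj
      simp [List.getElem?_append_left hj]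
    | succ i =>
      have := ih (i := i) (by simpa using hi) (by simpa using hj)
      simp only [List.take_succ_cons, List.map_cons, List.sum_cons, List.flatten_cons, add_assoc,
        List.getElem_cons_succ]
      rw [List.getElem?_append_right (by omega), Nat.add_sub_cancel_left, this]

lemma IsGridEmbedding.degree_le_four {V : Type*} [Fintype V] {G : SimpleGraph V}
    [DecidableRel G.Adj] {φ : V → ℤ × ℤ} (hφ : IsGridEmbedding G φ) (v : V) : G.degree v ≤ 4 := by
  classical
  rw [hφ.degree_eq (d := (1, 0)) (n := (0, 1)) (by simp [IsFrame]) v]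
  split_ifs <;> omega

/-- Degrees are at most four, so all positions in the concatenated lists are at most `4 * n`. This
is why words of value `4 * n + 4` suffice. -/
lemma storesGraph_graphInput {n : ℕ} {G : SimpleGraph (Fin n)} [DecidableRel G.Adj]
    {φ : Fin n → ℤ × ℤ} (hφ : IsGridEmbedding G φ) {adj : Fin n → List (Fin n)}
    (hadj : IsAdjacencyList G adj) {B : ℕ} (hB : 4 * n + 4 ≤ B) :
    StoresGraph G B ((graphInput adj).arr 0) ((graphInput adj).arr 1) := by
  have hlen : ∀ v, (adj v).length = G.degree v := by
    intro v
    rw [← List.toFinset_card_of_nodup (hadj v).1, ← G.card_neighborFinset_eq_degree]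
    congr 1
    ext w
    rw [List.mem_toFinset, (hadj v).2, G.mem_neighborFinset]
  have hA0 : ∀ i ≤ n, (graphInput adj).arr 0 i =
      (((List.ofFn adj).take i).map List.length).sum := by
    intro i hi
    simp [graphInput, hi]
  have hstep : ∀ v : Fin n,
      (graphInput adj).arr 0 (v + 1) = (graphInput adj).arr 0 v + G.degree v := by
    intro v
    rw [hA0 _ v.isLt, hA0 _ v.isLt.le, List.take_add_one]
    simp [hlen]
  have hA1 : ∀ (v : Fin n) (j : ℕ) (hj : j < (adj v).length),
      (graphInput adj).arr 1 ((graphInput adj).arr 0 v + j) = ((adj v)[j] : Fin n) := by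
    intro v j hj
    have h1 := flatten_getElem?_of_sum (List.ofFn adj) (i := v) (by simp) (j := j) (by simpa)
    rw [← hA0 _ v.isLt.le] at h1
    rw [show (graphInput adj).arr 1 = fun i =>
      (((List.ofFn adj).flatten).map Fin.val).getD i 0 from rfl]
    simp only [List.getD_eq_getElem?_getD, List.getElem?_map, h1]
    simp
  refine ⟨hstep, fun v k h1 h2 => ?_, fun v w hvw => ?_, fun i hi => ?_, hφ.degree_le_four,
    by omega⟩
  · rw [hstep] at h2
    obtain ⟨j, rfl⟩ := Nat.exists_eq_add_of_le h1
    have hj : j < (adj v).length := by rw [hlen]; omega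
    exact ⟨(adj v)[j], ((hadj v).2 _).1 (List.getElem_mem hj), hA1 v j hj⟩
  · obtain ⟨j, hj, rfl⟩ := List.getElem_of_mem (((hadj v).2 w).2 hvw)
    refine ⟨(graphInput adj).arr 0 v + j, by omega, ?_, hA1 v j hj⟩
    rw [hstep, ← hlen]
    omega
  · have h4 : ∀ i ≤ n, (graphInput adj).arr 0 i ≤ 4 * i := by
      intro i
      induction i with
      | zero => simp [hA0]
      | succ i ih =>
        intro hi
        have h5 := hstep ⟨i, hi⟩
        have h6 := hφ.degree_le_four (⟨i, hi⟩ : Fin n)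
        have h7 := ih (by omega)
        simp only at h5
        omega
    have := h4 i hi
    omega

theorem theorem5 :
    -- a linear-time 3-approximation algorithm, which is given the abstract graph only
    (∃ (prog : RamProgram) (c k : ℕ), ∀ (n : ℕ) (G : SimpleGraph (Fin n))
      (adj : Fin n → List (Fin n)), IsSolidGridGraph G → IsAdjacencyList G adj →
        ∃ (t : ℕ) (s : RamState), RamExec ((n + 2) ^ k) prog (graphInput adj) t s ∧
          t ≤ c * (n + 1) ∧
          IsGeodeticSet G (vertexOutput n s) ∧
          (vertexOutput n s).ncard ≤ 3 * geodeticNumber G) ∧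
    -- the corner vertices
    (∀ (V : Type*) [Fintype V] (G : SimpleGraph V) [DecidableRel G.Adj] (φ : V → ℤ × ℤ),
      IsSolidGridEmbedding G φ →
        ((∀ v : V, G.degree v ≠ 0) → IsGeodeticSet G (cornerVertices G φ)) ∧
        (∀ S : Set V, IsGeodeticSet G S → ∀ (u v : V) (P : G.Walk u v), IsCornerPath G φ P →
          ∃ w ∈ P.support, w ∈ S) ∧
        (cornerVertices G φ).ncard ≤ 3 * geodeticNumber G) := by
  classical
  refine ⟨⟨markCorners, 4000, 3, fun n G adj ⟨φ, hs⟩ hadj => ?_⟩,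
    fun V _ G _ φ hs => hs.cornerVertices_spec⟩
  -- A polynomial word bound, that is, words of logarithmic length, also for `n = 0`, where the
  -- constants of the program must still fit.
  have hB : 4 * n + 4 ≤ (n + 2) ^ 3 := by
    nlinarith [Nat.zero_le (n ^ 3), Nat.zero_le (n ^ 2)]
  obtain ⟨t, s, h1, h2, h3⟩ := runs_markCorners (s := graphInput adj) hs.1
    (storesGraph_graphInput hs.1 hadj hB) rfl fun j => rfl
  refine ⟨t, s, h1, h2, ?_⟩
  rw [h3]
  exact ⟨hs.isGeodeticSet_corner, hs.ncard_corner_le⟩
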